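/- Let $\mathrm U,\mathrm V,\mathrm W$ be real Banach spaces, $T>0$, $2\le p<3$, and let $\omega$ be a control on $[0,T]$: a non-negative, super-additive function $\omega_{s,t}$ of $0\le s\le t\le T$ which is continuous at the diagonal (where it vanishes). Tensor products are completed projective ones. A rough path $\mathbf x$ is a path $t\mapsto 1+x_t+\mathbf x^2_t$ from $[0,T]$ to $1\oplus\mathrm U\oplus(\mathrm U\otimes\mathrm U)$ whose increments $\mathbf x_{s,t}=\mathbf x_s^{-1}\otimes\mathbf x_t=1+\mathbf x^1_{s,t}+\mathbf x^2_{s,t}$ satisfy $|\mathbf x^1_{s,t}|\le C\omega_{s,t}^{1/p}$ and $|\mathbf x^2_{s,t}|\le C\omega_{s,t}^{2/p}$ for some constant $C$. For a Banach space $\mathrm E$, write $y_{s,t}=y_t-y_s$; a controlled rough path in $\mathrm P\mathrm E$ is a pair of paths $y:[0,T]\to\mathrm E$, $y^\dag:[0,T]\to L(\mathrm U,\mathrm E)$ such that $|y^\dag_t-y^\dag_s|\le C\omega_{s,t}^{1/p}$ and $|y_{s,t}-y^\dag_s\mathbf x^1_{s,t}|\le C\omega_{s,t}^{2/p}$ for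 some constant $C$. For $z\in\mathrm P\mathrm W$, let $z^\flat_{s,t}\in\mathrm U\otimes\mathrm W$ be the unique family with $z^\flat_{r,s}+z^\flat_{s,t}+\mathbf x^1_{r,s}\otimes z_{s,t}=z^\flat_{r,t}$ for $0\le r\le s\le t\le T$ and $|z^\flat_{s,t}-(\mathrm{id}\otimes z^\dag_s)\mathbf x^2_{s,t}|\le C\omega_{s,t}^{\theta}$ for some $C$ and some $\theta>1$. For $(Y,Y^\dag)$ with values in $L(\mathrm W,\mathrm V)$ and $L(\mathrm U,L(\mathrm W,\mathrm V))\simeq L(\mathrm U\otimes\mathrm W,\mathrm V)$, the integral $\int_0^\cdot Y\,\mathrm dz$ is the unique path $J$ with $J_0=0$ and $|J_{s,t}-Y_sz_{s,t}-Y^\dag_sz^\flat_{s,t}|\le C\omega_{s,t}^{\theta}$ for some $C$ and some $\theta>1$. For an integer $m\ge0$ and $0<\alpha\le1$, a map is of class $\mathcal C^{m+\alpha}$ on an open set if there it is $m$ times continuously Fréchet differentiable with bounded derivatives of orders $0,\dots,m$, the one of order $m$ being $\alpha$-Hölder continuous. Let $k\ge1$ be an integer, $\gamma\in(0,1]$,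 and $\kappa\in(0,1)$ with $2+\kappa\gamma>p$. Let $\mathbf x$ be a rough path, $z\in\mathrm P\mathrm W$, and let $f:\mathrm V\to L(\mathrm W,\mathrm V)$ be of class $\mathcal C^{k+1+\gamma}$ on $\mathrm V$. Then for every $a\in\mathrm V$ there is a unique $\mathfrak I(a,0,f,z)=(y,y^\dag)\in\mathrm P\mathrm V$ that solves $$y_t=a+\int_0^tf(y_s)\,\mathrm dz_s,\qquad y^\dag_t=f(y_t)z^\dag_t,\qquad t\in[0,T],$$ where $f(y)$ is taken with $f(y)^\dag=\mathrm Df(y)y^\dag$. Moreover, for every $t\in(0,T]$, the flow $\mathfrak f_t:\mathrm V\to\mathrm V$ that maps $a$ to the value $y_t$ at time $t$ of $\mathfrak I(a,0,f,z)$ is locally a $\mathcal C^{k+(1-\kappa)\gamma}$-diffeomorphism: every point of $\mathrm V$ has an open neighbourhood $O$ such that $\mathfrak f_t(O)$ is open, $\mathfrak f_t:O\to\mathfrak f_t(O)$ is a bijection, and $\mathfrak f_t$ on $O$ and its inverse on $\mathfrak f_t(O)$ are both of class $\mathcal C^{k+(1-\kappa)\gamma}$. -/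

import Mathlib

open scoped TensorProduct
open Set Filter Topology

/-! ### The completed projective tensor product of two real normed spaces -/

/-- The algebraic tensor product `E ⊗ F`, to be equipped with the projective seminorm. -/
def AlgTensor (E F : Type*) [NormedAddCommGroup E] [NormedSpace ℝ E]
    [NormedAddCommGroup F] [NormedSpace ℝ F] : Type _ := E ⊗[ℝ] F

namespace AlgTensor

variable {E F : Type*} [NormedAddCommGroup E] [NormedSpace ℝ E]
  [NormedAddCommGroup F] [NormedSpace ℝ F]

noncomputable instance : AddCommGroup (AlgTensor E F) :=
  inferInstanceAs (AddCommGroup (E ⊗[ℝ] F))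

noncomputable instance : Module ℝ (AlgTensor E F) :=
  inferInstanceAs (Module ℝ (E ⊗[ℝ] F))

/-- The canonical bilinear map `(a, b) ↦ a ⊗ b`. -/
noncomputable def mk (E F : Type*) [NormedAddCommGroup E] [NormedSpace ℝ E]
    [NormedAddCommGroup F] [NormedSpace ℝ F] : E →ₗ[ℝ] F →ₗ[ℝ] AlgTensor E F :=
  TensorProduct.mk ℝ E F

/-- The tensor `∑ aᵢ ⊗ bᵢ` represented by a finite list of pairs `(aᵢ, bᵢ)`. -/
noncomputable def ofList (l : List (E × F)) : AlgTensor E F :=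
  (l.map fun q => mk E F q.1 q.2).sum

/-- The cost `∑ ‖aᵢ‖ ‖bᵢ‖` of a representation. -/
noncomputable def cost (l : List (E × F)) : ℝ := (l.map fun q => ‖q.1‖ * ‖q.2‖).sum

/-- The projective norm: the infimum of `∑ ‖aᵢ‖ ‖bᵢ‖` over all representations `∑ aᵢ ⊗ bᵢ`. -/
noncomputable def projNorm (t : AlgTensor E F) : ℝ :=
  sInf (cost '' {l : List (E × F) | ofList l = t})

set_option linter.unusedSectionVars false in
theorem cost_nonneg (l : List (E × F)) : 0 ≤ cost l := by
  refine List.sum_nonneg fun a ha => ?_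
  obtain ⟨q, _, rfl⟩ := List.mem_map.1 ha
  positivity

theorem ofList_append (l m : List (E × F)) : ofList (l ++ m) = ofList l + ofList m := by
  simp [ofList]

theorem exists_ofList (t : AlgTensor E F) : ∃ l : List (E × F), ofList l = t := by
  refine TensorProduct.induction_on (motive := fun t => ∃ l : List (E × F), ofList l = t) t
    ⟨[], rfl⟩ (fun a b => ⟨[(a, b)], ?_⟩) ?_
  · simp only [ofList, List.map_cons, List.map_nil, List.sum_cons, List.sum_nil, add_zero]
    rfl
  · rintro _ _ ⟨l, rfl⟩ ⟨m, rfl⟩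
    exact ⟨l ++ m, ofList_append l m⟩

theorem bddBelow_cost (t : AlgTensor E F) :
    BddBelow (cost '' {l : List (E × F) | ofList l = t}) :=
  ⟨0, by rintro _ ⟨l, _, rfl⟩; exact cost_nonneg l⟩

theorem projNorm_ofList_le (l : List (E × F)) : projNorm (ofList l) ≤ cost l :=
  csInf_le (bddBelow_cost _) ⟨l, rfl, rfl⟩

theorem le_projNorm {t : AlgTensor E F} {c : ℝ}
    (h : ∀ l : List (E × F), ofList l = t → c ≤ cost l) : c ≤ projNorm t := by
  obtain ⟨l, hl⟩ := exists_ofList t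
  refine le_csInf ⟨_, l, hl, rfl⟩ ?_
  rintro _ ⟨m, hm, rfl⟩
  exact h m hm

theorem projNorm_nonneg (t : AlgTensor E F) : 0 ≤ projNorm t :=
  le_projNorm fun l _ => cost_nonneg l

theorem projNorm_zero : projNorm (0 : AlgTensor E F) = 0 :=
  le_antisymm (projNorm_ofList_le (E := E) (F := F) []) (projNorm_nonneg _)

theorem projNorm_add_le (s t : AlgTensor E F) : projNorm (s + t) ≤ projNorm s + projNorm t := by
  rw [← sub_le_iff_le_add]
  refine le_projNorm fun l hl => ?_
  rw [sub_le_comm]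
  refine le_projNorm fun m hm => ?_
  rw [sub_le_iff_le_add']
  have h : ofList (l ++ m) = s + t := by
    rw [← hl, ← hm, ofList_append]
  calc projNorm (s + t) = projNorm (ofList (l ++ m)) := by rw [h]
    _ ≤ cost (l ++ m) := projNorm_ofList_le _
    _ = cost l + cost m := by simp [cost]

theorem projNorm_smul_le (c : ℝ) (t : AlgTensor E F) : projNorm (c • t) ≤ ‖c‖ * projNorm t := by
  have key : ∀ l : List (E × F), ofList l = t → projNorm (c • t) ≤ ‖c‖ * cost l := by
    intro l hl
    have h : ofList (l.map fun q => (c • q.1, q.2)) = c • t := by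
      rw [← hl]
      simp [ofList, List.smul_sum, Function.comp_def]
    calc projNorm (c • t) = projNorm (ofList (l.map fun q => (c • q.1, q.2))) := by rw [h]
      _ ≤ cost (l.map fun q => (c • q.1, q.2)) := projNorm_ofList_le _
      _ = ‖c‖ * cost l := by
        simp [cost, Function.comp_def, norm_smul, mul_assoc, List.sum_map_mul_left]
  rcases eq_or_ne c 0 with rfl | hc
  · simp [projNorm_zero]
  · have hc' : 0 < ‖c‖ := norm_pos_iff.2 hc
    rw [← div_le_iff₀' hc']
    exact le_projNorm fun l hl => (div_le_iff₀' hc').2 (key l hl)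

noncomputable instance : SeminormedAddCommGroup (AlgTensor E F) :=
  AddGroupSeminorm.toSeminormedAddCommGroup
    (Seminorm.ofSMulLE projNorm projNorm_zero projNorm_add_le projNorm_smul_le :
      Seminorm ℝ (AlgTensor E F)).toAddGroupSeminorm

noncomputable instance : NormedSpace ℝ (AlgTensor E F) := ⟨projNorm_smul_le⟩

theorem norm_eq (t : AlgTensor E F) : ‖t‖ = projNorm t := rfl

/-- The linear map on `E ⊗ F` induced by a bilinear map. -/
noncomputable def liftₗ {G : Type*} [AddCommGroup G] [Module ℝ G]
    (B : E →ₗ[ℝ] F →ₗ[ℝ] G) : AlgTensor E F →ₗ[ℝ] G :=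
  (TensorProduct.lift B : E ⊗[ℝ] F →ₗ[ℝ] G)

theorem liftₗ_mk {G : Type*} [AddCommGroup G] [Module ℝ G]
    (B : E →ₗ[ℝ] F →ₗ[ℝ] G) (a : E) (b : F) : liftₗ B (mk E F a b) = B a b :=
  TensorProduct.lift.tmul a b

/-- The bounded linear map on `E ⊗ F` induced by a bounded bilinear map. -/
noncomputable def lift {G : Type*} [NormedAddCommGroup G] [NormedSpace ℝ G]
    (B : E →L[ℝ] F →L[ℝ] G) : AlgTensor E F →L[ℝ] G :=
  LinearMap.mkContinuous
    (liftₗ ((ContinuousLinearMap.coeLM ℝ).comp (B : E →ₗ[ℝ] F →L[ℝ] G))) ‖B‖ (by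
    intro t
    have key : ∀ l : List (E × F), ofList l = t →
        ‖liftₗ ((ContinuousLinearMap.coeLM ℝ).comp (B : E →ₗ[ℝ] F →L[ℝ] G)) t‖ ≤ ‖B‖ * cost l := by
      rintro l rfl
      induction l with
      | nil => simp [ofList, cost]
      | cons q l ih =>
        unfold ofList cost at *
        rw [List.map_cons, List.sum_cons, map_add, List.map_cons, List.sum_cons, mul_add]
        refine (norm_add_le _ _).trans (add_le_add ?_ ih)
        rw [liftₗ_mk]
        simpa [mul_assoc] using B.le_opNorm₂ q.1 q.2
    rw [norm_eq]
    rcases (norm_nonneg B).eq_or_lt with hB | hB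
    · obtain ⟨l, hl⟩ := exists_ofList t
      have h := key l hl
      rw [← hB, zero_mul] at h ⊢
      exact h
    · rw [← div_le_iff₀' hB]
      exact le_projNorm fun l hl => (div_le_iff₀' hB).2 (key l hl))

end AlgTensor

/-- The completed projective tensor product of `E` and `F`. -/
abbrev ProjTensor (E F : Type*) [NormedAddCommGroup E] [NormedSpace ℝ E]
    [NormedAddCommGroup F] [NormedSpace ℝ F] : Type _ :=
  UniformSpace.Completion (AlgTensor E F)

namespace ProjTensor

/-- The canonical bounded bilinear map `(a, b) ↦ a ⊗ b`. -/
noncomputable def tmul (E F : Type*) [NormedAddCommGroup E] [NormedSpace ℝ E]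
    [NormedAddCommGroup F] [NormedSpace ℝ F] : E →L[ℝ] F →L[ℝ] ProjTensor E F :=
  LinearMap.mkContinuous₂
    ((AlgTensor.mk E F).compr₂
      (UniformSpace.Completion.toComplL (𝕜 := ℝ) (E := AlgTensor E F) :
        AlgTensor E F →ₗ[ℝ] ProjTensor E F)) 1 (by
    intro a b
    have h := AlgTensor.projNorm_ofList_le [(a, b)]
    rw [← AlgTensor.norm_eq] at h
    simpa [AlgTensor.cost, AlgTensor.ofList] using h)

variable {E F G : Type*} [NormedAddCommGroup E] [NormedSpace ℝ E]
  [NormedAddCommGroup F] [NormedSpace ℝ F] [NormedAddCommGroup G] [NormedSpace ℝ G]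

/-- The identification of `L(E, L(F, G))` with `L(E ⊗ F, G)`: `lift B (a ⊗ b) = B a b`. -/
noncomputable def lift [CompleteSpace G] (B : E →L[ℝ] F →L[ℝ] G) : ProjTensor E F →L[ℝ] G :=
  (AlgTensor.lift B).fromCompletion

/-- The operator `id ⊗ A`, that is `a ⊗ b ↦ a ⊗ A b`. -/
noncomputable def mapRight (A : F →L[ℝ] G) : ProjTensor E F →L[ℝ] ProjTensor E G :=
  lift ((tmul E G).bilinearComp (ContinuousLinearMap.id ℝ E) A)

theorem lift_tmul [CompleteSpace G] (B : E →L[ℝ] F →L[ℝ] G) (a : E) (b : F) :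
    lift B (tmul E F a b) = B a b := by
  refine (ContinuousLinearMap.fromCompletion_apply_coe (AlgTensor.lift B) _).trans ?_
  exact AlgTensor.liftₗ_mk _ a b

theorem mapRight_tmul (A : F →L[ℝ] G) (a : E) (b : F) :
    mapRight A (tmul E F a b) = tmul E G a (A b) := by
  simp [mapRight, lift_tmul]

end ProjTensor

/-! ### Controls, rough paths and controlled rough paths on `[0, T]` -/

/-- `ω` is a control on `[0, T]`: a non-negative super-additive function of the sub-intervals
`[s, t]` of `[0, T]` that is continuous at the diagonal (where it vanishes). Its values for other
arguments are irrelevant. -/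
structure IsControl (T : ℝ) (ω : ℝ → ℝ → ℝ) : Prop where
  nonneg : ∀ s t, 0 ≤ s → s ≤ t → t ≤ T → 0 ≤ ω s t
  superadd : ∀ r s t, 0 ≤ r → r ≤ s → s ≤ t → t ≤ T → ω r s + ω s t ≤ ω r t
  tendsto_diag : ∀ u ∈ Icc 0 T,
    Tendsto (fun q : ℝ × ℝ => ω q.1 q.2) (𝓝[{q | 0 ≤ q.1 ∧ q.1 ≤ q.2 ∧ q.2 ≤ T}] (u, u)) (𝓝 0)

/-- The two-parameter function `A` is bounded on `0 ≤ s ≤ t ≤ T` by a constant times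
`ω(s, t) ^ θ`. -/
def BoundedByControl {E : Type*} [NormedAddCommGroup E] (T : ℝ) (ω : ℝ → ℝ → ℝ) (θ : ℝ)
    (A : ℝ → ℝ → E) : Prop :=
  ∃ C : ℝ, ∀ s t, 0 ≤ s → s ≤ t → t ≤ T → ‖A s t‖ ≤ C * ω s t ^ θ

/-- A rough path of finite `p`-variation with respect to `ω`, for `2 ≤ p < 3`: a path
`t ↦ 1 + first t + second t` in `1 ⊕ U ⊕ (U ⊗ U)` whose increments
`𝐱_{s,t} = 𝐱_s⁻¹ ⊗ 𝐱_t` have levels one and two bounded by multiples of `ω(s, t) ^ (1 / p)`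
and `ω(s, t) ^ (2 / p)`. -/
structure RoughPath (T : ℝ) (ω : ℝ → ℝ → ℝ) (p : ℝ) (U : Type*) [NormedAddCommGroup U]
    [NormedSpace ℝ U] where
  first : ℝ → U
  second : ℝ → ProjTensor U U
  bound_first : BoundedByControl T ω (1 / p) fun s t => first t - first s
  bound_second : BoundedByControl T ω (2 / p) fun s t =>
    second t - second s - ProjTensor.tmul U U (first s) (first t - first s)

namespace RoughPath

variable {T : ℝ} {ω : ℝ → ℝ → ℝ} {p : ℝ} {U : Type*} [NormedAddCommGroup U] [NormedSpace ℝ U]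

/-- The level one part of `𝐱_s⁻¹ ⊗ 𝐱_t`. -/
def incr₁ (x : RoughPath T ω p U) (s t : ℝ) : U := x.first t - x.first s

/-- The level two part of `𝐱_s⁻¹ ⊗ 𝐱_t`. -/
noncomputable def incr₂ (x : RoughPath T ω p U) (s t : ℝ) : ProjTensor U U :=
  x.second t - x.second s - ProjTensor.tmul U U (x.first s) (x.first t - x.first s)

end RoughPath

/-- A controlled rough path `(y, y†)` over `x` with values in `V`, that is an element of
`P_{p,q,r}(x, V)`: `y†` is of finite `q`-variation with respect to `ω`, and the remainder
`y♯_{s,t} = y_{s,t} - y†_s x¹_{s,t}` is bounded by a multiple of `ω(s, t) ^ (1 / r)`. -/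
structure CRP {T : ℝ} {ω : ℝ → ℝ → ℝ} {p : ℝ} {U : Type*} [NormedAddCommGroup U]
    [NormedSpace ℝ U] (x : RoughPath T ω p U) (q r : ℝ) (V : Type*) [NormedAddCommGroup V]
    [NormedSpace ℝ V] where
  path : ℝ → V
  dag : ℝ → U →L[ℝ] V
  bound_dag : BoundedByControl T ω (1 / q) fun s t => dag t - dag s
  bound_sharp : BoundedByControl T ω (1 / r) fun s t =>
    path t - path s - dag s (x.incr₁ s t)

section Integral

variable {T : ℝ} {ω : ℝ → ℝ → ℝ} {p q r : ℝ} {U V W : Type*}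
  [NormedAddCommGroup U] [NormedSpace ℝ U]
  [NormedAddCommGroup V] [NormedSpace ℝ V]
  [NormedAddCommGroup W] [NormedSpace ℝ W]

/-- `zb = z♭` is the cross iterated integral `∫ x¹ ⊗ dz` of the controlled rough path `z`: on
`0 ≤ s ≤ t ≤ T`, it satisfies `z♭_{r,s} + z♭_{s,t} + x¹_{r,s} ⊗ z_{s,t} = z♭_{r,t}` and is close to
`(id ⊗ z†_s) x²_{s,t}` up to an error of order `ω(s, t) ^ θ` with `θ > 1`. These two properties
determine `z♭` on `0 ≤ s ≤ t ≤ T`. -/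
def IsFlat {x : RoughPath T ω p U} (z : CRP x q r W) (zb : ℝ → ℝ → ProjTensor U W) : Prop :=
  (∀ u s t, 0 ≤ u → u ≤ s → s ≤ t → t ≤ T →
    zb u s + zb s t + ProjTensor.tmul U W (x.incr₁ u s) (z.path t - z.path s) = zb u t) ∧
  ∃ θ : ℝ, 1 < θ ∧ BoundedByControl T ω θ fun s t =>
    zb s t - ProjTensor.mapRight (z.dag s) (x.incr₂ s t)

/-- `J = ∫_0^· Y dz`, for `(Y, Y†)` with values in `L(W, V)` and `Y†` seen as an `L(U ⊗ W, V)`-valued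
path: `J_0 = 0`, and `J_t - J_s` is close to `Y_s z_{s,t} + Y†_s z♭_{s,t}` up to an error of order
`ω(s, t) ^ θ` with `θ > 1`. These two properties determine `J` on `[0, T]`. -/
def IsRoughIntegral [CompleteSpace V] {x : RoughPath T ω p U} (Y : ℝ → W →L[ℝ] V)
    (Ydag : ℝ → U →L[ℝ] W →L[ℝ] V) (z : CRP x q r W) (J : ℝ → V) : Prop :=
  J 0 = 0 ∧ ∃ zb, IsFlat z zb ∧ ∃ θ : ℝ, 1 < θ ∧ BoundedByControl T ω θ fun s t =>
    J t - J s - Y s (z.path t - z.path s) - ProjTensor.lift (Ydag s) (zb s t)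

/-- The controlled rough path `y` solves, on `[0, T]`,
`y_t = a + ∫_0^t f(y_s) dz_s + b z_{0,t}` with `y†_t = f(y_t) z†_t + b z†_t`, where
`f(y)` is the controlled rough path with `f(y)† = Df(y) y†`. -/
def IsRDESolution [CompleteSpace V] {x : RoughPath T ω p U} (z : CRP x q r W)
    (f : V → W →L[ℝ] V) (a : V) (b : W →L[ℝ] V) (y : CRP x q r V) : Prop :=
  (∃ J : ℝ → V,
    IsRoughIntegral (fun s => f (y.path s)) (fun s => (fderiv ℝ f (y.path s)).comp (y.dag s)) z J ∧
    ∀ t ∈ Icc 0 T, y.path t = a + J t + b (z.path t - z.path 0)) ∧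
  ∀ t ∈ Icc 0 T, y.dag t = (f (y.path t)).comp (z.dag t) + b.comp (z.dag t)

end Integral

/-! ### Hölder classes and local diffeomorphisms -/

/-- `g` is of class `C^{m+α}` on the open set `O`, for an integer `m` and `0 < α ≤ 1`: it is
`m` times continuously differentiable on `O`, its derivatives of order `0, …, m` are bounded on `O`,
and the one of order `m` is `α`-Hölder continuous on `O`. -/
def IsHolderClassOn {E F : Type*} [NormedAddCommGroup E] [NormedSpace ℝ E]
    [NormedAddCommGroup F] [NormedSpace ℝ F] (m : ℕ) (α : ℝ) (g : E → F) (O : Set E) : Prop :=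
  ContDiffOn ℝ m g O ∧
  (∀ j ≤ m, ∃ C : ℝ, ∀ u ∈ O, ‖iteratedFDerivWithin ℝ j g O u‖ ≤ C) ∧
  ∃ C : ℝ, ∀ u ∈ O, ∀ v ∈ O,
    ‖iteratedFDerivWithin ℝ m g O u - iteratedFDerivWithin ℝ m g O v‖ ≤ C * ‖u - v‖ ^ α

/-- `g` is locally a `C^{m+α}`-diffeomorphism: around every point, it restricts to a
homeomorphism between open sets which is of class `C^{m+α}` together with its inverse. -/
def IsLocalHolderDiffeo {E F : Type*} [NormedAddCommGroup E] [NormedSpace ℝ E]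
    [NormedAddCommGroup F] [NormedSpace ℝ F] (m : ℕ) (α : ℝ) (g : E → F) : Prop :=
  ∀ a : E, ∃ e : OpenPartialHomeomorph E F, a ∈ e.source ∧ EqOn g e e.source ∧
    IsHolderClassOn m α g e.source ∧ IsHolderClassOn m α e.symm e.target

/-! The solution is a fixed point in a Banach space of controlled paths, and the regularity of the
flow comes from the inverse function theorem in that space. Everything therefore rests on the
regularity of the operator `y ↦ f(y)` between such spaces.

The norm (`Driver.Bd`) is deliberately weaker than the natural one. With `τ = κγ`, the increments of
`y†` are measured against `ω ^ (τ/p)` and the remainder against `ω ^ ((1+τ)/p)`. The condition `2 +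
κγ > p` is exactly what keeps the error exponent `(2+τ)/p` of the rough integral above 1, so that
sewing applies. The weaker weight pays for Hölder continuity: a second difference of `Df` is bounded
both by the power `γ` of the distance of the two paths and by the power `γ` of their time
increments. Interpolating (`le_mul_rpow_mul_rpow`) leaves the power `(1-κ)γ` of the distance and the
power `κγ` of the increments, hence `Driver.norm_nem_sub_le`. Since the derivative of `y ↦ f(y)` is
multiplication by `Df(y)`, induction on `k` yields class `k + (1-κ)γ` (`Driver.holderDiffAt_nem`).

Integration against `z` is a bounded operator, and the weaker norm also gives it a small factor `η`
on short intervals. Only the supremum of the derivative `f(y) z†` does not shrink with the interval;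
replacing `x` by `Λx` divides it by `Λ` and leaves the equation unchanged. On short intervals the
Picard map is then a 1/2-contraction, uniformly in the initial value, because the set on which it
acts does not restrict the values of the path (`exists_dilatedDriver`, `Driver.norm_picard_sub_le`).
The inverse function theorem for `y ↦ y - ∫ f(y) dz` gives the regularity of the solution in its
initial value (`Driver.holderDiffAt_picard_fixed`), and the derivative of the flow is within 1/2 of
the identity, hence invertible (`Driver.isUnit_of_hasFDerivAt_flow`).

To reach `[0, T]`, solutions are described by their local expansion (`DavieOn`), which involves
neither the dilation nor the norm. Such expansions can be concatenated, and the admissible length of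
an interval does not depend on its position, so finitely many local flows compose to the global one;
the chain rule preserves both the Hölder class and invertibility. For uniqueness, two given
solutions have a priori bounds, so on short enough intervals both are fixed points in the
contraction domain (`FlowData.eqOn_of_davieOn`). -/

/-! ### Sewing along an abstract control on a linear order -/

/-- A control on a linear order with least element `o` and a greatest element: a non-negative
super-additive function such that there are finite chains from `o` to the greatest element whose
consecutive steps have arbitrarily small control. -/
structure ChainControl {ι : Type*} [LinearOrder ι] (o : ι) (ω : ι → ι → ℝ) : Prop where
  bot_le : ∀ s, o ≤ s
  nonneg : ∀ s t, s ≤ t → 0 ≤ ω s t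
  superadd : ∀ r s t, r ≤ s → s ≤ t → ω r s + ω s t ≤ ω r t
  fine : ∀ ε : ℝ, 0 < ε → ∃ u : ℕ → ι, ∃ N : ℕ, Monotone u ∧ u 0 = o ∧ (∀ s, s ≤ u N) ∧
    ∀ i, ω (u i) (u (i + 1)) ≤ ε

/-- The constant of the sewing lemma. -/
noncomputable def sewConst (θ : ℝ) : ℝ := 2 / (1 - 2 * (1 / 2 : ℝ) ^ θ)

theorem two_mul_half_rpow_lt_one {θ : ℝ} (hθ : 1 < θ) : 2 * (1 / 2 : ℝ) ^ θ < 1 := by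
  have h := Real.rpow_lt_rpow_of_exponent_gt (x := (1 / 2 : ℝ)) (by norm_num) (by norm_num) hθ
  rw [Real.rpow_one] at h
  linarith

theorem sewConst_pos {θ : ℝ} (hθ : 1 < θ) : 0 < sewConst θ :=
  div_pos two_pos (by linarith [two_mul_half_rpow_lt_one hθ])

/-- This is the recursion closed by the induction in Young's inequality: two halves, each scaled by
`(1/2) ^ θ`, plus two additivity defects. -/
theorem sewConst_eq {θ : ℝ} (hθ : 1 < θ) :
    sewConst θ * (2 * (1 / 2 : ℝ) ^ θ) + 2 = sewConst θ := by
  have h : (1 - 2 * (1 / 2 : ℝ) ^ θ) ≠ 0 := by linarith [two_mul_half_rpow_lt_one hθ]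
  have h2 : sewConst θ * (1 - 2 * (1 / 2 : ℝ) ^ θ) = 2 := div_mul_cancel₀ _ h
  linarith

namespace ChainControl

variable {ι : Type*} [LinearOrder ι] {o : ι} {ω : ι → ι → ℝ}

theorem self (hω : ChainControl o ω) (s : ι) : ω s s = 0 :=
  le_antisymm (by linarith [hω.superadd s s s le_rfl le_rfl]) (hω.nonneg s s le_rfl)

theorem mono (hω : ChainControl o ω) {r s t v : ι} (h₁ : r ≤ s) (h₂ : s ≤ t) (h₃ : t ≤ v) :
    ω s t ≤ ω r v := by
  linarith [hω.superadd r s v h₁ (h₂.trans h₃), hω.superadd s t v h₂ h₃, hω.nonneg r s h₁,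
    hω.nonneg t v h₃]

theorem rpow_mono (hω : ChainControl o ω) {θ : ℝ} (hθ : 0 ≤ θ) {r s t v : ι} (h₁ : r ≤ s)
    (h₂ : s ≤ t) (h₃ : t ≤ v) : ω s t ^ θ ≤ ω r v ^ θ :=
  Real.rpow_le_rpow (hω.nonneg _ _ h₂) (hω.mono h₁ h₂ h₃) hθ

theorem sum_le (hω : ChainControl o ω) (u : ℕ → ι) (hu : Monotone u) (n : ℕ) :
    ∑ i ∈ Finset.range n, ω (u i) (u (i + 1)) ≤ ω (u 0) (u n) := by
  induction n with
  | zero => simp [hω.self]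
  | succ n ih =>
    rw [Finset.sum_range_succ]
    linarith [hω.superadd (u 0) (u n) (u (n + 1)) (hu (Nat.zero_le n)) (hu n.le_succ)]

/-- Super-additivity pays for one power of the control; the remaining power `θ - 1` is small on a
fine chain. -/
theorem sum_rpow_le (hω : ChainControl o ω) {θ ε : ℝ} (hθ : 1 < θ) (u : ℕ → ι) (hu : Monotone u)
    (hε : ∀ i, ω (u i) (u (i + 1)) ≤ ε) (n : ℕ) :
    ∑ i ∈ Finset.range n, ω (u i) (u (i + 1)) ^ θ ≤ ε ^ (θ - 1) * ω (u 0) (u n) := by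
  have h0 : ∀ i, 0 ≤ ω (u i) (u (i + 1)) := fun i => hω.nonneg _ _ (hu i.le_succ)
  have hε0 : 0 ≤ ε := (h0 0).trans (hε 0)
  refine le_trans ?_ (mul_le_mul_of_nonneg_left (hω.sum_le u hu n) (Real.rpow_nonneg hε0 _))
  rw [Finset.mul_sum]
  refine Finset.sum_le_sum fun i _ => ?_
  have : ω (u i) (u (i + 1)) ^ θ = ω (u i) (u (i + 1)) ^ (θ - 1) * ω (u i) (u (i + 1)) := by
    conv_lhs => rw [show θ = (θ - 1) + 1 by ring]
    rw [Real.rpow_add_of_nonneg (h0 i) (by linarith) zero_le_one, Real.rpow_one]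
  rw [this]
  exact mul_le_mul_of_nonneg_right (Real.rpow_le_rpow (h0 i) (hε i) (by linarith)) (h0 i)

variable {E : Type*} [NormedAddCommGroup E]

/-- Young's maximal inequality. -/
theorem norm_sum_sub_le (hω : ChainControl o ω) {θ M : ℝ} (hθ : 1 < θ) (hM : 0 ≤ M)
    {Ξ : ι → ι → E}
    (hΞ : ∀ r s t, r ≤ s → s ≤ t → ‖Ξ r t - Ξ r s - Ξ s t‖ ≤ M * ω r t ^ θ) (n : ℕ) :
    ∀ u : ℕ → ι, Monotone u → ‖∑ i ∈ Finset.range n, Ξ (u i) (u (i + 1)) - Ξ (u 0) (u n)‖ ≤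
      sewConst θ * M * ω (u 0) (u n) ^ θ := by
  have hC := sewConst_pos hθ
  have hself : ∀ c, Ξ c c = 0 := fun c => by
    have h := hΞ c c c le_rfl le_rfl
    rw [hω.self, Real.zero_rpow (by linarith), mul_zero] at h
    simpa using h
  induction n using Nat.strong_induction_on with
  | _ n ih =>
    intro u hu
    rcases Nat.eq_zero_or_pos n with rfl | hn
    · simp only [Finset.range_zero, Finset.sum_empty, hself, sub_zero, norm_zero]
      exact mul_nonneg (mul_nonneg hC.le hM) (Real.rpow_nonneg (hω.nonneg _ _ le_rfl) _)
    set Ω := ω (u 0) (u n) with hΩ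
    have hΩ0 : 0 ≤ Ω := hω.nonneg _ _ (hu (Nat.zero_le n))
    -- The cell `[u k, u (k+1)]` in which the control measured from the left passes half of the
    -- total is cut out, which leaves two shorter chains, each of control at most `Ω / 2`.
    obtain ⟨k, hkn, hk, hk'⟩ : ∃ k < n, ω (u 0) (u k) ≤ Ω / 2 ∧ ω (u (k + 1)) (u n) ≤ Ω / 2 := by
      -- The alternative `j + 1 = n` makes the last cell a fallback when the half is never passed.
      have hex : ∃ j, j + 1 = n ∨ Ω / 2 < ω (u 0) (u (j + 1)) := ⟨n - 1, Or.inl (by omega)⟩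
      classical
      let k := Nat.find hex
      have hmin : ∀ j < k, ¬ (j + 1 = n ∨ Ω / 2 < ω (u 0) (u (j + 1))) := fun j hj =>
        Nat.find_min hex hj
      have hspec : k + 1 = n ∨ Ω / 2 < ω (u 0) (u (k + 1)) := Nat.find_spec hex
      have hkn : k + 1 ≤ n := by
        have : k ≤ n - 1 := Nat.find_min' hex (Or.inl (by omega))
        omega
      refine ⟨k, hkn, ?_, ?_⟩
      · rcases Nat.eq_zero_or_pos k with h0 | h0
        · rw [h0, hω.self]; linarith
        · have := hmin (k - 1) (by omega)
          push Not at this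
          have h2 := this.2
          rwa [Nat.sub_add_cancel h0] at h2
      · rcases hspec with h | h
        · rw [h, hω.self]; linarith
        · linarith [hω.superadd (u 0) (u (k + 1)) (u n) (hu (Nat.zero_le _)) (hu hkn)]
    have h1 := ih k hkn u hu
    have h2 := ih (n - (k + 1)) (by omega) (fun i => u (k + 1 + i))
      (fun i j hij => hu (by omega))
    simp only [add_zero, show k + 1 + (n - (k + 1)) = n by omega] at h2
    have h3 := hΞ (u 0) (u k) (u (k + 1)) (hu (Nat.zero_le k)) (hu k.le_succ)
    have h4 := hΞ (u 0) (u (k + 1)) (u n) (hu (Nat.zero_le _)) (hu hkn)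
    have hsum : ∑ i ∈ Finset.range n, Ξ (u i) (u (i + 1)) =
        ∑ i ∈ Finset.range k, Ξ (u i) (u (i + 1)) + Ξ (u k) (u (k + 1)) +
        ∑ i ∈ Finset.range (n - (k + 1)), Ξ (u (k + 1 + i)) (u (k + 1 + (i + 1))) := by
      conv_lhs => rw [show n = (k + 1) + (n - (k + 1)) by omega]
      rw [Finset.sum_range_add, Finset.sum_range_succ]
      rfl
    have hθ0 : 0 ≤ θ := by linarith
    have e1 : ω (u 0) (u k) ^ θ ≤ (1 / 2 : ℝ) ^ θ * Ω ^ θ := by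
      rw [← Real.mul_rpow (by norm_num) hΩ0]
      exact Real.rpow_le_rpow (hω.nonneg _ _ (hu (Nat.zero_le k))) (by linarith) hθ0
    have e2 : ω (u (k + 1)) (u n) ^ θ ≤ (1 / 2 : ℝ) ^ θ * Ω ^ θ := by
      rw [← Real.mul_rpow (by norm_num) hΩ0]
      exact Real.rpow_le_rpow (hω.nonneg _ _ (hu hkn)) (by linarith) hθ0
    have e3 : ω (u 0) (u (k + 1)) ^ θ ≤ Ω ^ θ :=
      hω.rpow_mono hθ0 le_rfl (hu (Nat.zero_le _)) (hu hkn)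
    rw [hsum]
    calc _ = ‖(∑ i ∈ Finset.range k, Ξ (u i) (u (i + 1)) - Ξ (u 0) (u k)) +
          (∑ i ∈ Finset.range (n - (k + 1)), Ξ (u (k + 1 + i)) (u (k + 1 + (i + 1))) -
            Ξ (u (k + 1)) (u n)) -
          (Ξ (u 0) (u (k + 1)) - Ξ (u 0) (u k) - Ξ (u k) (u (k + 1))) -
          (Ξ (u 0) (u n) - Ξ (u 0) (u (k + 1)) - Ξ (u (k + 1)) (u n))‖ := by congr 1; abel
      _ ≤ sewConst θ * M * ω (u 0) (u k) ^ θ + sewConst θ * M * ω (u (k + 1)) (u n) ^ θ +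
          M * ω (u 0) (u (k + 1)) ^ θ + M * Ω ^ θ :=
        (norm_sub_le _ _).trans (add_le_add ((norm_sub_le _ _).trans
          (add_le_add ((norm_add_le _ _).trans (add_le_add h1 h2)) h3)) h4)
      _ ≤ sewConst θ * M * ((1 / 2 : ℝ) ^ θ * Ω ^ θ) + sewConst θ * M * ((1 / 2 : ℝ) ^ θ * Ω ^ θ) +
          M * Ω ^ θ + M * Ω ^ θ := by gcongr
      _ = (sewConst θ * (2 * (1 / 2 : ℝ) ^ θ) + 2) * M * Ω ^ θ := by ring
      _ = _ := by rw [sewConst_eq hθ]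

end ChainControl

/-- Projection of a linear order on its interval `[s, t]`. -/
def clampTo {ι : Type*} [LinearOrder ι] (s t c : ι) : ι := max s (min t c)

section clampTo

variable {ι : Type*} [LinearOrder ι]

theorem clampTo_mono (s t : ι) : Monotone (clampTo s t) := fun _ _ h =>
  max_le_max le_rfl (min_le_min le_rfl h)

theorem le_clampTo (s t c : ι) : s ≤ clampTo s t c := le_max_left _ _

theorem clampTo_le {s t : ι} (h : s ≤ t) (c : ι) : clampTo s t c ≤ t :=
  max_le h (min_le_left _ _)

theorem clampTo_of_le {s t c : ι} (h : c ≤ s) : clampTo s t c = s :=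
  max_eq_left ((min_le_right _ _).trans h)

theorem clampTo_of_ge {s t c : ι} (hst : s ≤ t) (h : t ≤ c) : clampTo s t c = t := by
  rw [clampTo, min_eq_left h, max_eq_right hst]

/-- Both sides evaluate the germ on the intersection of `[a, b]` and `[c, d]`; without overlap both
arguments collapse to one point. -/
theorem germ_clampTo_comm {E : Type*} [Zero E] {Ξ : ι → ι → E} (hΞ : ∀ c, Ξ c c = 0)
    {a b c d : ι} (hab : a ≤ b) (hcd : c ≤ d) :
    Ξ (clampTo a b c) (clampTo a b d) = Ξ (clampTo c d a) (clampTo c d b) := by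
  rcases le_total b c with h | h
  · rw [clampTo_of_ge hab h, clampTo_of_ge hab (h.trans hcd), clampTo_of_le (hab.trans h),
      clampTo_of_le h, hΞ, hΞ]
  rcases le_total d a with h' | h'
  · rw [clampTo_of_le (hcd.trans h'), clampTo_of_le h', clampTo_of_ge hcd h',
      clampTo_of_ge hcd (h'.trans hab), hΞ, hΞ]
  simp only [clampTo]
  rw [min_eq_right h, min_eq_right h', min_comm d b, max_comm a c, max_eq_right (le_min hab h'),
    max_eq_right (le_min h hcd)]

end clampTo

namespace ChainControl

variable {ι : Type*} [LinearOrder ι] {o : ι} {ω : ι → ι → ℝ}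

theorem clamp_le (hω : ChainControl o ω) {s t a b : ι} (hst : s ≤ t) (hab : a ≤ b) :
    ω (clampTo s t a) (clampTo s t b) ≤ ω a b := by
  rcases le_total t a with h | h
  · rw [clampTo_of_ge hst h, clampTo_of_ge hst (h.trans hab), hω.self]
    exact hω.nonneg _ _ hab
  rcases le_total b s with h' | h'
  · rw [clampTo_of_le h', clampTo_of_le (hab.trans h'), hω.self]
    exact hω.nonneg _ _ hab
  refine hω.mono ?_ (clampTo_mono s t hab) ?_
  · exact (le_min h le_rfl).trans (le_max_right _ _)
  · exact max_le h' (min_le_right _ _)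

/-- Two points between which all increments are `O(ω ^ θ)`, `θ > 1`, have the same value. -/
theorem eq_of_norm_sub_le (hω : ChainControl o ω) {E : Type*} [NormedAddCommGroup E] {θ C : ℝ}
    (hθ : 1 < θ) {A : ι → E} (hA : ∀ s t, s ≤ t → ‖A t - A s‖ ≤ C * ω s t ^ θ) (s : ι) :
    A s = A o := by
  have hos := hω.bot_le s
  rw [← sub_eq_zero, ← norm_le_zero_iff]
  have key : ∀ ε : ℝ, 0 < ε → ‖A s - A o‖ ≤ |C| * (ε ^ (θ - 1) * ω o s) := by
    intro ε hε
    obtain ⟨u, N, hu, hu0, huN, hε'⟩ := hω.fine ε hε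
    let v : ℕ → ι := fun i => clampTo o s (u i)
    have hv : Monotone v := (clampTo_mono o s).comp hu
    have hv0 : v 0 = o := by simp only [v, hu0, clampTo_of_le le_rfl]
    have hvN : v N = s := clampTo_of_ge hos (huN s)
    have h := hω.sum_rpow_le hθ v hv (fun i => (hω.clamp_le hos (hu i.le_succ)).trans (hε' i)) N
    rw [hv0, hvN] at h
    calc ‖A s - A o‖ = ‖∑ i ∈ Finset.range N, (A (v (i + 1)) - A (v i))‖ := by
          rw [Finset.sum_range_sub (fun i => A (v i)), hv0, hvN]
      _ ≤ ∑ i ∈ Finset.range N, |C| * ω (v i) (v (i + 1)) ^ θ := by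
          refine norm_sum_le_of_le _ fun i _ => (hA _ _ (hv i.le_succ)).trans ?_
          exact mul_le_mul_of_nonneg_right (le_abs_self C)
            (Real.rpow_nonneg (hω.nonneg _ _ (hv i.le_succ)) _)
      _ ≤ _ := by
          rw [← Finset.mul_sum]
          exact mul_le_mul_of_nonneg_left h (abs_nonneg C)
  have hlim : Tendsto (fun ε : ℝ => |C| * (ε ^ (θ - 1) * ω o s)) (𝓝[>] 0) (𝓝 0) := by
    have : Tendsto (fun ε : ℝ => ε ^ (θ - 1)) (𝓝 0) (𝓝 0) := by
      have := (Real.continuousAt_rpow_const 0 (θ - 1) (Or.inr (by linarith))).tendsto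
      rwa [Real.zero_rpow (by linarith)] at this
    simpa using ((this.mono_left nhdsWithin_le_nhds).mul_const (ω o s)).const_mul |C|
  exact ge_of_tendsto hlim (eventually_nhdsWithin_of_forall fun ε hε => key ε hε)

variable {E : Type*} [NormedAddCommGroup E]

/-- Both Riemann sums are compared with the double sum over intersections of cells, which plays the
role of a common refinement and is symmetric in the two chains by `germ_clampTo_comm`. -/
theorem norm_sum_sub_sum_le (hω : ChainControl o ω) {θ M : ℝ} (hθ : 1 < θ) (hM : 0 ≤ M)
    {Ξ : ι → ι → E}
    (hΞ : ∀ r s t, r ≤ s → s ≤ t → ‖Ξ r t - Ξ r s - Ξ s t‖ ≤ M * ω r t ^ θ)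
    {u v : ℕ → ι} (hu : Monotone u) (hv : Monotone v) {m n : ℕ} (h0 : u 0 = v 0)
    (h1 : u m = v n) {ε ε' : ℝ} (hε : ∀ i, ω (u i) (u (i + 1)) ≤ ε)
    (hε' : ∀ i, ω (v i) (v (i + 1)) ≤ ε') :
    ‖∑ i ∈ Finset.range m, Ξ (u i) (u (i + 1)) - ∑ i ∈ Finset.range n, Ξ (v i) (v (i + 1))‖ ≤
      sewConst θ * M * ((ε ^ (θ - 1) + ε' ^ (θ - 1)) * ω (u 0) (u m)) := by
  have hC := sewConst_pos hθ
  have hself : ∀ c, Ξ c c = 0 := fun c => by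
    have h := hΞ c c c le_rfl le_rfl
    rw [hω.self, Real.zero_rpow (by linarith), mul_zero] at h
    simpa using h
  have key : ∀ (u v : ℕ → ι) (hu : Monotone u) (hv : Monotone v) (m n : ℕ) (h0 : u 0 = v 0)
      (h1 : u m = v n) (ε : ℝ) (hε : ∀ i, ω (u i) (u (i + 1)) ≤ ε),
      ‖∑ i ∈ Finset.range m, ∑ j ∈ Finset.range n, Ξ (clampTo (u i) (u (i + 1)) (v j))
        (clampTo (u i) (u (i + 1)) (v (j + 1))) - ∑ i ∈ Finset.range m, Ξ (u i) (u (i + 1))‖ ≤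
        sewConst θ * M * (ε ^ (θ - 1) * ω (u 0) (u m)) := by
    intro u v hu hv m n h0 h1 ε hε
    rw [← Finset.sum_sub_distrib]
    refine (norm_sum_le_of_le _ (f := fun i => _)
      (n := fun i => sewConst θ * M * ω (u i) (u (i + 1)) ^ θ) fun i hi => ?_).trans ?_
    · have h := hω.norm_sum_sub_le hθ hM hΞ n (fun j => clampTo (u i) (u (i + 1)) (v j))
        ((clampTo_mono _ _).comp hv)
      have e0 : clampTo (u i) (u (i + 1)) (v 0) = u i :=
        clampTo_of_le (h0 ▸ hu (Nat.zero_le i))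
      have e1 : clampTo (u i) (u (i + 1)) (v n) = u (i + 1) :=
        clampTo_of_ge (hu i.le_succ) (h1 ▸ hu (Finset.mem_range.1 hi))
      simpa only [e0, e1] using h
    · rw [← Finset.mul_sum]
      exact mul_le_mul_of_nonneg_left (hω.sum_rpow_le hθ u hu hε m) (mul_nonneg hC.le hM)
  have k1 := key u v hu hv m n h0 h1 ε hε
  have k2 := key v u hv hu n m h0.symm h1.symm ε' hε'
  rw [Finset.sum_comm] at k2
  simp_rw [fun i j => germ_clampTo_comm hself (hv (Nat.le_succ j)) (hu (Nat.le_succ i))] at k2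
  rw [← h0, ← h1] at k2
  rw [← norm_neg] at k1
  calc _ = ‖-(∑ i ∈ Finset.range m, ∑ j ∈ Finset.range n, Ξ (clampTo (u i) (u (i + 1)) (v j))
        (clampTo (u i) (u (i + 1)) (v (j + 1))) - ∑ i ∈ Finset.range m, Ξ (u i) (u (i + 1))) +
        (∑ i ∈ Finset.range m, ∑ j ∈ Finset.range n, Ξ (clampTo (u i) (u (i + 1)) (v j))
        (clampTo (u i) (u (i + 1)) (v (j + 1))) - ∑ i ∈ Finset.range n, Ξ (v i) (v (i + 1)))‖ := by
        congr 1; abel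
    _ ≤ _ := (norm_add_le _ _).trans ((add_le_add k1 k2).trans_eq (by ring))

/-- The sewing lemma. -/
theorem exists_sewing [CompleteSpace E] (hω : ChainControl o ω) {θ M : ℝ} (hθ : 1 < θ)
    (hM : 0 ≤ M) {Ξ : ι → ι → E}
    (hΞ : ∀ r s t, r ≤ s → s ≤ t → ‖Ξ r t - Ξ r s - Ξ s t‖ ≤ M * ω r t ^ θ) :
    ∃ J : ι → E, J o = 0 ∧
      ∀ s t, s ≤ t → ‖J t - J s - Ξ s t‖ ≤ sewConst θ * M * ω s t ^ θ := by
  have hC := sewConst_pos hθ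
  have hself : ∀ c, Ξ c c = 0 := fun c => by
    have h := hΞ c c c le_rfl le_rfl
    rw [hω.self, Real.zero_rpow (by linarith), mul_zero] at h
    simpa using h
  -- One sequence of global chains serves all `s ≤ t` at once: projecting it on `[s, t]` gives
  -- chains there that are at least as fine.
  choose u N hu hu0 huN hε using fun n : ℕ => hω.fine (1 / ((n : ℝ) + 1)) (by positivity)
  let e : ℕ → ℝ := fun n => (1 / ((n : ℝ) + 1)) ^ (θ - 1)
  have he : Tendsto e atTop (𝓝 0) := by
    have := ((Real.continuousAt_rpow_const 0 (θ - 1) (Or.inr (by linarith))).tendsto).comp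
      (tendsto_one_div_add_atTop_nhds_zero_nat (𝕜 := ℝ))
    rwa [Real.zero_rpow (by linarith)] at this
  have hst : ∀ {s t : ι}, s ≤ t → ∀ n, clampTo s t (u n 0) = s ∧ clampTo s t (u n (N n)) = t ∧
      ∀ i, ω (clampTo s t (u n i)) (clampTo s t (u n (i + 1))) ≤ 1 / ((n : ℝ) + 1) := by
    intro s t h n
    refine ⟨?_, clampTo_of_ge h (huN n t), fun i =>
      (hω.clamp_le h (hu n i.le_succ)).trans (hε n i)⟩
    rw [hu0]
    exact clampTo_of_le (hω.bot_le s)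
  let S : ι → ι → ℕ → E := fun s t n => ∑ i ∈ Finset.range (N n),
    Ξ (clampTo s t (u n i)) (clampTo s t (u n (i + 1)))
  have hS : ∀ {s t : ι}, s ≤ t → ∀ n m, ‖S s t n - S s t m‖ ≤
      sewConst θ * M * ((e n + e m) * ω s t) := by
    intro s t h n m
    obtain ⟨a1, a2, a3⟩ := hst h n
    obtain ⟨b1, b2, b3⟩ := hst h m
    have := hω.norm_sum_sub_sum_le hθ hM hΞ ((clampTo_mono s t).comp (hu n))
      ((clampTo_mono s t).comp (hu m)) (m := N n) (n := N m) (a1.trans b1.symm)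
      (a2.trans b2.symm) a3 b3
    simpa only [Function.comp_apply, a1, a2] using this
  have hlim : ∀ {s t : ι}, s ≤ t → ∃ L, Tendsto (S s t) atTop (𝓝 L) := by
    intro s t h
    refine cauchySeq_tendsto_of_complete (cauchySeq_iff_tendsto_dist_atTop_0.2 ?_)
    refine squeeze_zero (fun _ => dist_nonneg) (fun p => ?_)
      (g := fun p : ℕ × ℕ => sewConst θ * M * ((e p.1 + e p.2) * ω s t)) ?_
    · rw [dist_eq_norm]
      exact hS h p.1 p.2
    · have h1 : Tendsto (fun p : ℕ × ℕ => e p.1) atTop (𝓝 0) := by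
        rw [← prod_atTop_atTop_eq]; exact he.comp tendsto_fst
      have h2 : Tendsto (fun p : ℕ × ℕ => e p.2) atTop (𝓝 0) := by
        rw [← prod_atTop_atTop_eq]; exact he.comp tendsto_snd
      simpa using ((h1.add h2).mul_const (ω s t)).const_mul (sewConst θ * M)
  choose J hJ using fun t => hlim (hω.bot_le t)
  -- Sums along the projected chains are additive only in the limit: in each cell the discrepancy is
  -- at most one defect of the germ, and the powers `ω ^ θ` sum to something vanishing.
  have hadd : ∀ {s t : ι}, s ≤ t → Tendsto (fun n => S o s n + S s t n - S o t n) atTop (𝓝 0) := by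
    intro s t h
    have hot := hω.bot_le t
    have hbd : Tendsto (fun n => M * (e n * ω o t)) atTop (𝓝 0) := by
      simpa using (he.mul_const (ω o t)).const_mul M
    refine squeeze_zero_norm (fun n => ?_) hbd
    obtain ⟨a1, a2, a3⟩ := hst hot n
    have hm : Monotone fun i => clampTo o t (u n i) := (clampTo_mono o t).comp (hu n)
    simp only [S]
    rw [← Finset.sum_add_distrib, ← Finset.sum_sub_distrib]
    refine (norm_sum_le_of_le _ (n := fun i => M * ω (clampTo o t (u n i))
      (clampTo o t (u n (i + 1))) ^ θ) fun i _ => ?_).trans ?_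
    · have hab : clampTo o t (u n i) ≤ clampTo o t (u n (i + 1)) := hm i.le_succ
      -- Projecting on `[o, s]` or `[s, t]` amounts to projecting on `[o, t]` and then truncating at
      -- `s`, so only a cell that straddles `s` is affected.
      have c1 : ∀ c, clampTo o s c = min (clampTo o t c) s := fun c => by
        simp only [clampTo, max_eq_right (hω.bot_le _)]
        rw [min_comm t c, min_assoc, min_eq_right h, min_comm]
      have c2 : ∀ c, clampTo s t c = max (clampTo o t c) s := fun c => by
        simp only [clampTo, max_eq_right (hω.bot_le _)]
        rw [max_comm]
      rw [c1, c1, c2, c2]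
      generalize clampTo o t (u n i) = a at hab ⊢
      generalize clampTo o t (u n (i + 1)) = b at hab ⊢
      have hnn : 0 ≤ M * ω a b ^ θ := mul_nonneg hM (Real.rpow_nonneg (hω.nonneg _ _ hab) _)
      rcases le_total b s with hb | hb
      · simpa [min_eq_left hb, min_eq_left (hab.trans hb), max_eq_right hb,
          max_eq_right (hab.trans hb), hself] using hnn
      rcases le_total s a with ha | ha
      · simpa [min_eq_right hb, min_eq_right ha, max_eq_left hb, max_eq_left ha, hself] using hnn
      rw [min_eq_left ha, min_eq_right hb, max_eq_right ha, max_eq_left hb, ← norm_neg]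
      refine (congrArg norm ?_).trans_le (hΞ a s b ha hb)
      abel
    · rw [← Finset.mul_sum]
      refine mul_le_mul_of_nonneg_left ?_ hM
      have := hω.sum_rpow_le hθ _ hm a3 (N n)
      rwa [a1, a2] at this
  refine ⟨J, ?_, fun s t h => ?_⟩
  · refine tendsto_nhds_unique (hJ o) ?_
    have : S o o = fun _ => 0 := by
      funext n
      refine Finset.sum_eq_zero fun i _ => ?_
      have : ∀ c, clampTo o o c = o := fun c =>
        le_antisymm (clampTo_le le_rfl c) (le_clampTo _ _ _)
      rw [this, this, hself]
    rw [this]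
    exact tendsto_const_nhds
  · have hlim2 : Tendsto (fun n => S s t n - Ξ s t) atTop (𝓝 (J t - J s - Ξ s t)) := by
      have := (((hJ t).sub (hJ s)).add (hadd h)).sub_const (Ξ s t)
      rw [add_zero] at this
      refine this.congr fun n => ?_
      abel
    refine le_of_tendsto hlim2.norm (Eventually.of_forall fun n => ?_)
    obtain ⟨a1, a2, -⟩ := hst h n
    have := hω.norm_sum_sub_le hθ hM hΞ (N n) _ ((clampTo_mono s t).comp (hu n))
    simpa only [Function.comp_apply, a1, a2] using this

end ChainControl

/-! ### Locally Hölder differentiable maps -/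

/-- `g` is `k` times continuously differentiable near `x`, with a derivative of order `k` which is
`α`-Hölder continuous near `x`. -/
def HolderDiffAt {E F : Type*} [NormedAddCommGroup E] [NormedSpace ℝ E]
    [NormedAddCommGroup F] [NormedSpace ℝ F] (k : ℕ) (α : ℝ) (g : E → F) (x : E) : Prop :=
  ContDiffAt ℝ k g x ∧ ∃ C : ℝ, ∀ᶠ q : E × E in 𝓝 (x, x),
    ‖iteratedFDeriv ℝ k g q.1 - iteratedFDeriv ℝ k g q.2‖ ≤ C * ‖q.1 - q.2‖ ^ α

theorem Filter.Eventually.diag_prod {X : Type*} [TopologicalSpace X] {P : X → Prop} {x : X}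
    (h : ∀ᶠ y in 𝓝 x, P y) : ∀ᶠ q : X × X in 𝓝 (x, x), P q.1 ∧ P q.2 := by
  rw [nhds_prod_eq]
  exact h.prod_mk h

/-- Currying is a linear isometry; this is what lets Hölder classes be handled by induction through
`fderiv`. -/
theorem norm_iteratedFDeriv_succ_sub {E F : Type*} [NormedAddCommGroup E] [NormedSpace ℝ E]
    [NormedAddCommGroup F] [NormedSpace ℝ F] (k : ℕ) (g : E → F) (x y : E) :
    ‖iteratedFDeriv ℝ (k + 1) g x - iteratedFDeriv ℝ (k + 1) g y‖ =
      ‖iteratedFDeriv ℝ k (fderiv ℝ g) x - iteratedFDeriv ℝ k (fderiv ℝ g) y‖ := by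
  have e : ∀ z, iteratedFDeriv ℝ (k + 1) g z = (continuousMultilinearCurryRightEquiv' ℝ k E F).symm
      (iteratedFDeriv ℝ k (fderiv ℝ g) z) := fun z => by
    rw [iteratedFDeriv_succ_eq_comp_right]
    rfl
  rw [e, e, ← LinearIsometryEquiv.map_sub, LinearIsometryEquiv.norm_map]

namespace HolderDiffAt

section

variable {E F G : Type*} [NormedAddCommGroup E] [NormedSpace ℝ E]
    [NormedAddCommGroup F] [NormedSpace ℝ F] [NormedAddCommGroup G] [NormedSpace ℝ G]
    {k : ℕ} {α : ℝ} {g : E → F} {x : E}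

theorem congr {g' : E → F} (hg : HolderDiffAt k α g x) (h : g' =ᶠ[𝓝 x] g) :
    HolderDiffAt k α g' x := by
  refine ⟨hg.1.congr_of_eventuallyEq h, hg.2.imp fun C hC => ?_⟩
  filter_upwards [hC, (h.iteratedFDeriv ℝ k).diag_prod] with q hq hq'
  rwa [hq'.1, hq'.2]

theorem succ_of_hasFDerivAt {g' : E → E →L[ℝ] F} (h : ∀ᶠ y in 𝓝 x, HasFDerivAt g (g' y) y)
    (hg : HolderDiffAt k α g' x) : HolderDiffAt (k + 1) α g x := by
  have h' : fderiv ℝ g =ᶠ[𝓝 x] g' := h.mono fun y hy => hy.fderiv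
  refine ⟨?_, ?_⟩
  · push_cast
    exact contDiffAt_succ_iff_hasFDerivAt.2 ⟨g', ⟨_, h, fun y hy => hy⟩, hg.1⟩
  · refine (hg.congr h').2.imp fun C hC => hC.mono fun q hq => ?_
    rwa [norm_iteratedFDeriv_succ_sub]

theorem fderiv_of_succ (hg : HolderDiffAt (k + 1) α g x) : HolderDiffAt k α (fderiv ℝ g) x := by
  refine ⟨hg.1.fderiv_right (by push_cast; exact le_rfl), hg.2.imp fun C hC => hC.mono fun q hq => ?_⟩
  rwa [norm_iteratedFDeriv_succ_sub] at hq

theorem eventually_hasFDerivAt (hg : HolderDiffAt (k + 1) α g x) :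
    ∀ᶠ y in 𝓝 x, HasFDerivAt g (fderiv ℝ g y) y := by
  filter_upwards [hg.1.eventually (by simp)] with y hy
  exact (hy.differentiableAt (by simp)).hasFDerivAt

theorem clm_comp (L : F →L[ℝ] G) (hg : HolderDiffAt k α g x) :
    HolderDiffAt k α (fun y => L (g y)) x := by
  refine ⟨L.contDiff.contDiffAt.comp x hg.1, ?_⟩
  obtain ⟨C, hC⟩ := hg.2
  refine ⟨‖L‖ * C, ?_⟩
  filter_upwards [hC, (hg.1.eventually (by simp)).diag_prod] with q hq hq'
  have e : ∀ y, ContDiffAt ℝ k g y → iteratedFDeriv ℝ k (fun y => L (g y)) y =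
      L.compContinuousMultilinearMap (iteratedFDeriv ℝ k g y) := fun y hy =>
    L.iteratedFDeriv_comp_left hy le_rfl
  rw [e _ hq'.1, e _ hq'.2]
  have : L.compContinuousMultilinearMap (iteratedFDeriv ℝ k g q.1) -
      L.compContinuousMultilinearMap (iteratedFDeriv ℝ k g q.2) =
      L.compContinuousMultilinearMap (iteratedFDeriv ℝ k g q.1 - iteratedFDeriv ℝ k g q.2) := by
    ext; simp
  rw [this, mul_assoc]
  exact (ContinuousLinearMap.norm_compContinuousMultilinearMap_le _ _).trans
    (mul_le_mul_of_nonneg_left hq (norm_nonneg _))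

theorem add {g' : E → F} (hg : HolderDiffAt k α g x) (hg' : HolderDiffAt k α g' x) :
    HolderDiffAt k α (fun y => g y + g' y) x := by
  refine ⟨hg.1.add hg'.1, ?_⟩
  obtain ⟨C, hC⟩ := hg.2
  obtain ⟨C', hC'⟩ := hg'.2
  refine ⟨C + C', ?_⟩
  filter_upwards [hC, hC', (hg.1.eventually (by simp)).diag_prod,
    (hg'.1.eventually (by simp)).diag_prod] with q h1 h2 h3 h4
  have e : ∀ y, ContDiffAt ℝ k g y → ContDiffAt ℝ k g' y →
      iteratedFDeriv ℝ k (fun y => g y + g' y) y =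
      iteratedFDeriv ℝ k g y + iteratedFDeriv ℝ k g' y := fun y hy hy' =>
    iteratedFDeriv_add_apply hy hy'
  rw [e _ h3.1 h4.1, e _ h3.2 h4.2, add_mul, add_sub_add_comm]
  exact (norm_add_le _ _).trans (add_le_add h1 h2)

theorem prodMk {g' : E → G} (hg : HolderDiffAt k α g x) (hg' : HolderDiffAt k α g' x) :
    HolderDiffAt k α (fun y => (g y, g' y)) x := by
  have := (hg.clm_comp (ContinuousLinearMap.inl ℝ F G)).add
    (hg'.clm_comp (ContinuousLinearMap.inr ℝ F G))
  simpa using this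

/-- The derivative of order `k` is locally Lipschitz, and for points at distance at most 1 a
Lipschitz bound implies an `α`-Hölder one. -/
theorem of_contDiffAt (hα : 0 < α) (hα' : α ≤ 1) (hg : ContDiffAt ℝ (k + 1 : ℕ) g x) :
    HolderDiffAt k α g x := by
  refine ⟨hg.of_le (by exact_mod_cast k.le_succ), ?_⟩
  have h1 : ContDiffAt ℝ 1 (iteratedFDeriv ℝ k g) x :=
    hg.iteratedFDeriv_right (by push_cast; rw [add_comm])
  obtain ⟨K, t, ht, hK⟩ := h1.exists_lipschitzOnWith
  refine ⟨K, ?_⟩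
  filter_upwards [(eventually_mem_set.2 ht).diag_prod,
    (eventually_mem_set.2
      (Metric.ball_mem_nhds x (show (0 : ℝ) < 1 / 2 by norm_num))).diag_prod] with q hq hq'
  refine (hK.norm_sub_le hq.1 hq.2).trans (mul_le_mul_of_nonneg_left ?_ K.2)
  have hd : ‖q.1 - q.2‖ ≤ 1 := by
    rw [← dist_eq_norm]
    have h1 := Metric.mem_ball.1 hq'.1
    have h2 := Metric.mem_ball'.1 hq'.2
    linarith [dist_triangle q.1 x q.2]
  have := Real.rpow_le_rpow_of_exponent_ge' (norm_nonneg (q.1 - q.2)) hd hα.le hα'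
  rwa [Real.rpow_one] at this

theorem of_le (hα : 0 < α) (hα' : α ≤ 1) {j : ℕ} (hj : j ≤ k) (hg : HolderDiffAt k α g x) :
    HolderDiffAt j α g x := by
  rcases hj.eq_or_lt with rfl | h
  · exact hg
  · exact of_contDiffAt hα hα' (hg.1.of_le (by exact_mod_cast h))

end

theorem norm_iteratedFDeriv_zero_sub {E F : Type*} [NormedAddCommGroup E] [NormedSpace ℝ E]
    [NormedAddCommGroup F] [NormedSpace ℝ F] (g : E → F) (x y : E) :
    ‖iteratedFDeriv ℝ 0 g x - iteratedFDeriv ℝ 0 g y‖ = ‖g x - g y‖ := by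
  rw [iteratedFDeriv_zero_eq_comp]
  simp only [Function.comp_apply]
  rw [← LinearIsometryEquiv.map_sub, LinearIsometryEquiv.norm_map]

theorem zero_iff {E F : Type*} [NormedAddCommGroup E] [NormedSpace ℝ E]
    [NormedAddCommGroup F] [NormedSpace ℝ F] {α : ℝ} {g : E → F} {x : E} :
    HolderDiffAt 0 α g x ↔ ContDiffAt ℝ 0 g x ∧ ∃ C : ℝ, ∀ᶠ q : E × E in 𝓝 (x, x),
      ‖g q.1 - g q.2‖ ≤ C * ‖q.1 - q.2‖ ^ α := by
  simp only [HolderDiffAt, norm_iteratedFDeriv_zero_sub]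
  rfl

/-- One of the two maps must be locally Lipschitz, since composing two `α`-Hölder maps would only
give the exponent `α²`. -/
theorem comp_zero {E F G : Type*} [NormedAddCommGroup E] [NormedSpace ℝ E] [NormedAddCommGroup F]
    [NormedSpace ℝ F] [NormedAddCommGroup G] [NormedSpace ℝ G] {α : ℝ} (hα : 0 < α) {g : F → G}
    {f : E → F} {x : E} (hg : HolderDiffAt 0 α g (f x)) (hf : HolderDiffAt 0 α f x)
    (h : ContDiffAt ℝ 1 f x ∨ ContDiffAt ℝ 1 g (f x)) :
    HolderDiffAt 0 α (fun y => g (f y)) x := by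
  rw [zero_iff] at *
  refine ⟨hg.1.comp x hf.1, ?_⟩
  have hc : ContinuousAt (fun q : E × E => (f q.1, f q.2)) (x, x) :=
    (hf.1.continuousAt.comp continuousAt_fst).prodMk (hf.1.continuousAt.comp continuousAt_snd)
  rcases h with h | h
  · obtain ⟨C, hC⟩ := hg.2
    obtain ⟨K, t, ht, hK⟩ := h.exists_lipschitzOnWith
    refine ⟨|C| * K ^ α, ?_⟩
    filter_upwards [(eventually_mem_set.2 ht).diag_prod, hc.eventually hC] with q hq hq'
    calc _ ≤ C * ‖f q.1 - f q.2‖ ^ α := hq'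
      _ ≤ |C| * (K * ‖q.1 - q.2‖) ^ α := by
        gcongr
        · exact le_abs_self C
        · exact hK.norm_sub_le hq.1 hq.2
      _ = _ := by rw [Real.mul_rpow K.coe_nonneg (norm_nonneg _), mul_assoc]
  · obtain ⟨C, hC⟩ := hf.2
    obtain ⟨K, t, ht, hK⟩ := h.exists_lipschitzOnWith
    refine ⟨K * C, ?_⟩
    filter_upwards [hc.eventually (eventually_mem_set.2 ht).diag_prod, hC] with q hq hq'
    rw [mul_assoc]
    exact (hK.norm_sub_le hq.1 hq.2).trans (mul_le_mul_of_nonneg_left hq' K.2)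

universe u v

/-- Kept apart from `comp`, whose spaces share one universe. The target sits in the larger universe
so that `E →L[ℝ] H` is again an admissible target for the induction. -/
theorem comp_clm {α : ℝ} (hα : 0 < α) (hα' : α ≤ 1) (k : ℕ) :
    ∀ {E : Type u} {G : Type v} {H : Type (max u v)} [NormedAddCommGroup E] [NormedSpace ℝ E]
    [NormedAddCommGroup H] [NormedSpace ℝ H] [NormedAddCommGroup G] [NormedSpace ℝ G]
    {g : E → H} (L : G →L[ℝ] E) {x : G}, HolderDiffAt k α g (L x) →
    HolderDiffAt k α (fun y => g (L y)) x := by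
  induction k with
  | zero =>
    intro E G H _ _ _ _ _ _ g L x hg
    exact comp_zero hα hg (of_contDiffAt hα hα' L.contDiff.contDiffAt)
      (Or.inl L.contDiff.contDiffAt)
  | succ k ih =>
    intro E G H _ _ _ _ _ _ g L x hg
    refine succ_of_hasFDerivAt (g' := fun y => (fderiv ℝ g (L y)).comp L) ?_ ?_
    · filter_upwards [L.continuous.continuousAt.eventually hg.eventually_hasFDerivAt] with y hy
      exact hy.comp y L.hasFDerivAt
    · exact (ih L hg.fderiv_of_succ).clm_comp ((ContinuousLinearMap.compL ℝ G E H).flip L)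

/-- The derivative is the bilinear composition of `Dg ∘ f` and `Df`, to which the induction
hypothesis applies twice. The `C¹` alternative matters only at order 0; at higher order it is
implied. -/
theorem comp {α : ℝ} (hα : 0 < α) (hα' : α ≤ 1) (k : ℕ) :
    ∀ {E F G : Type u} [NormedAddCommGroup E] [NormedSpace ℝ E] [NormedAddCommGroup F]
    [NormedSpace ℝ F] [NormedAddCommGroup G] [NormedSpace ℝ G] {g : F → G} {f : E → F} {x : E},
    HolderDiffAt k α g (f x) → HolderDiffAt k α f x →
    (ContDiffAt ℝ 1 f x ∨ ContDiffAt ℝ 1 g (f x)) →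
    HolderDiffAt k α (fun y => g (f y)) x := by
  induction k with
  | zero =>
    intro E F G _ _ _ _ _ _ g f x hg hf h1
    exact comp_zero hα hg hf h1
  | succ k ih =>
    intro E F G _ _ _ _ _ _ g f x hg hf _
    have h1 : ContDiffAt ℝ 1 f x := hf.1.of_le (by exact_mod_cast k.succ_pos)
    refine succ_of_hasFDerivAt (g' := fun y => (fderiv ℝ g (f y)).comp (fderiv ℝ f y)) ?_ ?_
    · filter_upwards [hf.1.continuousAt.eventually hg.eventually_hasFDerivAt,
        hf.eventually_hasFDerivAt] with y hy hy'
      exact hy.comp y hy'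
    · have h2 : HolderDiffAt k α (fun y => fderiv ℝ g (f y)) x :=
        ih hg.fderiv_of_succ (hf.of_le hα hα' k.le_succ) (Or.inl h1)
      refine ih (g := fun q : (F →L[ℝ] G) × (E →L[ℝ] F) => q.1.comp q.2)
        (f := fun y => (fderiv ℝ g (f y), fderiv ℝ f y)) ?_ (h2.prodMk hf.fderiv_of_succ)
        (Or.inr ?_)
      · exact of_contDiffAt hα hα' (isBoundedBilinearMap_comp.contDiff.contDiffAt)
      · exact isBoundedBilinearMap_comp.contDiff.contDiffAt

/-- The local inverse of a locally Hölder differentiable map is of the same class. -/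
theorem symm {E F : Type u} [NormedAddCommGroup E] [NormedSpace ℝ E] [CompleteSpace E]
    [NormedAddCommGroup F] [NormedSpace ℝ F]  {α : ℝ} (hα : 0 < α)
    (hα' : α ≤ 1) {k : ℕ} (hk : 1 ≤ k) (e : OpenPartialHomeomorph E F) {x : E} (hx : x ∈ e.source)
    (he : HolderDiffAt k α e x) {e' : E ≃L[ℝ] F} (he' : HasFDerivAt e (e' : E →L[ℝ] F) x) :
    HolderDiffAt k α e.symm (e x) := by
  have hsymm : ContDiffAt ℝ k e.symm (e x) := by
    refine e.contDiffAt_symm (e.map_source hx) (f₀' := e') ?_ ?_ <;> rw [e.left_inv hx]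
    exacts [he', he.1]
  have hsymm1 : ContDiffAt ℝ 1 e.symm (e x) := hsymm.of_le (by exact_mod_cast hk)
  have key : ∀ j ≤ k, HolderDiffAt j α e.symm (e x) := by
    intro j
    induction j with
    | zero => exact fun _ => of_contDiffAt hα hα' hsymm1
    | succ j ih =>
      intro hj
      have hgj := ih (by omega)
      have hej : HolderDiffAt j α (fderiv ℝ e) x := (he.of_le hα hα' hj).fderiv_of_succ
      have hd : fderiv ℝ e x = e' := he'.fderiv
      -- Bootstrap through `D(e⁻¹) = inverse ∘ De ∘ e⁻¹`: the right side has the class already known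
      -- for `e⁻¹`, and operator inversion is smooth near an invertible operator.
      refine succ_of_hasFDerivAt
        (g' := fun y => ContinuousLinearMap.inverse (fderiv ℝ e (e.symm y))) ?_ ?_
      · have hopen : ∀ᶠ A in 𝓝 (e' : E →L[ℝ] F), A ∈ range ((↑) : (E ≃L[ℝ] F) → E →L[ℝ] F) :=
          ContinuousLinearEquiv.nhds e'
        have hc : ContinuousAt (fun y => fderiv ℝ e (e.symm y)) (e x) := by
          refine ContinuousAt.comp (g := fderiv ℝ e) ?_ hsymm.continuousAt
          rw [e.left_inv hx]
          exact hej.1.continuousAt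
        have hc' := hc.tendsto
        rw [e.left_inv hx, hd] at hc'
        have hdiff : ∀ᶠ y in 𝓝 (e x), HasFDerivAt e (fderiv ℝ e (e.symm y)) (e.symm y) := by
          refine hsymm.continuousAt.eventually (p := fun z => HasFDerivAt e (fderiv ℝ e z) z) ?_
          rw [e.left_inv hx]
          exact (he.of_le hα hα' hj).eventually_hasFDerivAt
        filter_upwards [hc'.eventually hopen, hdiff, e.open_target.mem_nhds (e.map_source hx)]
          with y hy hy' hyt
        obtain ⟨A, hA⟩ := hy
        rw [← hA] at hy' ⊢
        rw [ContinuousLinearMap.inverse_equiv]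
        exact e.hasFDerivAt_symm hyt hy'
      · refine comp hα hα' j (g := ContinuousLinearMap.inverse)
          (f := fun y => fderiv ℝ e (e.symm y)) ?_ ?_ (Or.inr ?_)
        · rw [e.left_inv hx, hd]
          exact of_contDiffAt hα hα' (contDiffAt_map_inverse e')
        · refine comp hα hα' j (g := fderiv ℝ e) ?_ hgj (Or.inl hsymm1)
          rwa [e.left_inv hx]
        · rw [e.left_inv hx, hd]
          exact contDiffAt_map_inverse e'
  exact key k le_rfl

end HolderDiffAt

theorem IsHolderClassOn.mono_of_isOpen {E F : Type*} [NormedAddCommGroup E] [NormedSpace ℝ E]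
    [NormedAddCommGroup F] [NormedSpace ℝ F] {m : ℕ} {α : ℝ} {g : E → F} {O : Set E}
    (hO : IsOpen O) (hg : ∀ x ∈ O, ContDiffAt ℝ m g x)
    (hb : ∀ j ≤ m, ∃ C : ℝ, ∀ u ∈ O, ‖iteratedFDeriv ℝ j g u‖ ≤ C)
    (hh : ∃ C : ℝ, ∀ u ∈ O, ∀ v ∈ O,
      ‖iteratedFDeriv ℝ m g u - iteratedFDeriv ℝ m g v‖ ≤ C * ‖u - v‖ ^ α) :
    IsHolderClassOn m α g O := by
  have e : ∀ j, EqOn (iteratedFDerivWithin ℝ j g O) (iteratedFDeriv ℝ j g) O := fun j =>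
    iteratedFDerivWithin_of_isOpen j hO
  refine ⟨fun x hx => (hg x hx).contDiffWithinAt, fun j hj => (hb j hj).imp fun C hC u hu => ?_,
    hh.imp fun C hC u hu v hv => ?_⟩
  · rw [e j hu]; exact hC u hu
  · rw [e m hu, e m hv]; exact hC u hu v hv

/-- Each of the finitely many derivatives is continuous at `x`, hence bounded nearby; intersecting
the neighbourhoods makes all bounds uniform on every smaller open set. -/
theorem HolderDiffAt.exists_isHolderClassOn {E F : Type*} [NormedAddCommGroup E] [NormedSpace ℝ E]
    [NormedAddCommGroup F] [NormedSpace ℝ F] {m : ℕ} {α : ℝ} {g : E → F} {x : E}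
    (hg : HolderDiffAt m α g x) :
    ∃ N ∈ 𝓝 x, ∀ O ⊆ N, IsOpen O → IsHolderClassOn m α g O := by
  obtain ⟨C, hC⟩ := hg.2
  rw [nhds_prod_eq] at hC
  obtain ⟨N₁, hN₁, hN₁'⟩ := eventually_prod_self_iff
    (r := fun u v => ‖iteratedFDeriv ℝ m g u - iteratedFDeriv ℝ m g v‖ ≤ C * ‖u - v‖ ^ α).1 hC
  have hb : ∀ j ∈ Finset.range (m + 1), ∃ N ∈ 𝓝 x, ∃ C : ℝ, ∀ u ∈ N,
      ‖iteratedFDeriv ℝ j g u‖ ≤ C := by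
    intro j hj
    have hj' : j ≤ m := by simpa [Nat.lt_succ_iff] using hj
    have hc : ContinuousAt (iteratedFDeriv ℝ j g) x :=
      (hg.1.iteratedFDeriv_right (m := 0) (i := j)
        (by rw [zero_add]; exact_mod_cast hj')).continuousAt
    refine ⟨_, hc.norm.eventually (gt_mem_nhds (lt_add_one _)), _, fun u hu => le_of_lt hu⟩
  choose! N hN C' hC' using hb
  refine ⟨N₁ ∩ {y | ContDiffAt ℝ m g y} ∩ ⋂ j ∈ Finset.range (m + 1), N j,
    inter_mem (inter_mem hN₁ (hg.1.eventually (by simp)))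
      ((Filter.biInter_finset_mem _).2 hN), fun O hO hOo => ?_⟩
  refine IsHolderClassOn.mono_of_isOpen hOo (fun y hy => (hO hy).1.2)
    (fun j hj => ⟨C' j, fun u hu => ?_⟩) ⟨C, fun u hu v hv => ?_⟩
  · have hj' : j ∈ Finset.range (m + 1) := by simpa [Nat.lt_succ_iff] using hj
    exact hC' j hj' u (mem_iInter₂.1 (hO hu).2 j hj')
  · exact hN₁' _ (hO hu).1.1 _ (hO hv).1.1

/-- The inverse function theorem supplies the chart. It is then shrunk so that its source and its
target lie in neighbourhoods where the map and its inverse have uniform bounds. -/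
theorem isLocalHolderDiffeo_of_holderDiffAt {E : Type*} [NormedAddCommGroup E] [NormedSpace ℝ E]
    [CompleteSpace E] {m : ℕ} (hm : 1 ≤ m) {α : ℝ} (hα : 0 < α) (hα' : α ≤ 1) {g : E → E}
    (hg : ∀ x, HolderDiffAt m α g x) (hg' : ∀ x, IsUnit (fderiv ℝ g x)) :
    IsLocalHolderDiffeo m α g := by
  intro a
  obtain ⟨v, hv⟩ := hg' a
  obtain ⟨e', he'⟩ : ∃ e' : E ≃L[ℝ] E, (e' : E →L[ℝ] E) = fderiv ℝ g a :=
    ⟨ContinuousLinearEquiv.unitsEquiv ℝ E v, hv⟩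
  have hm0 : (m : WithTop ℕ∞) ≠ 0 := by
    have : m ≠ 0 := by omega
    exact_mod_cast this
  have hd : HasFDerivAt g (e' : E →L[ℝ] E) a := by
    rw [he']
    exact ((hg a).1.differentiableAt hm0).hasFDerivAt
  let e := (hg a).1.toOpenPartialHomeomorph g hd hm0
  have hea : a ∈ e.source := (hg a).1.mem_toOpenPartialHomeomorph_source hd hm0
  have hcoe : ∀ x, e x = g x := fun x => rfl
  have hs : HolderDiffAt m α e.symm (e a) := HolderDiffAt.symm hα hα' hm e hea (hg a) hd
  obtain ⟨N₁, hN₁, h₁⟩ := (hg a).exists_isHolderClassOn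
  obtain ⟨N₂, hN₂, h₂⟩ := hs.exists_isHolderClassOn
  have hO : interior (N₁ ∩ e ⁻¹' N₂) ∈ 𝓝 a :=
    interior_mem_nhds.2 (inter_mem hN₁ ((e.continuousAt hea).preimage_mem_nhds hN₂))
  refine ⟨e.restrOpen (interior (N₁ ∩ e ⁻¹' N₂)) isOpen_interior, ?_, ?_, ?_, ?_⟩
  · exact ⟨hea, mem_of_mem_nhds hO⟩
  · exact fun x _ => rfl
  · refine h₁ _ ?_ (OpenPartialHomeomorph.open_source _)
    exact fun x hx => (interior_subset hx.2).1
  · refine h₂ _ ?_ (OpenPartialHomeomorph.open_target _)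
    intro y hy
    have hy' : e.symm y ∈ interior (N₁ ∩ e ⁻¹' N₂) := hy.2
    have := (interior_subset hy').2
    rwa [mem_preimage, e.right_inv hy.1] at this

/-! ### The Banach space of controlled paths -/

/-- A rough path and a controlled path over it, on a linear order on which the control is small. -/
structure Driver (ι U W : Type*) [LinearOrder ι] [NormedAddCommGroup U] [NormedSpace ℝ U]
    [NormedAddCommGroup W] [NormedSpace ℝ W] where
  o : ι
  ω : ι → ι → ℝ
  control : ChainControl o ω
  al : ℝ
  τ : ℝ
  al_pos : 0 < al
  τ_pos : 0 < τ
  τ_lt_one : τ < 1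
  one_lt : 1 < (2 + τ) * al
  C : ℝ
  η : ℝ
  d : ℝ
  one_le_C : 1 ≤ C
  η_nonneg : 0 ≤ η
  d_le_C : d ≤ C
  le_one : ∀ s t, s ≤ t → ω s t ≤ 1
  pow_le : ∀ s t, s ≤ t → (ω s t ^ al) ^ (1 - τ) ≤ η
  x : ι → U
  z : ι → W
  zd : ι → U →L[ℝ] W
  zb : ι → ι → ProjTensor U W
  norm_x_le : ∀ s t, s ≤ t → ‖x t - x s‖ ≤ C * ω s t ^ al
  norm_zd_le : ∀ t, ‖zd t‖ ≤ d
  norm_zd_sub_le : ∀ s t, s ≤ t → ‖zd t - zd s‖ ≤ C * ω s t ^ al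
  norm_z_le : ∀ s t, s ≤ t → ‖z t - z s‖ ≤ C * ω s t ^ al
  norm_z_sharp_le : ∀ s t, s ≤ t → ‖z t - z s - zd s (x t - x s)‖ ≤ C * (ω s t ^ al * ω s t ^ al)
  norm_zb_le : ∀ s t, s ≤ t → ‖zb s t‖ ≤ C * (ω s t ^ al * ω s t ^ al)
  chen : ∀ r s t, r ≤ s → s ≤ t →
    zb r s + zb s t + ProjTensor.tmul U W (x s - x r) (z t - z s) = zb r t

namespace Driver

section

variable {ι U W : Type*} [LinearOrder ι] [NormedAddCommGroup U] [NormedSpace ℝ U]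
  [NormedAddCommGroup W] [NormedSpace ℝ W] (D : Driver ι U W)
  {E : Type*} [NormedAddCommGroup E] [NormedSpace ℝ E]
  {F : Type*} [NormedAddCommGroup F] [NormedSpace ℝ F]

/-- The weight of the increments of a driving path. -/
noncomputable def a (s t : ι) : ℝ := D.ω s t ^ D.al

/-- The weight of the increments of the derivative of a controlled path. -/
noncomputable def b (s t : ι) : ℝ := D.a s t ^ D.τ

variable {s t : ι}

theorem a_nonneg (h : s ≤ t) : 0 ≤ D.a s t := Real.rpow_nonneg (D.control.nonneg s t h) _

theorem b_nonneg (h : s ≤ t) : 0 ≤ D.b s t := Real.rpow_nonneg (D.a_nonneg h) _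

theorem a_le_one (h : s ≤ t) : D.a s t ≤ 1 :=
  Real.rpow_le_one (D.control.nonneg s t h) (D.le_one s t h) D.al_pos.le

theorem b_le_one (h : s ≤ t) : D.b s t ≤ 1 :=
  Real.rpow_le_one (D.a_nonneg h) (D.a_le_one h) D.τ_pos.le

/-- The gain from the weaker weight: bounds in `a`, restated in `b`, acquire the small factor `η`.
All smallness on short intervals comes from here. -/
theorem a_le_eta_mul_b (h : s ≤ t) : D.a s t ≤ D.η * D.b s t := by
  have e : D.a s t = D.a s t ^ (1 - D.τ) * D.b s t := by
    rw [b, ← Real.rpow_add_of_nonneg (D.a_nonneg h) (by linarith [D.τ_lt_one]) D.τ_pos.le]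
    simp
  calc D.a s t = D.a s t ^ (1 - D.τ) * D.b s t := e
    _ ≤ _ := mul_le_mul_of_nonneg_right (D.pow_le s t h) (D.b_nonneg h)

theorem a_le_eta (h : s ≤ t) : D.a s t ≤ D.η :=
  (D.a_le_eta_mul_b h).trans (mul_le_of_le_one_right D.η_nonneg (D.b_le_one h))

theorem a_le_b (h : s ≤ t) : D.a s t ≤ D.b s t := by
  have := Real.rpow_le_rpow_of_exponent_ge' (D.a_nonneg h) (D.a_le_one h) D.τ_pos.le
    D.τ_lt_one.le
  rwa [Real.rpow_one] at this

theorem rpow_a_le_b {γ : ℝ} (h : s ≤ t) (hγ : D.τ ≤ γ) : D.a s t ^ γ ≤ D.b s t :=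
  Real.rpow_le_rpow_of_exponent_ge' (D.a_nonneg h) (D.a_le_one h) D.τ_pos.le hγ

theorem a_mul_a_mul_b (h : s ≤ t) :
    D.a s t * D.a s t * D.b s t = D.ω s t ^ ((2 + D.τ) * D.al) := by
  have h0 := D.control.nonneg s t h
  rw [b, a, ← Real.rpow_mul h0, ← Real.rpow_add_of_nonneg h0 D.al_pos.le D.al_pos.le,
    ← Real.rpow_add_of_nonneg h0 (by linarith [D.al_pos])
      (mul_nonneg D.al_pos.le D.τ_pos.le)]
  ring_nf

theorem C_nonneg : 0 ≤ D.C := zero_le_one.trans D.one_le_C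

/-- All the components of the norm of a controlled path `(y, y')` are at most `c`. -/
structure Bd (c : ℝ) (y : ι → E) (y' : ι → U →L[ℝ] E) : Prop where
  path : ∀ t, ‖y t‖ ≤ c
  dag : ∀ t, ‖y' t‖ ≤ c
  dag_sub : ∀ s t, s ≤ t → ‖y' t - y' s‖ ≤ c * D.b s t
  sharp : ∀ s t, s ≤ t → ‖y t - y s - y' s (D.x t - D.x s)‖ ≤ c * (D.a s t * D.b s t)

variable {D} {c c' : ℝ} {y v : ι → E} {y' v' : ι → U →L[ℝ] E}

theorem Bd.add (h : D.Bd c y y') (h' : D.Bd c' v v') : D.Bd (c + c') (y + v) (y' + v') where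
  path t := (norm_add_le _ _).trans (add_le_add (h.path t) (h'.path t))
  dag t := (norm_add_le _ _).trans (add_le_add (h.dag t) (h'.dag t))
  dag_sub s t hst := by
    simp only [Pi.add_apply, add_sub_add_comm, add_mul]
    exact (norm_add_le _ _).trans (add_le_add (h.dag_sub s t hst) (h'.dag_sub s t hst))
  sharp s t hst := by
    simp only [Pi.add_apply, add_sub_add_comm, add_mul, add_apply]
    exact (norm_add_le _ _).trans (add_le_add (h.sharp s t hst) (h'.sharp s t hst))

theorem Bd.smul (r : ℝ) (h : D.Bd c y y') : D.Bd (‖r‖ * c) (r • y) (r • y') where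
  path t := by
    rw [Pi.smul_apply, norm_smul]; exact mul_le_mul_of_nonneg_left (h.path t) (norm_nonneg r)
  dag t := by
    rw [Pi.smul_apply, norm_smul]; exact mul_le_mul_of_nonneg_left (h.dag t) (norm_nonneg r)
  dag_sub s t hst := by
    simp only [Pi.smul_apply, ← smul_sub, norm_smul, mul_assoc]
    exact mul_le_mul_of_nonneg_left (h.dag_sub s t hst) (norm_nonneg r)
  sharp s t hst := by
    simp only [Pi.smul_apply, smul_apply, ← smul_sub, norm_smul, mul_assoc]
    exact mul_le_mul_of_nonneg_left (h.sharp s t hst) (norm_nonneg r)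

theorem Bd.mono (h : D.Bd c y y') (hc : c ≤ c') : D.Bd c' y y' where
  path t := (h.path t).trans hc
  dag t := (h.dag t).trans hc
  dag_sub s t hst := (h.dag_sub s t hst).trans (mul_le_mul_of_nonneg_right hc (D.b_nonneg hst))
  sharp s t hst := (h.sharp s t hst).trans (mul_le_mul_of_nonneg_right hc
    (mul_nonneg (D.a_nonneg hst) (D.b_nonneg hst)))

variable (D E)

/-- The controlled paths with finite norm, as a subspace of all pairs of paths. -/
def pathSubmodule : Submodule ℝ ((ι → E) × (ι → U →L[ℝ] E)) where
  carrier := {y | ∃ c, D.Bd c y.1 y.2}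
  add_mem' := by
    rintro y v ⟨c, h⟩ ⟨c', h'⟩
    exact ⟨_, h.add h'⟩
  zero_mem' := ⟨0, by constructor <;> simp⟩
  smul_mem' := by
    rintro r y ⟨c, h⟩
    exact ⟨_, h.smul r⟩

/-- The controlled paths with values in `E`. -/
def Path : Type _ := D.pathSubmodule E

noncomputable instance : AddCommGroup (D.Path E) := inferInstanceAs (AddCommGroup (D.pathSubmodule E))

noncomputable instance : Module ℝ (D.Path E) := inferInstanceAs (Module ℝ (D.pathSubmodule E))

variable {D E}

namespace Path

/-- The value of a controlled path. -/
def val (y : D.Path E) : ι → E := (y : D.pathSubmodule E).1.1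

/-- The derivative of a controlled path. -/
def dag (y : D.Path E) : ι → U →L[ℝ] E := (y : D.pathSubmodule E).1.2

/-- Constructor. -/
def mk (y : ι → E) (y' : ι → U →L[ℝ] E) (h : ∃ c, D.Bd c y y') : D.Path E :=
  (⟨(y, y'), h⟩ : D.pathSubmodule E)

@[simp] theorem val_mk (y : ι → E) (y' : ι → U →L[ℝ] E) (h : ∃ c, D.Bd c y y') :
    (mk y y' h).val = y := rfl

@[simp] theorem dag_mk (y : ι → E) (y' : ι → U →L[ℝ] E) (h : ∃ c, D.Bd c y y') :
    (mk y y' h).dag = y' := rfl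

@[ext] theorem ext {y v : D.Path E} (h : y.val = v.val) (h' : y.dag = v.dag) : y = v :=
  Subtype.ext (Prod.ext h h')

@[simp] theorem val_add (y v : D.Path E) : (y + v).val = y.val + v.val := rfl
@[simp] theorem dag_add (y v : D.Path E) : (y + v).dag = y.dag + v.dag := rfl
@[simp] theorem val_sub (y v : D.Path E) : (y - v).val = y.val - v.val := rfl
@[simp] theorem dag_sub (y v : D.Path E) : (y - v).dag = y.dag - v.dag := rfl
@[simp] theorem val_smul (r : ℝ) (y : D.Path E) : (r • y).val = r • y.val := rfl
@[simp] theorem dag_smul (r : ℝ) (y : D.Path E) : (r • y).dag = r • y.dag := rfl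
@[simp] theorem val_zero : (0 : D.Path E).val = 0 := rfl
@[simp] theorem dag_zero : (0 : D.Path E).dag = 0 := rfl

theorem exists_bd (y : D.Path E) : ∃ c, D.Bd c y.val y.dag := (y : D.pathSubmodule E).2

/-- The norm of a controlled path. -/
noncomputable def pathNorm (y : D.Path E) : ℝ := sInf {c | D.Bd c y.val y.dag}

theorem bddBelow_bd (y : D.Path E) : BddBelow {c | D.Bd c y.val y.dag} :=
  ⟨0, fun _ hc => (norm_nonneg _).trans (hc.path D.o)⟩

theorem pathNorm_le {y : D.Path E} {c : ℝ} (h : D.Bd c y.val y.dag) : pathNorm y ≤ c :=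
  csInf_le (bddBelow_bd y) h

/-- The infimum is attained: every constraint has the form `m ≤ c * w` with `w ≥ 0`, which survives
passing to the infimum over `c`. -/
theorem bd_pathNorm (y : D.Path E) : D.Bd (pathNorm y) y.val y.dag := by
  have hne : {c | D.Bd c y.val y.dag}.Nonempty := y.exists_bd
  have key : ∀ m w : ℝ, 0 ≤ w → (∀ c, D.Bd c y.val y.dag → m ≤ c * w) → m ≤ pathNorm y * w := by
    intro m w hw h
    rcases hw.eq_or_lt with rfl | hw
    · obtain ⟨c, hc⟩ := hne
      simpa using h c hc
    · rw [← div_le_iff₀ hw]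
      exact le_csInf hne fun c hc => (div_le_iff₀ hw).2 (h c hc)
  constructor
  · intro t
    simpa using key _ 1 zero_le_one fun c hc => by simpa using hc.path t
  · intro t
    simpa using key _ 1 zero_le_one fun c hc => by simpa using hc.dag t
  · exact fun s t hst => key _ _ (D.b_nonneg hst) fun c hc => hc.dag_sub s t hst
  · exact fun s t hst => key _ _ (mul_nonneg (D.a_nonneg hst) (D.b_nonneg hst))
      fun c hc => hc.sharp s t hst

theorem pathNorm_nonneg (y : D.Path E) : 0 ≤ pathNorm y :=
  (norm_nonneg _).trans (y.bd_pathNorm.path D.o)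

theorem pathNorm_smul_le (r : ℝ) (y : D.Path E) : pathNorm (r • y) ≤ ‖r‖ * pathNorm y :=
  pathNorm_le (y.bd_pathNorm.smul r)

noncomputable instance : NormedAddCommGroup (D.Path E) :=
  AddGroupNorm.toNormedAddCommGroup
    { toFun := pathNorm
      map_zero' := le_antisymm (pathNorm_le (by constructor <;> simp)) (pathNorm_nonneg _)
      add_le' := fun y v => pathNorm_le (y.bd_pathNorm.add v.bd_pathNorm)
      neg' := fun y => by
        have h : ∀ v : D.Path E, pathNorm (-v) ≤ pathNorm v := fun v => by
          simpa using pathNorm_smul_le (-1) v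
        exact le_antisymm (h y) (by simpa using h (-y))
      eq_zero_of_map_eq_zero' := fun y hy => by
        have h := y.bd_pathNorm
        change pathNorm y = 0 at hy
        rw [hy] at h
        ext t : 2
        · simpa using h.path t
        · simpa using norm_le_zero_iff.1 (h.dag t) }

noncomputable instance : NormedSpace ℝ (D.Path E) := ⟨pathNorm_smul_le⟩

theorem norm_le {y : D.Path E} {c : ℝ} (h : D.Bd c y.val y.dag) : ‖y‖ ≤ c := pathNorm_le h

theorem bd (y : D.Path E) : D.Bd ‖y‖ y.val y.dag := y.bd_pathNorm

theorem norm_val_sub_le (y : D.Path E) (h : s ≤ t) :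
    ‖y.val t - y.val s‖ ≤ (D.C + 1) * ‖y‖ * D.a s t := by
  have h1 := y.bd.sharp s t h
  have h2 : ‖y.dag s (D.x t - D.x s)‖ ≤ ‖y‖ * (D.C * D.a s t) :=
    ((y.dag s).le_opNorm _).trans (mul_le_mul (y.bd.dag s) (D.norm_x_le s t h)
      (norm_nonneg _) (norm_nonneg _))
  have h3 : D.a s t * D.b s t ≤ D.a s t := mul_le_of_le_one_right (D.a_nonneg h) (D.b_le_one h)
  have h4 := mul_le_mul_of_nonneg_left h3 (norm_nonneg y)
  calc _ = ‖(y.val t - y.val s - y.dag s (D.x t - D.x s)) + y.dag s (D.x t - D.x s)‖ := by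
        congr 1; abel
    _ ≤ _ := (norm_add_le _ _).trans (by linarith)

instance [CompleteSpace E] : CompleteSpace (D.Path E) := by
  refine Metric.complete_of_cauchySeq_tendsto fun u hu => ?_
  have hbd : ∀ ε > 0, ∃ N, ∀ m ≥ N, ∀ n ≥ N, D.Bd ε (u m - u n).val (u m - u n).dag := by
    intro ε hε
    obtain ⟨N, hN⟩ := Metric.cauchySeq_iff.1 hu ε hε
    refine ⟨N, fun m hm n hn => ?_⟩
    have h := hN m hm n hn
    rw [dist_eq_norm] at h
    exact (u m - u n).bd.mono h.le
  have h1 : ∀ t, ∃ l, Tendsto (fun n => (u n).val t) atTop (𝓝 l) := by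
    intro t
    refine cauchySeq_tendsto_of_complete (Metric.cauchySeq_iff.2 fun ε hε => ?_)
    obtain ⟨N, hN⟩ := hbd (ε / 2) (half_pos hε)
    refine ⟨N, fun m hm n hn => ?_⟩
    rw [dist_eq_norm]
    exact ((hN m hm n hn).path t).trans_lt (half_lt_self hε)
  have h2 : ∀ t, ∃ l, Tendsto (fun n => (u n).dag t) atTop (𝓝 l) := by
    intro t
    refine cauchySeq_tendsto_of_complete (Metric.cauchySeq_iff.2 fun ε hε => ?_)
    obtain ⟨N, hN⟩ := hbd (ε / 2) (half_pos hε)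
    refine ⟨N, fun m hm n hn => ?_⟩
    rw [dist_eq_norm]
    exact ((hN m hm n hn).dag t).trans_lt (half_lt_self hε)
  choose l hl using h1
  choose l' hl' using h2
  -- The Cauchy bound passes to the limit in one index, since each component of the norm involves
  -- only finitely many evaluations.
  have hlim : ∀ ε > 0, ∃ N, ∀ m ≥ N, D.Bd ε ((u m).val - l) ((u m).dag - l') := by
    intro ε hε
    obtain ⟨N, hN⟩ := hbd ε hε
    refine ⟨N, fun m hm => ?_⟩
    have ev := eventually_ge_atTop (α := ℕ) N
    constructor
    · intro t
      exact le_of_tendsto ((tendsto_const_nhds.sub (hl t)).norm)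
        (ev.mono fun n hn => (hN m hm n hn).path t)
    · intro t
      exact le_of_tendsto ((tendsto_const_nhds.sub (hl' t)).norm)
        (ev.mono fun n hn => (hN m hm n hn).dag t)
    · intro s t hst
      exact le_of_tendsto (((tendsto_const_nhds.sub (hl' t)).sub
        (tendsto_const_nhds.sub (hl' s))).norm)
        (ev.mono fun n hn => (hN m hm n hn).dag_sub s t hst)
    · intro s t hst
      refine le_of_tendsto ((((tendsto_const_nhds.sub (hl t)).sub
        (tendsto_const_nhds.sub (hl s))).sub ((ContinuousLinearMap.apply ℝ E
          (D.x t - D.x s)).continuous.continuousAt.tendsto.comp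
          (tendsto_const_nhds.sub (hl' s)))).norm)
        (ev.mono fun n hn => (hN m hm n hn).sharp s t hst)
  obtain ⟨N, hN⟩ := hlim 1 one_pos
  -- The limit is `u N` minus the difference `u N - l`, both of finite norm.
  have hmem : ∃ c, D.Bd c l l' := by
    have := ((u N).bd).add ((hN N le_rfl).smul (-1))
    rw [neg_one_smul, neg_one_smul, neg_sub, neg_sub, add_sub_cancel, add_sub_cancel] at this
    exact ⟨_, this⟩
  refine ⟨mk l l' hmem, Metric.tendsto_atTop.2 fun ε hε => ?_⟩
  obtain ⟨N, hN⟩ := hlim (ε / 2) (half_pos hε)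
  refine ⟨N, fun n hn => ?_⟩
  rw [dist_eq_norm]
  exact (norm_le (hN n hn)).trans_lt (half_lt_self hε)

variable (D E)

/-- Evaluation. -/
noncomputable def ev (t : ι) : D.Path E →L[ℝ] E :=
  LinearMap.mkContinuous ⟨⟨fun y => y.val t, fun _ _ => rfl⟩, fun _ _ => rfl⟩ 1 fun y => by
    rw [one_mul]
    exact y.bd.path t

/-- Evaluation of the derivative. -/
noncomputable def evDag (t : ι) : D.Path E →L[ℝ] U →L[ℝ] E :=
  LinearMap.mkContinuous ⟨⟨fun y => y.dag t, fun _ _ => rfl⟩, fun _ _ => rfl⟩ 1 fun y => by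
    rw [one_mul]
    exact y.bd.dag t

/-- Constant paths. -/
noncomputable def const : E →L[ℝ] D.Path E :=
  LinearMap.mkContinuous
    ⟨⟨fun e => mk (fun _ => e) 0 ⟨‖e‖, by
      constructor <;> intros <;> simp <;> have := D.a_nonneg ‹_› <;> have := D.b_nonneg ‹_› <;>
        positivity⟩, fun _ _ => by ext <;> simp⟩, fun _ _ => by ext <;> simp⟩ 1 fun e => by
    rw [one_mul]
    refine norm_le ?_
    constructor <;> intros <;> simp <;> have := D.a_nonneg ‹_› <;> have := D.b_nonneg ‹_› <;>
        positivity

variable {D E}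

@[simp] theorem ev_apply (t : ι) (y : D.Path E) : ev D E t y = y.val t := rfl
@[simp] theorem evDag_apply (t : ι) (y : D.Path E) : evDag D E t y = y.dag t := rfl
@[simp] theorem val_const (e : E) (t : ι) : (const D E e).val t = e := rfl
@[simp] theorem dag_const (e : E) (t : ι) : (const D E e).dag t = 0 := rfl

theorem norm_const_le (e : E) : ‖const D E e‖ ≤ ‖e‖ := by
  have := (const D E).le_of_opNorm_le (LinearMap.mkContinuous_norm_le _ zero_le_one _) e
  simpa using this

/-- Leibniz rule. In the remainder the product of the two increments is of order `a * a`, which `a ≤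
b` turns into the required `a * b`. -/
theorem bd_mul (Y : D.Path (E →L[ℝ] F)) (h : D.Path E) :
    D.Bd (4 * (D.C + 1) ^ 2 * ‖Y‖ * ‖h‖) (fun t => Y.val t (h.val t))
      (fun t => (Y.dag t).flip (h.val t) + (Y.val t).comp (h.dag t)) := by
  have hC := D.one_le_C
  have hP : 0 ≤ ‖Y‖ * ‖h‖ := by positivity
  have hC2 : 1 ≤ (D.C + 1) ^ 2 := by nlinarith
  have hC3 : D.C + 1 ≤ (D.C + 1) ^ 2 := by nlinarith
  have n1 : ∀ t, ‖(Y.dag t).flip (h.val t)‖ ≤ ‖Y‖ * ‖h‖ := fun t =>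
    ((Y.dag t).flip.le_opNorm _).trans (by
      rw [ContinuousLinearMap.opNorm_flip]
      exact mul_le_mul (Y.bd.dag t) (h.bd.path t) (norm_nonneg _) (norm_nonneg _))
  constructor
  · intro t
    calc _ ≤ ‖Y‖ * ‖h‖ := ((Y.val t).le_opNorm _).trans
          (mul_le_mul (Y.bd.path t) (h.bd.path t) (norm_nonneg _) (norm_nonneg _))
      _ ≤ _ := by nlinarith
  · intro t
    have n2 : ‖(Y.val t).comp (h.dag t)‖ ≤ ‖Y‖ * ‖h‖ :=
      (ContinuousLinearMap.opNorm_comp_le _ _).trans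
        (mul_le_mul (Y.bd.path t) (h.bd.dag t) (norm_nonneg _) (norm_nonneg _))
    calc _ ≤ ‖Y‖ * ‖h‖ + ‖Y‖ * ‖h‖ := (norm_add_le _ _).trans (add_le_add (n1 t) n2)
      _ ≤ _ := by nlinarith
  · intro s t hst
    have ha := D.a_nonneg hst
    have hb := D.b_nonneg hst
    have hab := D.a_le_b hst
    have e : (Y.dag t).flip (h.val t) + (Y.val t).comp (h.dag t) -
        ((Y.dag s).flip (h.val s) + (Y.val s).comp (h.dag s)) =
        (Y.dag t - Y.dag s).flip (h.val t) + (Y.dag s).flip (h.val t - h.val s) +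
        (Y.val t - Y.val s).comp (h.dag t) + (Y.val s).comp (h.dag t - h.dag s) := by
      ext u
      simp
      abel
    have k1 : ‖(Y.dag t - Y.dag s).flip (h.val t)‖ ≤ (‖Y‖ * D.b s t) * ‖h‖ :=
      ((Y.dag t - Y.dag s).flip.le_opNorm _).trans (by
        rw [ContinuousLinearMap.opNorm_flip]
        exact mul_le_mul (Y.bd.dag_sub s t hst) (h.bd.path t) (norm_nonneg _) (by positivity))
    have k2 : ‖(Y.dag s).flip (h.val t - h.val s)‖ ≤ ‖Y‖ * ((D.C + 1) * ‖h‖ * D.a s t) :=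
      ((Y.dag s).flip.le_opNorm _).trans (by
        rw [ContinuousLinearMap.opNorm_flip]
        exact mul_le_mul (Y.bd.dag s) (h.norm_val_sub_le hst) (norm_nonneg _) (by positivity))
    have k3 : ‖(Y.val t - Y.val s).comp (h.dag t)‖ ≤ ((D.C + 1) * ‖Y‖ * D.a s t) * ‖h‖ :=
      (ContinuousLinearMap.opNorm_comp_le _ _).trans
        (mul_le_mul (Y.norm_val_sub_le hst) (h.bd.dag t) (norm_nonneg _) (by positivity))
    have k4 : ‖(Y.val s).comp (h.dag t - h.dag s)‖ ≤ ‖Y‖ * (‖h‖ * D.b s t) :=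
      (ContinuousLinearMap.opNorm_comp_le _ _).trans
        (mul_le_mul (Y.bd.path s) (h.bd.dag_sub s t hst) (norm_nonneg _) (by positivity))
    rw [e]
    calc _ ≤ (‖Y‖ * D.b s t) * ‖h‖ + ‖Y‖ * ((D.C + 1) * ‖h‖ * D.a s t) +
          ((D.C + 1) * ‖Y‖ * D.a s t) * ‖h‖ + ‖Y‖ * (‖h‖ * D.b s t) :=
          (norm_add_le _ _).trans (add_le_add ((norm_add_le _ _).trans (add_le_add
            ((norm_add_le _ _).trans (add_le_add k1 k2)) k3)) k4)
      _ = (‖Y‖ * ‖h‖) * (2 * D.b s t + 2 * ((D.C + 1) * D.a s t)) := by ring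
      _ ≤ (‖Y‖ * ‖h‖) * (2 * ((D.C + 1) ^ 2 * D.b s t) + 2 * ((D.C + 1) ^ 2 * D.b s t)) := by
          gcongr
          exact le_mul_of_one_le_left hb hC2
      _ = _ := by ring
  · intro s t hst
    have ha := D.a_nonneg hst
    have hb := D.b_nonneg hst
    have hab := D.a_le_b hst
    have e : Y.val t (h.val t) - Y.val s (h.val s) -
        ((Y.dag s).flip (h.val s) + (Y.val s).comp (h.dag s)) (D.x t - D.x s) =
        (Y.val t - Y.val s - Y.dag s (D.x t - D.x s)) (h.val s) +
        Y.val s (h.val t - h.val s - h.dag s (D.x t - D.x s)) +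
        (Y.val t - Y.val s) (h.val t - h.val s) := by
      simp
      abel
    have k1 : ‖(Y.val t - Y.val s - Y.dag s (D.x t - D.x s)) (h.val s)‖ ≤
        (‖Y‖ * (D.a s t * D.b s t)) * ‖h‖ :=
      (ContinuousLinearMap.le_opNorm _ _).trans
        (mul_le_mul (Y.bd.sharp s t hst) (h.bd.path s) (norm_nonneg _) (by positivity))
    have k2 : ‖Y.val s (h.val t - h.val s - h.dag s (D.x t - D.x s))‖ ≤
        ‖Y‖ * (‖h‖ * (D.a s t * D.b s t)) :=
      (ContinuousLinearMap.le_opNorm _ _).trans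
        (mul_le_mul (Y.bd.path s) (h.bd.sharp s t hst) (norm_nonneg _) (by positivity))
    have k3 : ‖(Y.val t - Y.val s) (h.val t - h.val s)‖ ≤
        ((D.C + 1) * ‖Y‖ * D.a s t) * ((D.C + 1) * ‖h‖ * D.a s t) :=
      (ContinuousLinearMap.le_opNorm _ _).trans
        (mul_le_mul (Y.norm_val_sub_le hst) (h.norm_val_sub_le hst) (norm_nonneg _)
          (by positivity))
    rw [e]
    calc _ ≤ (‖Y‖ * (D.a s t * D.b s t)) * ‖h‖ + ‖Y‖ * (‖h‖ * (D.a s t * D.b s t)) +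
          ((D.C + 1) * ‖Y‖ * D.a s t) * ((D.C + 1) * ‖h‖ * D.a s t) :=
          (norm_add_le _ _).trans (add_le_add ((norm_add_le _ _).trans (add_le_add k1 k2)) k3)
      _ = (‖Y‖ * ‖h‖) * (2 * (D.a s t * D.b s t) + (D.C + 1) ^ 2 * (D.a s t * D.a s t)) := by ring
      _ ≤ (‖Y‖ * ‖h‖) * (2 * ((D.C + 1) ^ 2 * (D.a s t * D.b s t)) +
          2 * ((D.C + 1) ^ 2 * (D.a s t * D.b s t))) := by
          have hnn : 0 ≤ D.a s t * D.b s t := by positivity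
          refine mul_le_mul_of_nonneg_left (add_le_add (mul_le_mul_of_nonneg_left
            (le_mul_of_one_le_left hnn hC2) zero_le_two) ?_) hP
          have h5 := mul_le_mul_of_nonneg_left (mul_le_mul_of_nonneg_left hab ha)
            (sq_nonneg (D.C + 1))
          linarith [mul_nonneg (sq_nonneg (D.C + 1)) hnn]
      _ = _ := by ring

variable (D E F)

/-- The product of a controlled path of operators and a controlled path. -/
noncomputable def mul : D.Path (E →L[ℝ] F) →L[ℝ] D.Path E →L[ℝ] D.Path F :=
  LinearMap.mkContinuous₂
    (LinearMap.mk₂ ℝ (fun Y h => mk _ _ ⟨_, bd_mul Y h⟩)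
      (fun _ _ _ => by ext <;> simp; abel) (fun _ _ _ => by ext <;> simp)
      (fun _ _ _ => by ext <;> simp; abel) (fun _ _ _ => by ext <;> simp))
    (4 * (D.C + 1) ^ 2) fun Y h => norm_le (bd_mul Y h)

variable {D E F}

@[simp] theorem dag_mul (Y : D.Path (E →L[ℝ] F)) (h : D.Path E) (t : ι) :
    (mul D E F Y h).dag t = (Y.dag t).flip (h.val t) + (Y.val t).comp (h.dag t) := rfl

@[simp] theorem val_mul (Y : D.Path (E →L[ℝ] F)) (h : D.Path E) (t : ι) :
    (mul D E F Y h).val t = Y.val t (h.val t) := rfl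

theorem norm_mul_le (Y : D.Path (E →L[ℝ] F)) (h : D.Path E) :
    ‖mul D E F Y h‖ ≤ 4 * (D.C + 1) ^ 2 * ‖Y‖ * ‖h‖ := norm_le (bd_mul Y h)

end Path

end

end Driver

/-! ### Hölder classes on the whole space -/

/-- `g` is bounded and differentiable, with a bounded `γ`-Hölder continuous derivative, all with
the same constant `K`. -/
structure HolderOne {E F : Type*} [NormedAddCommGroup E] [NormedSpace ℝ E]
    [NormedAddCommGroup F] [NormedSpace ℝ F] (γ K : ℝ) (g : E → F) : Prop where
  diff : Differentiable ℝ g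
  norm_le : ∀ u, ‖g u‖ ≤ K
  norm_fderiv_le : ∀ u, ‖fderiv ℝ g u‖ ≤ K
  holder : ∀ u v, ‖fderiv ℝ g u - fderiv ℝ g v‖ ≤ K * ‖u - v‖ ^ γ

section

variable {E F : Type*} [NormedAddCommGroup E] [NormedSpace ℝ E]
    [NormedAddCommGroup F] [NormedSpace ℝ F] {γ K : ℝ} {g : E → F}

theorem isHolderClassOn_univ_iff {m : ℕ} : IsHolderClassOn m γ g univ ↔ ContDiff ℝ m g ∧
    (∀ j ≤ m, ∃ C : ℝ, ∀ u, ‖iteratedFDeriv ℝ j g u‖ ≤ C) ∧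
    ∃ C : ℝ, ∀ u v, ‖iteratedFDeriv ℝ m g u - iteratedFDeriv ℝ m g v‖ ≤ C * ‖u - v‖ ^ γ := by
  simp only [IsHolderClassOn, contDiffOn_univ, iteratedFDerivWithin_univ, mem_univ, true_imp_iff]

theorem IsHolderClassOn.fderiv {m : ℕ} (hg : IsHolderClassOn (m + 1) γ g univ) :
    IsHolderClassOn m γ (fderiv ℝ g) univ := by
  rw [isHolderClassOn_univ_iff] at *
  refine ⟨hg.1.fderiv_right (by push_cast; exact le_rfl), fun j hj => ?_, ?_⟩
  · obtain ⟨C, hC⟩ := hg.2.1 (j + 1) (by omega)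
    refine ⟨C, fun u => ?_⟩
    rw [norm_iteratedFDeriv_fderiv]
    exact hC u
  · refine hg.2.2.imp fun C hC u v => ?_
    rw [← norm_iteratedFDeriv_succ_sub]
    exact hC u v

/-- Distances below 1 use the mean value inequality and the bound `C` on the next derivative; larger
ones use twice the bound `B`. -/
theorem IsHolderClassOn.of_succ (hγ : 0 < γ) (hγ' : γ ≤ 1) {m : ℕ}
    (hg : IsHolderClassOn (m + 1) γ g univ) : IsHolderClassOn m γ g univ := by
  rw [isHolderClassOn_univ_iff] at *
  refine ⟨hg.1.of_le (by exact_mod_cast m.le_succ), fun j hj => hg.2.1 j (by omega), ?_⟩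
  obtain ⟨C, hC⟩ := hg.2.1 (m + 1) le_rfl
  obtain ⟨B, hB⟩ := hg.2.1 m m.le_succ
  have hC0 : 0 ≤ C := (norm_nonneg _).trans (hC 0)
  have hB0 : 0 ≤ B := (norm_nonneg _).trans (hB 0)
  refine ⟨C + 2 * B, fun u v => ?_⟩
  rcases le_total ‖u - v‖ 1 with h | h
  · have hd : Differentiable ℝ (iteratedFDeriv ℝ m g) :=
      hg.1.differentiable_iteratedFDeriv (by exact_mod_cast m.lt_succ_self)
    have h1 : ‖iteratedFDeriv ℝ m g u - iteratedFDeriv ℝ m g v‖ ≤ C * ‖u - v‖ :=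
      convex_univ.norm_image_sub_le_of_norm_fderiv_le (𝕜 := ℝ) (fun x _ => hd x)
        (fun x _ => by rw [norm_fderiv_iteratedFDeriv]; exact hC x) (mem_univ v) (mem_univ u)
    have h2 := Real.rpow_le_rpow_of_exponent_ge' (norm_nonneg (u - v)) h hγ.le hγ'
    rw [Real.rpow_one] at h2
    have h3 : 0 ≤ ‖u - v‖ ^ γ := Real.rpow_nonneg (norm_nonneg _) _
    nlinarith [mul_le_mul_of_nonneg_left h2 hC0, mul_nonneg hB0 h3]
  · have h1 : ‖iteratedFDeriv ℝ m g u - iteratedFDeriv ℝ m g v‖ ≤ B + B :=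
      (norm_sub_le _ _).trans (add_le_add (hB u) (hB v))
    have h2 : 1 ≤ ‖u - v‖ ^ γ := Real.one_le_rpow h hγ.le
    nlinarith

theorem IsHolderClassOn.exists_holderOne (hγ : 0 < γ) (hγ' : γ ≤ 1) {m : ℕ}
    (hg : IsHolderClassOn (m + 1) γ g univ) : ∃ K, 1 ≤ K ∧ HolderOne γ K g := by
  have h1 : IsHolderClassOn 1 γ g univ := by
    induction m with
    | zero => exact hg
    | succ m ih => exact ih (hg.of_succ hγ hγ')
  rw [isHolderClassOn_univ_iff] at h1
  obtain ⟨C₀, h₀⟩ := h1.2.1 0 zero_le_one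
  obtain ⟨C₁, h₁⟩ := h1.2.1 1 le_rfl
  obtain ⟨C₂, h₂⟩ := h1.2.2
  refine ⟨max 1 (max C₀ (max C₁ C₂)), le_max_left _ _, h1.1.differentiable (by simp), fun u => ?_,
    fun u => ?_, fun u v => ?_⟩
  · rw [← norm_iteratedFDeriv_zero (𝕜 := ℝ)]
    exact (h₀ u).trans (by simp)
  · rw [← norm_iteratedFDeriv_one]
    exact (h₁ u).trans (by simp)
  · have := norm_iteratedFDeriv_succ_sub 0 g u v
    rw [HolderDiffAt.norm_iteratedFDeriv_zero_sub] at this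
    rw [← this]
    exact (h₂ u v).trans (mul_le_mul_of_nonneg_right (by simp)
      (Real.rpow_nonneg (norm_nonneg _) _))

/-- Writes `X` as `X ^ (1-κ) * X ^ κ` and bounds each factor by one of the hypotheses. This
interpolation is the source of the loss `κ` in the regularity of the flow. -/
theorem le_mul_rpow_mul_rpow {X M d r κ : ℝ} (hM : 0 ≤ M) (hd : 0 ≤ d) (hr : 0 ≤ r)
    (hX : 0 ≤ X) (hκ : 0 ≤ κ) (hκ' : κ ≤ 1) (h₁ : X ≤ M * d ^ γ) (h₂ : X ≤ M * r ^ γ) :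
    X ≤ M * (d ^ ((1 - κ) * γ) * r ^ (κ * γ)) := by
  have e : ∀ y : ℝ, 0 ≤ y → y = y ^ (1 - κ) * y ^ κ := fun y hy => by
    rw [← Real.rpow_add_of_nonneg hy (by linarith) hκ]; simp
  have k1 : X ^ (1 - κ) ≤ M ^ (1 - κ) * d ^ ((1 - κ) * γ) := by
    rw [mul_comm (1 - κ) γ, Real.rpow_mul hd, ← Real.mul_rpow hM (Real.rpow_nonneg hd _)]
    exact Real.rpow_le_rpow hX h₁ (by linarith)
  have k2 : X ^ κ ≤ M ^ κ * r ^ (κ * γ) := by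
    rw [mul_comm κ γ, Real.rpow_mul hr, ← Real.mul_rpow hM (Real.rpow_nonneg hr _)]
    exact Real.rpow_le_rpow hX h₂ hκ
  calc X = X ^ (1 - κ) * X ^ κ := e X hX
    _ ≤ (M ^ (1 - κ) * d ^ ((1 - κ) * γ)) * (M ^ κ * r ^ (κ * γ)) :=
      mul_le_mul k1 k2 (Real.rpow_nonneg hX _)
        (mul_nonneg (Real.rpow_nonneg hM _) (Real.rpow_nonneg hd _))
    _ = (M ^ (1 - κ) * M ^ κ) * (d ^ ((1 - κ) * γ) * r ^ (κ * γ)) := by ring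
    _ = _ := by rw [← e M hM]

namespace HolderOne

variable (hg : HolderOne γ K g)
include hg

theorem K_nonneg : 0 ≤ K := (norm_nonneg _).trans (hg.norm_le 0)

theorem norm_sub_le (u v : E) : ‖g u - g v‖ ≤ K * ‖u - v‖ :=
  convex_univ.norm_image_sub_le_of_norm_fderiv_le (𝕜 := ℝ) (fun x _ => hg.diff x)
    (fun x _ => hg.norm_fderiv_le x) (mem_univ v) (mem_univ u)

theorem hasFDerivAt_taylor (u w : E) :
    HasFDerivAt (fun w => g (u + w) - g u - fderiv ℝ g u w) (fderiv ℝ g (u + w) - fderiv ℝ g u) w :=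
  (((hasFDerivAt_comp_add_left u).2 (hg.diff (u + w)).hasFDerivAt).sub_const (g u)).sub
    (fderiv ℝ g u).hasFDerivAt

/-- As a function of the displacement, the Taylor remainder has derivative `Dg(u+w) - Dg(u)`, at
most `K * r ^ γ` on the ball of radius `r`. -/
theorem norm_taylor_sub_le (hγ : 0 ≤ γ) (u : E) {v v' : E} {r : ℝ} (hv : ‖v‖ ≤ r)
    (hv' : ‖v'‖ ≤ r) :
    ‖(g (u + v) - g u - fderiv ℝ g u v) - (g (u + v') - g u - fderiv ℝ g u v')‖ ≤
      K * r ^ γ * ‖v - v'‖ := by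
  refine (convex_closedBall (0 : E) r).norm_image_sub_le_of_norm_hasFDerivWithin_le (𝕜 := ℝ)
    (f := fun w => g (u + w) - g u - fderiv ℝ g u w)
    (fun w _ => (hg.hasFDerivAt_taylor u w).hasFDerivWithinAt) (fun w hw => ?_)
    (mem_closedBall_zero_iff.2 hv') (mem_closedBall_zero_iff.2 hv)
  refine (hg.holder _ _).trans (mul_le_mul_of_nonneg_left ?_ hg.K_nonneg)
  rw [add_sub_cancel_left]
  exact Real.rpow_le_rpow (norm_nonneg _) (mem_closedBall_zero_iff.1 hw) hγ

/-- The four terms are paired in two ways: across the two paths (distance `d`) and across the two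
times (distance `r`). The two bounds are then interpolated. -/
theorem norm_fderiv_second_diff_le {κ : ℝ} (hγ : 0 ≤ γ) (hκ : 0 ≤ κ) (hκ' : κ ≤ 1)
    {p q p' q' : E} {d r : ℝ} (hp : ‖p' - p‖ ≤ d) (hq : ‖q' - q‖ ≤ d) (h : ‖p - q‖ ≤ r)
    (h' : ‖p' - q'‖ ≤ r) :
    ‖(fderiv ℝ g p' - fderiv ℝ g q') - (fderiv ℝ g p - fderiv ℝ g q)‖ ≤
      2 * K * (d ^ ((1 - κ) * γ) * r ^ (κ * γ)) := by
  have hK := hg.K_nonneg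
  have k : ∀ {u v : E} {s : ℝ}, ‖u - v‖ ≤ s → ‖fderiv ℝ g u - fderiv ℝ g v‖ ≤ K * s ^ γ :=
    fun h => (hg.holder _ _).trans
      (mul_le_mul_of_nonneg_left (Real.rpow_le_rpow (norm_nonneg _) h hγ) hK)
  refine le_mul_rpow_mul_rpow (by positivity) ((norm_nonneg _).trans hp)
    ((norm_nonneg _).trans h) (norm_nonneg _) hκ hκ' ?_ ?_
  · have e : (fderiv ℝ g p' - fderiv ℝ g q') - (fderiv ℝ g p - fderiv ℝ g q) =
        (fderiv ℝ g p' - fderiv ℝ g p) - (fderiv ℝ g q' - fderiv ℝ g q) := by abel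
    rw [e]
    exact (_root_.norm_sub_le _ _).trans ((add_le_add (k hp) (k hq)).trans_eq (by ring))
  · exact (_root_.norm_sub_le _ _).trans ((add_le_add (k h') (k h)).trans_eq (by ring))

/-- Both remainders vanish at displacement 0, and the derivative of their difference is a second
difference of `Dg`; the mean value inequality concludes. -/
theorem norm_taylor_sub_taylor_le {κ : ℝ} (hγ : 0 ≤ γ) (hκ : 0 ≤ κ) (hκ' : κ ≤ 1)
    {u u' v : E} {d r : ℝ} (hu : ‖u' - u‖ ≤ d) (hv : ‖v‖ ≤ r) :
    ‖(g (u' + v) - g u' - fderiv ℝ g u' v) - (g (u + v) - g u - fderiv ℝ g u v)‖ ≤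
      2 * K * (d ^ ((1 - κ) * γ) * r ^ (κ * γ)) * r := by
  have hr : 0 ≤ r := (norm_nonneg _).trans hv
  have hd : 0 ≤ d := (norm_nonneg _).trans hu
  have hK := hg.K_nonneg
  have := (convex_closedBall (0 : E) r).norm_image_sub_le_of_norm_hasFDerivWithin_le (𝕜 := ℝ)
    (f := fun w => (g (u' + w) - g u' - fderiv ℝ g u' w) - (g (u + w) - g u - fderiv ℝ g u w))
    (C := 2 * K * (d ^ ((1 - κ) * γ) * r ^ (κ * γ)))
    (fun w _ => ((hg.hasFDerivAt_taylor u' w).sub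
      (hg.hasFDerivAt_taylor u w)).hasFDerivWithinAt) (fun w hw => ?_)
    (Metric.mem_closedBall_self hr) (mem_closedBall_zero_iff.2 hv)
  · simp only [add_zero, map_zero, sub_self, sub_zero] at this
    exact this.trans (mul_le_mul_of_nonneg_left hv (by positivity))
  · have hw' := mem_closedBall_zero_iff.1 hw
    refine hg.norm_fderiv_second_diff_le hγ hκ hκ' ?_ hu ?_ ?_ <;> simpa

end HolderOne

end

/-! ### Composition of controlled paths with functions -/

namespace Driver

variable {ι U W : Type*} [LinearOrder ι] [NormedAddCommGroup U] [NormedSpace ℝ U]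
  [NormedAddCommGroup W] [NormedSpace ℝ W] {D : Driver ι U W}

section

variable {E : Type*} [NormedAddCommGroup E] [NormedSpace ℝ E]
  {F : Type*} [NormedAddCommGroup F] [NormedSpace ℝ F]

/-- The components of the norm of a controlled path `(y, y')`, other than the one of `y`, are at
most `R`. -/
structure Tame (D : Driver ι U W) (R : ℝ) (y : ι → E) (y' : ι → U →L[ℝ] E) : Prop where
  dag : ∀ t, ‖y' t‖ ≤ R
  dag_sub : ∀ s t, s ≤ t → ‖y' t - y' s‖ ≤ R * D.b s t
  sharp : ∀ s t, s ≤ t → ‖y t - y s - y' s (D.x t - D.x s)‖ ≤ R * (D.a s t * D.b s t)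

theorem Bd.tame {R : ℝ} {y : ι → E} {y' : ι → U →L[ℝ] E} (h : D.Bd R y y') : D.Tame R y y' :=
  ⟨h.dag, h.dag_sub, h.sharp⟩

namespace Tame

variable {R : ℝ} {y : ι → E} {y' : ι → U →L[ℝ] E} (hy : D.Tame R y y') {s t : ι}
include hy

theorem nonneg : 0 ≤ R := (norm_nonneg _).trans (hy.dag D.o)

theorem norm_sub_le (h : s ≤ t) : ‖y t - y s‖ ≤ (D.C + 1) * R * D.a s t := by
  have h2 : ‖y' s (D.x t - D.x s)‖ ≤ R * (D.C * D.a s t) :=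
    ((y' s).le_opNorm _).trans (mul_le_mul (hy.dag s) (D.norm_x_le s t h)
      (norm_nonneg _) hy.nonneg)
  have h3 : D.a s t * D.b s t ≤ D.a s t := mul_le_of_le_one_right (D.a_nonneg h) (D.b_le_one h)
  have h4 := mul_le_mul_of_nonneg_left h3 hy.nonneg
  calc _ = ‖(y t - y s - y' s (D.x t - D.x s)) + y' s (D.x t - D.x s)‖ := by congr 1; abel
    _ ≤ _ := (norm_add_le _ _).trans (by linarith [hy.sharp s t h])

end Tame

theorem rpow_mul_a_le {P γ : ℝ} (hP : 1 ≤ P) (hγ : D.τ ≤ γ) (hγ' : γ ≤ 1) {s t : ι} (h : s ≤ t) :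
    (P * D.a s t) ^ γ ≤ P * D.b s t := by
  rw [Real.mul_rpow (by linarith) (D.a_nonneg h)]
  refine mul_le_mul ?_ (D.rpow_a_le_b h hγ) (Real.rpow_nonneg (D.a_nonneg h) _) (by linarith)
  have := Real.rpow_le_rpow_of_exponent_le hP hγ'
  rwa [Real.rpow_one] at this

theorem one_le_mul_of_one_le {R : ℝ} (hR : 1 ≤ R) : 1 ≤ (D.C + 1) * R ∧ R ≤ (D.C + 1) * R := by
  have := D.one_le_C
  constructor <;> nlinarith

/-- The Hölder modulus of `Dg` along `y` is of order `a ^ γ`, and `τ ≤ γ` makes this at most `b`, so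
composition stays in the same weighted space. The bound is independent of the size of `y` itself. -/
theorem Tame.bd_comp {γ K R : ℝ} {g : E → F} (hg : HolderOne γ K g) (hγ : D.τ ≤ γ) (hγ' : γ ≤ 1)
    (hR : 1 ≤ R) {y : ι → E} {y' : ι → U →L[ℝ] E} (hy : D.Tame R y y') :
    D.Bd (2 * K * ((D.C + 1) * R) ^ 2) (fun t => g (y t))
      (fun t => (fderiv ℝ g (y t)).comp (y' t)) := by
  have hγ0 : 0 ≤ γ := D.τ_pos.le.trans hγ
  have hK := hg.K_nonneg
  obtain ⟨hP, hRP⟩ := D.one_le_mul_of_one_le hR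
  have hsub := fun {s t} (h : s ≤ t) => hy.norm_sub_le h
  set P := (D.C + 1) * R
  have hP2 : P ≤ P ^ 2 := by nlinarith
  have key : ∀ c, c ≤ 2 * P ^ 2 → K * c ≤ 2 * K * P ^ 2 := fun c hc => by nlinarith
  constructor
  · intro t
    exact (hg.norm_le _).trans (by simpa using key 1 (by linarith))
  · intro t
    refine (ContinuousLinearMap.opNorm_comp_le _ _).trans ?_
    exact (mul_le_mul (hg.norm_fderiv_le _) (hy.dag t) (norm_nonneg _) hK).trans
      (key R (by linarith))
  · intro s t h
    have hb := D.b_nonneg h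
    have e : (fderiv ℝ g (y t)).comp (y' t) - (fderiv ℝ g (y s)).comp (y' s) =
        (fderiv ℝ g (y t) - fderiv ℝ g (y s)).comp (y' t) +
        (fderiv ℝ g (y s)).comp (y' t - y' s) := by
      ext u; simp
    have k0 : ‖fderiv ℝ g (y t) - fderiv ℝ g (y s)‖ ≤ K * (P * D.b s t) :=
      (hg.holder _ _).trans (mul_le_mul_of_nonneg_left ((Real.rpow_le_rpow (norm_nonneg _)
        (hsub h) hγ0).trans (rpow_mul_a_le hP hγ hγ' h)) hK)
    have k1 : ‖(fderiv ℝ g (y t) - fderiv ℝ g (y s)).comp (y' t)‖ ≤ K * (P * D.b s t) * R :=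
      (ContinuousLinearMap.opNorm_comp_le _ _).trans
        (mul_le_mul k0 (hy.dag t) (norm_nonneg _) (by positivity))
    have k2 : ‖(fderiv ℝ g (y s)).comp (y' t - y' s)‖ ≤ K * (R * D.b s t) :=
      (ContinuousLinearMap.opNorm_comp_le _ _).trans
        (mul_le_mul (hg.norm_fderiv_le _) (hy.dag_sub s t h) (norm_nonneg _) hK)
    rw [e]
    calc _ ≤ K * (P * D.b s t) * R + K * (R * D.b s t) :=
          (norm_add_le _ _).trans (add_le_add k1 k2)
      _ = (K * (P * R + R)) * D.b s t := by ring
      _ ≤ _ := mul_le_mul_of_nonneg_right (key _ (by nlinarith)) hb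
  · intro s t h
    have ha := D.a_nonneg h
    have hb := D.b_nonneg h
    have e : g (y t) - g (y s) - ((fderiv ℝ g (y s)).comp (y' s)) (D.x t - D.x s) =
        ((g (y s + (y t - y s)) - g (y s) - fderiv ℝ g (y s) (y t - y s)) -
          (g (y s + 0) - g (y s) - fderiv ℝ g (y s) 0)) +
        fderiv ℝ g (y s) (y t - y s - y' s (D.x t - D.x s)) := by
      simp
    have hPa : 0 ≤ P * D.a s t := by positivity
    have k1 := hg.norm_taylor_sub_le hγ0 (y s) (v := y t - y s) (v' := 0) (hsub h) (by simpa)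
    rw [sub_zero (y t - y s)] at k1
    have k1' : K * (P * D.a s t) ^ γ * ‖y t - y s‖ ≤ K * (P * D.b s t) * (P * D.a s t) :=
      mul_le_mul (mul_le_mul_of_nonneg_left (rpow_mul_a_le hP hγ hγ' h) hK) (hsub h)
        (norm_nonneg _) (by positivity)
    have k2 : ‖fderiv ℝ g (y s) (y t - y s - y' s (D.x t - D.x s))‖ ≤
        K * (R * (D.a s t * D.b s t)) :=
      (ContinuousLinearMap.le_opNorm _ _).trans
        (mul_le_mul (hg.norm_fderiv_le _) (hy.sharp s t h) (norm_nonneg _) hK)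
    rw [e]
    calc _ ≤ K * (P * D.b s t) * (P * D.a s t) + K * (R * (D.a s t * D.b s t)) :=
          (norm_add_le _ _).trans (add_le_add (k1.trans k1') k2)
      _ = (K * (P ^ 2 + R)) * (D.a s t * D.b s t) := by ring
      _ ≤ _ := mul_le_mul_of_nonneg_right (key _ (by linarith)) (by positivity)

open Classical in
/-- The controlled path `(g(y), Dg(y) y')`. -/
noncomputable def nem (g : E → F) (y : D.Path E) : D.Path F :=
  if h : ∃ c, D.Bd c (fun t => g (y.val t)) (fun t => (fderiv ℝ g (y.val t)).comp (y.dag t)) then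
    Path.mk _ _ h else 0

section

variable {γ K : ℝ} {g : E → F} (hg : HolderOne γ K g) (hγ : D.τ ≤ γ) (hγ' : γ ≤ 1)
include hg hγ hγ'

theorem exists_bd_comp (y : D.Path E) : ∃ c, D.Bd c (fun t => g (y.val t))
    (fun t => (fderiv ℝ g (y.val t)).comp (y.dag t)) :=
  ⟨_, (y.bd.mono (le_max_left _ 1)).tame.bd_comp hg hγ hγ' (le_max_right _ _)⟩

theorem val_nem (y : D.Path E) : (nem g y).val = fun t => g (y.val t) := by
  rw [nem, dif_pos (exists_bd_comp hg hγ hγ' y), Path.val_mk]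

theorem dag_nem (y : D.Path E) :
    (nem g y).dag = fun t => (fderiv ℝ g (y.val t)).comp (y.dag t) := by
  rw [nem, dif_pos (exists_bd_comp hg hγ hγ' y), Path.dag_mk]

theorem norm_nem_le {R : ℝ} (hR : 1 ≤ R) (y : D.Path E) (hy : D.Tame R y.val y.dag) :
    ‖nem g y‖ ≤ 2 * K * ((D.C + 1) * R) ^ 2 := by
  refine Path.norm_le ?_
  rw [val_nem hg hγ hγ', dag_nem hg hγ hγ']
  exact hy.bd_comp hg hγ hγ' hR

/-- Interpolation is needed only for second differences of `Dg` and for Taylor remainders at two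
base points; there `τ = κγ` turns the time factor into `b`. Every other term is at least `γ`-Hölder
in the distance, which is better since the distance is at most 1. -/
theorem norm_nem_sub_le {κ R : ℝ} (hκ : 0 < κ) (hκ' : κ < 1) (hτ : D.τ = κ * γ) (hR : 1 ≤ R)
    {y v : D.Path E} (hy : D.Tame R y.val y.dag) (hv : D.Tame R v.val v.dag)
    (hd : ‖v - y‖ ≤ 1) :
    ‖nem g v - nem g y‖ ≤ 6 * K * ((D.C + 1) * R) ^ 2 * ‖v - y‖ ^ ((1 - κ) * γ) := by
  have hγ0 : 0 < γ := D.τ_pos.trans_le hγ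
  have hK := hg.K_nonneg
  obtain ⟨hP, hRP⟩ := D.one_le_mul_of_one_le hR
  have hysub := fun {s t} (h : s ≤ t) => hy.norm_sub_le h
  have hvsub := fun {s t} (h : s ≤ t) => hv.norm_sub_le h
  have hCP : D.C + 1 ≤ (D.C + 1) * R := by nlinarith [D.one_le_C]
  have hh := (v - y).bd
  have hhsub := fun {s t} (h : s ≤ t) => (v - y).norm_val_sub_le h
  have hd0 : 0 ≤ ‖v - y‖ := norm_nonneg _
  simp only [Path.val_sub, Pi.sub_apply] at hhsub
  set P := (D.C + 1) * R
  set d := ‖v - y‖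
  set e := d ^ ((1 - κ) * γ) with he
  have he0 : 0 ≤ e := Real.rpow_nonneg hd0 _
  have hα0 : 0 ≤ (1 - κ) * γ := mul_nonneg (by linarith) hγ0.le
  have hdγ : d ^ γ ≤ e := Real.rpow_le_rpow_of_exponent_ge' hd0 hd hα0 (by nlinarith)
  have hde : d ≤ e := by
    have := Real.rpow_le_rpow_of_exponent_ge' hd0 hd hα0 (show (1 - κ) * γ ≤ 1 by nlinarith)
    rwa [Real.rpow_one] at this
  have hP2 : P ≤ P ^ 2 := by nlinarith
  have key : ∀ c, c ≤ 6 * P ^ 2 → K * c * e ≤ 6 * K * P ^ 2 * e := fun c hc => by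
    have := mul_le_mul_of_nonneg_right (mul_le_mul_of_nonneg_left hc hK) he0
    linarith
  have hpath : ∀ t, ‖v.val t - y.val t‖ ≤ d := hh.path
  have hdag : ∀ t, ‖v.dag t - y.dag t‖ ≤ d := hh.dag
  have hDg : ∀ t, ‖fderiv ℝ g (v.val t) - fderiv ℝ g (y.val t)‖ ≤ K * e := fun t =>
    (hg.holder _ _).trans (mul_le_mul_of_nonneg_left
      ((Real.rpow_le_rpow (norm_nonneg _) (hpath t) hγ0.le).trans hdγ) hK)
  have hPb : ∀ {s t : ι}, s ≤ t → (P * D.a s t) ^ (κ * γ) ≤ P * D.b s t := fun h =>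
    rpow_mul_a_le hP hτ.le (hτ ▸ D.τ_lt_one.le) h
  refine Path.norm_le ?_
  rw [Path.val_sub, Path.dag_sub, val_nem hg hγ hγ', dag_nem hg hγ hγ', val_nem hg hγ hγ',
    dag_nem hg hγ hγ']
  constructor
  · intro t
    calc _ ≤ K * ‖v.val t - y.val t‖ := hg.norm_sub_le _ _
      _ ≤ K * 1 * e := by
        rw [mul_one]; exact mul_le_mul_of_nonneg_left ((hpath t).trans hde) hK
      _ ≤ _ := key 1 (by linarith)
  · intro t
    have e1 : (fderiv ℝ g (v.val t)).comp (v.dag t) - (fderiv ℝ g (y.val t)).comp (y.dag t) =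
        (fderiv ℝ g (v.val t) - fderiv ℝ g (y.val t)).comp (v.dag t) +
        (fderiv ℝ g (y.val t)).comp (v.dag t - y.dag t) := by
      ext u; simp
    have k1 : ‖(fderiv ℝ g (v.val t) - fderiv ℝ g (y.val t)).comp (v.dag t)‖ ≤ K * e * R :=
      (ContinuousLinearMap.opNorm_comp_le _ _).trans
        (mul_le_mul (hDg t) (hv.dag t) (norm_nonneg _) (by positivity))
    have k2 : ‖(fderiv ℝ g (y.val t)).comp (v.dag t - y.dag t)‖ ≤ K * e :=
      (ContinuousLinearMap.opNorm_comp_le _ _).trans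
        (mul_le_mul (hg.norm_fderiv_le _) ((hdag t).trans hde) (norm_nonneg _) hK)
    simp only [Pi.sub_apply]
    rw [e1]
    calc _ ≤ K * e * R + K * e := (norm_add_le _ _).trans (add_le_add k1 k2)
      _ = K * (R + 1) * e := by ring
      _ ≤ _ := key _ (by linarith)
  · intro s t h
    have ha := D.a_nonneg h
    have hb := D.b_nonneg h
    -- Arranged so that the first term is the second difference of `Dg` over the two paths and the
    -- two times.
    have e1 : (fderiv ℝ g (v.val t)).comp (v.dag t) - (fderiv ℝ g (y.val t)).comp (y.dag t) -
        ((fderiv ℝ g (v.val s)).comp (v.dag s) - (fderiv ℝ g (y.val s)).comp (y.dag s)) =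
        ((fderiv ℝ g (v.val t) - fderiv ℝ g (v.val s)) -
          (fderiv ℝ g (y.val t) - fderiv ℝ g (y.val s))).comp (v.dag t) +
        (fderiv ℝ g (y.val t) - fderiv ℝ g (y.val s)).comp (v.dag t - y.dag t) +
        (fderiv ℝ g (v.val s) - fderiv ℝ g (y.val s)).comp (v.dag t - v.dag s) +
        (fderiv ℝ g (y.val s)).comp ((v - y).dag t - (v - y).dag s) := by
      ext u; simp; abel
    have k1 : ‖((fderiv ℝ g (v.val t) - fderiv ℝ g (v.val s)) -
          (fderiv ℝ g (y.val t) - fderiv ℝ g (y.val s))).comp (v.dag t)‖ ≤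
        (2 * K * (e * (P * D.b s t))) * R := by
      refine (ContinuousLinearMap.opNorm_comp_le _ _).trans
        (mul_le_mul ?_ (hv.dag t) (norm_nonneg _) (by positivity))
      refine (hg.norm_fderiv_second_diff_le hγ0.le hκ.le hκ'.le (hpath t) (hpath s) (hysub h)
        (hvsub h)).trans ?_
      exact mul_le_mul_of_nonneg_left (mul_le_mul_of_nonneg_left (hPb h) he0) (by positivity)
    have k2 : ‖(fderiv ℝ g (y.val t) - fderiv ℝ g (y.val s)).comp (v.dag t - y.dag t)‖ ≤
        K * (P * D.b s t) * e := by
      refine (ContinuousLinearMap.opNorm_comp_le _ _).trans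
        (mul_le_mul ?_ ((hdag t).trans hde) (norm_nonneg _) (by positivity))
      exact (hg.holder _ _).trans (mul_le_mul_of_nonneg_left ((Real.rpow_le_rpow (norm_nonneg _)
        (hysub h) hγ0.le).trans (rpow_mul_a_le hP hγ hγ' h)) hK)
    have k3 : ‖(fderiv ℝ g (v.val s) - fderiv ℝ g (y.val s)).comp (v.dag t - v.dag s)‖ ≤
        K * e * (R * D.b s t) :=
      (ContinuousLinearMap.opNorm_comp_le _ _).trans
        (mul_le_mul (hDg s) (hv.dag_sub s t h) (norm_nonneg _) (by positivity))
    have k4 : ‖(fderiv ℝ g (y.val s)).comp ((v - y).dag t - (v - y).dag s)‖ ≤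
        K * (e * D.b s t) :=
      (ContinuousLinearMap.opNorm_comp_le _ _).trans
        (mul_le_mul (hg.norm_fderiv_le _) ((hh.dag_sub s t h).trans
          (mul_le_mul_of_nonneg_right hde hb)) (norm_nonneg _) hK)
    simp only [Pi.sub_apply]
    rw [e1]
    calc _ ≤ (2 * K * (e * (P * D.b s t))) * R + K * (P * D.b s t) * e + K * e * (R * D.b s t) +
          K * (e * D.b s t) := (norm_add_le _ _).trans (add_le_add ((norm_add_le _ _).trans
            (add_le_add ((norm_add_le _ _).trans (add_le_add k1 k2)) k3)) k4)
      _ = K * (2 * P * R + P + R + 1) * e * D.b s t := by ring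
      _ ≤ _ := mul_le_mul_of_nonneg_right (key _ (by nlinarith)) hb
  · intro s t h
    have ha := D.a_nonneg h
    have hb := D.b_nonneg h
    have hhst : ‖(v.val t - v.val s) - (y.val t - y.val s)‖ ≤ P * e * D.a s t := by
      have e2 : (v.val t - v.val s) - (y.val t - y.val s) =
          v.val t - y.val t - (v.val s - y.val s) := by abel
      rw [e2]
      refine (hhsub h).trans (mul_le_mul_of_nonneg_right ?_ ha)
      exact mul_le_mul hCP hde hd0 (by linarith)
    -- The Taylor remainder moves in two stages: first the displacement changes at the base point
    -- `v_s`, then the base point changes with the displacement of `y`.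
    have e1 : g (v.val t) - g (y.val t) - (g (v.val s) - g (y.val s)) -
        ((fderiv ℝ g (v.val s)).comp (v.dag s) - (fderiv ℝ g (y.val s)).comp (y.dag s))
          (D.x t - D.x s) =
        ((g (v.val s + (v.val t - v.val s)) - g (v.val s) -
            fderiv ℝ g (v.val s) (v.val t - v.val s)) -
          (g (v.val s + (y.val t - y.val s)) - g (v.val s) -
            fderiv ℝ g (v.val s) (y.val t - y.val s))) +
        ((g (v.val s + (y.val t - y.val s)) - g (v.val s) -
            fderiv ℝ g (v.val s) (y.val t - y.val s)) -
          (g (y.val s + (y.val t - y.val s)) - g (y.val s) -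
            fderiv ℝ g (y.val s) (y.val t - y.val s))) +
        (fderiv ℝ g (v.val s) - fderiv ℝ g (y.val s))
          (v.val t - v.val s - v.dag s (D.x t - D.x s)) +
        fderiv ℝ g (y.val s) ((v - y).val t - (v - y).val s -
          (v - y).dag s (D.x t - D.x s)) := by
      simp; abel
    have hPa : 0 ≤ P * D.a s t := by positivity
    have k1 := (hg.norm_taylor_sub_le hγ0.le (v.val s) (hvsub h) (hysub h)).trans
      (mul_le_mul (mul_le_mul_of_nonneg_left (rpow_mul_a_le hP hγ hγ' h) hK) hhst
        (norm_nonneg _) (by positivity))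
    have k2 := (hg.norm_taylor_sub_taylor_le hγ0.le hκ.le hκ'.le (hpath s) (hysub h)).trans
      (mul_le_mul_of_nonneg_right (mul_le_mul_of_nonneg_left (mul_le_mul_of_nonneg_left
        (hPb h) he0) (show 0 ≤ 2 * K by positivity)) hPa)
    have k3 : ‖(fderiv ℝ g (v.val s) - fderiv ℝ g (y.val s))
          (v.val t - v.val s - v.dag s (D.x t - D.x s))‖ ≤ K * e * (R * (D.a s t * D.b s t)) :=
      (ContinuousLinearMap.le_opNorm _ _).trans
        (mul_le_mul (hDg s) (hv.sharp s t h) (norm_nonneg _) (by positivity))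
    have k4 : ‖fderiv ℝ g (y.val s) ((v - y).val t - (v - y).val s -
          (v - y).dag s (D.x t - D.x s))‖ ≤ K * (e * (D.a s t * D.b s t)) :=
      (ContinuousLinearMap.le_opNorm _ _).trans
        (mul_le_mul (hg.norm_fderiv_le _) ((hh.sharp s t h).trans
          (mul_le_mul_of_nonneg_right hde (by positivity))) (norm_nonneg _) hK)
    simp only [Pi.sub_apply]
    rw [e1]
    calc _ ≤ K * (P * D.b s t) * (P * e * D.a s t) +
          2 * K * (e * (P * D.b s t)) * (P * D.a s t) + K * e * (R * (D.a s t * D.b s t)) +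
          K * (e * (D.a s t * D.b s t)) := (norm_add_le _ _).trans (add_le_add
            ((norm_add_le _ _).trans (add_le_add ((norm_add_le _ _).trans
              (add_le_add k1 k2)) k3)) k4)
      _ = K * (3 * P ^ 2 + R + 1) * e * (D.a s t * D.b s t) := by ring
      _ ≤ _ := mul_le_mul_of_nonneg_right (key _ (by nlinarith)) (by positivity)

end

end

end Driver

/-! ### Differentiability of the composition operator -/

namespace Driver

variable {ι U W : Type*} [LinearOrder ι] [NormedAddCommGroup U] [NormedSpace ℝ U]
  [NormedAddCommGroup W] [NormedSpace ℝ W] {D : Driver ι U W}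

section

variable {E : Type*} [NormedAddCommGroup E] [NormedSpace ℝ E]
  {F : Type*} [NormedAddCommGroup F] [NormedSpace ℝ F]

theorem continuous_of_locally_holder {X Y : Type*} [NormedAddCommGroup X] [NormedAddCommGroup Y]
    {φ : X → Y} {α : ℝ} (hα : 0 < α)
    (h : ∀ x, ∃ C, ∀ᶠ y in 𝓝 x, ‖φ y - φ x‖ ≤ C * ‖y - x‖ ^ α) : Continuous φ := by
  refine continuous_iff_continuousAt.2 fun x => ?_
  obtain ⟨C, hC⟩ := h x
  rw [ContinuousAt, tendsto_iff_norm_sub_tendsto_zero]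
  refine squeeze_zero' (Eventually.of_forall fun _ => norm_nonneg _) hC ?_
  have h1 : Tendsto (fun y => ‖y - x‖) (𝓝 x) (𝓝 0) := tendsto_norm_sub_self x
  have h2 := (Real.continuousAt_rpow_const 0 α (Or.inr hα.le)).tendsto.comp h1
  rw [Real.zero_rpow hα.ne'] at h2
  simpa using h2.const_mul C

section

variable {γ K : ℝ} {g : E → F} (hg : HolderOne γ K g) (hγ' : γ ≤ 1) {κ : ℝ} (hκ : 0 < κ)
  (hκ' : κ < 1) (hγ : 0 < γ) (hτ : D.τ = κ * γ)
include hg hγ' hκ hκ' hγ hτ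

theorem exists_nem_holder (y : D.Path E) : ∃ C, ∀ᶠ q : D.Path E × D.Path E in 𝓝 (y, y),
    ‖nem g q.1 - nem g q.2‖ ≤ C * ‖q.1 - q.2‖ ^ ((1 - κ) * γ) := by
  have hγτ : D.τ ≤ γ := by rw [hτ]; nlinarith
  refine ⟨6 * K * ((D.C + 1) * (‖y‖ + 1)) ^ 2, ?_⟩
  filter_upwards [(eventually_mem_set.2
    (Metric.ball_mem_nhds y (show (0 : ℝ) < 1 / 2 by norm_num))).diag_prod] with q hq
  have hn : ∀ v ∈ Metric.ball y (1 / 2 : ℝ), D.Tame (‖y‖ + 1) v.val v.dag := by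
    intro v hv
    refine (v.bd.mono ?_).tame
    rw [mem_ball_iff_norm] at hv
    calc ‖v‖ = ‖y + (v - y)‖ := by congr 1; abel
      _ ≤ _ := (norm_add_le _ _).trans (by linarith)
  refine norm_nem_sub_le hg hγτ hγ' hκ hκ' hτ (by linarith [norm_nonneg y]) (hn _ hq.2)
    (hn _ hq.1) ?_
  have h1 := Metric.mem_ball.1 hq.1
  have h2 := Metric.mem_ball'.1 hq.2
  rw [← dist_eq_norm]
  linarith [dist_triangle q.1 y q.2]

theorem holderDiffAt_zero_nem (y : D.Path E) :
    HolderDiffAt 0 ((1 - κ) * γ) (nem g : D.Path E → D.Path F) y := by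
  refine HolderDiffAt.zero_iff.2 ⟨?_, exists_nem_holder hg hγ' hκ hκ' hγ hτ y⟩
  refine (contDiff_zero.2 (continuous_of_locally_holder (mul_pos (sub_pos.2 hκ') hγ)
    fun y => ?_)).contDiffAt
  obtain ⟨C, hC⟩ := exists_nem_holder hg hγ' hκ hκ' hγ hτ y
  exact ⟨C, (continuous_id.prodMk continuous_const).continuousAt.eventually
    (p := fun q : D.Path E × D.Path E => ‖nem g q.1 - nem g q.2‖ ≤
      C * ‖q.1 - q.2‖ ^ ((1 - κ) * γ)) hC⟩

end

/-- Mean value inequality for `ℓ ∘ N` alone. Applied to all the functionals that make up the path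
norm, with their weights `w`, it gives an estimate in that norm before `N` is known to be
differentiable. -/
theorem norm_clm_sub_le_of_ball {X Y G : Type*} [NormedAddCommGroup X] [NormedSpace ℝ X]
    [NormedAddCommGroup Y] [NormedSpace ℝ Y] [NormedAddCommGroup G] [NormedSpace ℝ G]
    {N : X → Y} {N' : X → X →L[ℝ] Y} {x y : X} {δ ε : ℝ}
    (hN' : ∀ v ∈ Metric.ball x δ, ‖N' v - N' x‖ ≤ ε) (hy : y ∈ Metric.ball x δ) (ℓ : Y →L[ℝ] G)
    (w : ℝ) (hw : 0 ≤ w) (hℓ : ∀ v, ‖ℓ v‖ ≤ w * ‖v‖)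
    (hd : ∀ y, HasFDerivAt (fun y => ℓ (N y)) (ℓ.comp (N' y)) y) :
    ‖ℓ (N y - N x - N' x (y - x))‖ ≤ ε * ‖y - x‖ * w := by
  have hδ : 0 < δ := dist_nonneg.trans_lt (Metric.mem_ball.1 hy)
  have := (convex_ball x δ).norm_image_sub_le_of_norm_hasFDerivWithin_le' (𝕜 := ℝ)
    (f := fun y => ℓ (N y)) (φ := ℓ.comp (N' x)) (C := w * ε)
    (fun v _ => (hd v).hasFDerivWithinAt) (fun v hv => ?_) (Metric.mem_ball_self hδ) hy
  · rw [map_sub, map_sub]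
    refine this.trans_eq (by ring)
  · rw [← ContinuousLinearMap.comp_sub]
    exact (ContinuousLinearMap.opNorm_comp_le _ _).trans
      (mul_le_mul (ℓ.opNorm_le_bound hw hℓ) (hN' v hv) (norm_nonneg _) hw)

/-- A map into controlled paths is differentiable if it is so coordinatewise, with a continuous
derivative. -/
theorem hasFDerivAt_of_coord {X : Type*} [NormedAddCommGroup X] [NormedSpace ℝ X]
    {N : X → D.Path F} {N' : X → X →L[ℝ] D.Path F} {x : X} (hc : ContinuousAt N' x)
    (h₁ : ∀ y t, HasFDerivAt (fun y => (N y).val t) ((Path.ev D F t).comp (N' y)) y)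
    (h₂ : ∀ y t, HasFDerivAt (fun y => (N y).dag t) ((Path.evDag D F t).comp (N' y)) y) :
    HasFDerivAt N (N' x) x := by
  refine HasFDerivAt.of_isLittleO (Asymptotics.isLittleO_iff.2 fun ε hε => ?_)
  obtain ⟨δ, hδ, hN'⟩ := Metric.continuousAt_iff.1 hc ε hε
  simp only [dist_eq_norm] at hN'
  filter_upwards [Metric.ball_mem_nhds x hδ] with y hy
  have hball : ∀ v ∈ Metric.ball x δ, ‖N' v - N' x‖ ≤ ε := fun v hv =>
    (hN' (mem_ball_iff_norm.1 hv)).le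
  refine Path.norm_le ⟨fun t => ?_, fun t => ?_, fun s t hst => ?_, fun s t hst => ?_⟩
  · simpa using norm_clm_sub_le_of_ball hball hy (Path.ev D F t) 1 zero_le_one (fun v => by simpa using v.bd.path t)
      (fun y => h₁ y t)
  · simpa using norm_clm_sub_le_of_ball hball hy (Path.evDag D F t) 1 zero_le_one (fun v => by simpa using v.bd.dag t)
      (fun y => h₂ y t)
  · exact norm_clm_sub_le_of_ball hball hy (Path.evDag D F t - Path.evDag D F s) (D.b s t) (D.b_nonneg hst)
      (fun v => by rw [mul_comm]; exact v.bd.dag_sub s t hst)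
      (fun y => by
        rw [ContinuousLinearMap.sub_comp]
        exact (h₂ y t).sub (h₂ y s))
  · exact norm_clm_sub_le_of_ball hball hy (Path.ev D F t - Path.ev D F s -
        (ContinuousLinearMap.apply ℝ F (D.x t - D.x s)).comp (Path.evDag D F s))
      (D.a s t * D.b s t) (mul_nonneg (D.a_nonneg hst) (D.b_nonneg hst))
      (fun v => by rw [mul_comm]; exact v.bd.sharp s t hst)
      (fun y => by
        rw [ContinuousLinearMap.sub_comp, ContinuousLinearMap.sub_comp]
        exact ((h₁ y t).sub (h₁ y s)).sub
          ((ContinuousLinearMap.apply ℝ F (D.x t - D.x s)).hasFDerivAt.comp y (h₂ y s)))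

/-- The candidate derivative is multiplication by `Dg(y)`. On derivatives of paths, the product rule
yields the arguments of `D²g` in the opposite order, so the symmetry of the second derivative is
used. -/
theorem hasFDerivAt_nem {γ K K' : ℝ} {g : E → F} (hg : HolderOne γ K g)
    (hg' : HolderOne γ K' (fderiv ℝ g)) (hg2 : ContDiff ℝ 2 g) (hγ : D.τ ≤ γ) (hγ' : γ ≤ 1)
    (hc : Continuous (nem (fderiv ℝ g) : D.Path E → D.Path (E →L[ℝ] F))) (y : D.Path E) :
    HasFDerivAt (nem g : D.Path E → D.Path F) (Path.mul D E F (nem (fderiv ℝ g) y)) y := by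
  refine hasFDerivAt_of_coord (N' := fun y => Path.mul D E F (nem (fderiv ℝ g) y))
    ((Path.mul D E F).continuous.comp hc).continuousAt (fun y t => ?_) (fun y t => ?_)
  · simp only [val_nem hg hγ hγ']
    have h := (hg.diff (y.val t)).hasFDerivAt.comp y (Path.ev D E t).hasFDerivAt
    refine h.congr_fderiv ?_
    ext v
    simp [val_nem hg' hγ hγ']
  · simp only [dag_nem hg hγ hγ']
    have h1 := (hg'.diff (y.val t)).hasFDerivAt.comp y (Path.ev D E t).hasFDerivAt
    have h := h1.clm_comp (Path.evDag D E t).hasFDerivAt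
    refine h.congr_fderiv ?_
    ext v u
    have hs : IsSymmSndFDerivAt ℝ g (y.val t) :=
      hg2.contDiffAt.isSymmSndFDerivAt (by simp)
    simp [val_nem hg' hγ hγ', dag_nem hg' hγ hγ', hs.eq (v.val t), add_comm]

end

universe u v

/-- The derivative of the operator for `g` is a bounded linear image of the operator for `Dg`, so
the order rises by one at each step, starting from the Hölder estimate. The target universe is
chosen to absorb `E →L[ℝ] F`. -/
theorem holderDiffAt_nem {E : Type u} [NormedAddCommGroup E] [NormedSpace ℝ E] {γ κ : ℝ}
    (hγ : 0 < γ) (hγ' : γ ≤ 1) (hκ : 0 < κ) (hκ' : κ < 1) (hτ : D.τ = κ * γ) (k : ℕ) :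
    ∀ {F : Type (max u v)} [NormedAddCommGroup F] [NormedSpace ℝ F] {g : E → F},
    IsHolderClassOn (k + 1) γ g univ → ∀ y : D.Path E,
    HolderDiffAt k ((1 - κ) * γ) (nem g : D.Path E → D.Path F) y := by
  have hα : 0 < (1 - κ) * γ := mul_pos (sub_pos.2 hκ') hγ
  have hγτ : D.τ ≤ γ := by rw [hτ]; nlinarith
  induction k with
  | zero =>
    intro F _ _ g hg y
    obtain ⟨K, -, hK⟩ := hg.exists_holderOne hγ hγ'
    exact holderDiffAt_zero_nem hK hγ' hκ hκ' hγ hτ y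
  | succ k ih =>
    intro F _ _ g hg y
    obtain ⟨K, -, hK⟩ := hg.exists_holderOne hγ hγ'
    obtain ⟨K', -, hK'⟩ := hg.fderiv.exists_holderOne hγ hγ'
    have hih := fun y : D.Path E => ih hg.fderiv y
    have hc : Continuous (nem (_root_.fderiv ℝ g) : D.Path E → D.Path (E →L[ℝ] F)) :=
      continuous_iff_continuousAt.2 fun y => (hih y).1.continuousAt
    have hg2 : ContDiff ℝ 2 g := (isHolderClassOn_univ_iff.1 hg).1.of_le (by
      exact_mod_cast (by omega : 2 ≤ k + 1 + 1))
    exact HolderDiffAt.succ_of_hasFDerivAt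
      (Eventually.of_forall fun y => hasFDerivAt_nem hK hK' hg2 hγτ hγ' hc y)
      ((hih y).clm_comp (Path.mul D E F))

end Driver

/-! ### Bounded maps out of the projective tensor product -/

namespace ProjTensor

variable {E F G : Type*} [NormedAddCommGroup E] [NormedSpace ℝ E]
  [NormedAddCommGroup F] [NormedSpace ℝ F] [NormedAddCommGroup G] [NormedSpace ℝ G]

/-- Finite sums of elementary tensors are dense in the completion. -/
theorem clm_ext {L L' : ProjTensor E F →L[ℝ] G}
    (h : ∀ a b, L (tmul E F a b) = L' (tmul E F a b)) : L = L' := by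
  ext q
  refine UniformSpace.Completion.induction_on q (isClosed_eq L.continuous L'.continuous) fun t => ?_
  obtain ⟨l, rfl⟩ := AlgTensor.exists_ofList t
  induction l with
  | nil =>
    have : ((AlgTensor.ofList ([] : List (E × F)) : AlgTensor E F) : ProjTensor E F) = 0 := by
      simp [AlgTensor.ofList, UniformSpace.Completion.coe_zero]
    rw [this, map_zero, map_zero]
  | cons q l ih =>
    have : ((AlgTensor.ofList (q :: l) : AlgTensor E F) : ProjTensor E F) =
        tmul E F q.1 q.2 + ((AlgTensor.ofList l : AlgTensor E F) : ProjTensor E F) := by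
      have : (AlgTensor.ofList (q :: l) : AlgTensor E F) =
          AlgTensor.mk E F q.1 q.2 + AlgTensor.ofList l := by simp [AlgTensor.ofList]
      rw [this, UniformSpace.Completion.coe_add]
      rfl
    rw [this, map_add, map_add, ih, h]

theorem norm_lift_apply_le [CompleteSpace G] (B : E →L[ℝ] F →L[ℝ] G) (q : ProjTensor E F) :
    ‖lift B q‖ ≤ ‖B‖ * ‖q‖ := by
  have h : ‖AlgTensor.lift B‖ ≤ ‖B‖ := by
    unfold AlgTensor.lift
    exact LinearMap.mkContinuous_norm_le _ (norm_nonneg B) _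
  refine UniformSpace.Completion.induction_on q (isClosed_le (lift B).continuous.norm
    (continuous_const.mul continuous_norm)) fun t => ?_
  rw [lift, ContinuousLinearMap.fromCompletion_apply_coe, UniformSpace.Completion.norm_coe]
  exact (AlgTensor.lift B).le_of_opNorm_le h t

theorem lift_add [CompleteSpace G] (B B' : E →L[ℝ] F →L[ℝ] G) :
    lift (B + B') = lift B + lift B' :=
  clm_ext fun a b => by simp [lift_tmul]

theorem lift_smul [CompleteSpace G] (r : ℝ) (B : E →L[ℝ] F →L[ℝ] G) :
    lift (r • B) = r • lift B :=
  clm_ext fun a b => by simp [lift_tmul]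

theorem lift_sub [CompleteSpace G] (B B' : E →L[ℝ] F →L[ℝ] G) :
    lift (B - B') = lift B - lift B' :=
  clm_ext fun a b => by simp [lift_tmul]

theorem norm_tmul_le (a : E) (b : F) : ‖tmul E F a b‖ ≤ ‖a‖ * ‖b‖ := by
  refine ((tmul E F).le_opNorm₂ a b).trans ?_
  have : ‖tmul E F‖ ≤ 1 := LinearMap.mkContinuous₂_norm_le _ zero_le_one _
  rw [mul_assoc]
  exact mul_le_of_le_one_left (by positivity) this

end ProjTensor

/-! ### The rough integral as a bounded operator -/

namespace Driver

variable {ι U W : Type*} [LinearOrder ι] [NormedAddCommGroup U] [NormedSpace ℝ U]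
  [NormedAddCommGroup W] [NormedSpace ℝ W] {D : Driver ι U W}
  {V : Type*} [NormedAddCommGroup V] [NormedSpace ℝ V] [CompleteSpace V]

/-- The germ `Y_s z_{s,t} + Y'_s z♭_{s,t}` of the rough integral. -/
noncomputable def germ (D : Driver ι U W) (Y : ι → W →L[ℝ] V) (Y' : ι → U →L[ℝ] W →L[ℝ] V)
    (s t : ι) : V :=
  Y s (D.z t - D.z s) + ProjTensor.lift (Y' s) (D.zb s t)

/-- The tensor term in Chen's relation contributes `Y'_r x_{r,s}` applied to `z_{s,t}`, which
completes the increment of `Y` to its remainder. -/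
theorem germ_sub_sub (Y : ι → W →L[ℝ] V) (Y' : ι → U →L[ℝ] W →L[ℝ] V) {r s t : ι} (hrs : r ≤ s)
    (hst : s ≤ t) : D.germ Y Y' r t - D.germ Y Y' r s - D.germ Y Y' s t =
      -((Y s - Y r - Y' r (D.x s - D.x r)) (D.z t - D.z s) +
        ProjTensor.lift (Y' s - Y' r) (D.zb s t)) := by
  simp only [germ, ← D.chen r s t hrs hst, ProjTensor.lift_sub, map_add, ProjTensor.lift_tmul,
    sub_apply, map_sub]
  abel

/-- The exponent of the error of the rough integral. -/
noncomputable def θ (D : Driver ι U W) : ℝ := (2 + D.τ) * D.al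

theorem mul_le_rpow_θ {r s t : ι} (hrs : r ≤ s) (hst : s ≤ t) :
    D.a r s * D.b r s * D.a s t ≤ D.ω r t ^ D.θ ∧
    D.b r s * (D.a s t * D.a s t) ≤ D.ω r t ^ D.θ := by
  have hrt := hrs.trans hst
  have h1 : D.a r s ≤ D.a r t := D.control.rpow_mono D.al_pos.le le_rfl hrs hst
  have h2 : D.a s t ≤ D.a r t := D.control.rpow_mono D.al_pos.le hrs hst le_rfl
  have h3 : D.b r s ≤ D.b r t := Real.rpow_le_rpow (D.a_nonneg hrs) h1 D.τ_pos.le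
  have n1 := D.a_nonneg hrs
  have n2 := D.a_nonneg hst
  have n3 := D.a_nonneg hrt
  have n4 := D.b_nonneg hrs
  have n5 := D.b_nonneg hrt
  rw [θ, ← D.a_mul_a_mul_b hrt]
  constructor
  · calc _ ≤ D.a r t * D.b r t * D.a r t := by gcongr
      _ = _ := by ring
  · calc _ ≤ D.b r t * (D.a r t * D.a r t) := by gcongr
      _ = _ := by ring

/-- Each of the two defects carries the weights `a * a * b`, that is the power `(2+τ) * al > 1` of
the control: the hypothesis of the sewing lemma. -/
theorem norm_germ_sub_sub_le (Y : D.Path (W →L[ℝ] V)) {r s t : ι} (hrs : r ≤ s) (hst : s ≤ t) :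
    ‖D.germ Y.val Y.dag r t - D.germ Y.val Y.dag r s - D.germ Y.val Y.dag s t‖ ≤
      2 * ‖Y‖ * D.C * D.ω r t ^ D.θ := by
  rw [germ_sub_sub _ _ hrs hst, norm_neg]
  obtain ⟨h1, h2⟩ := D.mul_le_rpow_θ hrs hst
  have hC := D.C_nonneg
  have n1 := D.a_nonneg hrs
  have n2 := D.a_nonneg hst
  have n4 := D.b_nonneg hrs
  have k1 : ‖(Y.val s - Y.val r - Y.dag r (D.x s - D.x r)) (D.z t - D.z s)‖ ≤
      (‖Y‖ * (D.a r s * D.b r s)) * (D.C * D.a s t) :=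
    (ContinuousLinearMap.le_opNorm _ _).trans
      (mul_le_mul (Y.bd.sharp r s hrs) (D.norm_z_le s t hst) (norm_nonneg _) (by positivity))
  have k2 : ‖ProjTensor.lift (Y.dag s - Y.dag r) (D.zb s t)‖ ≤
      (‖Y‖ * D.b r s) * (D.C * (D.a s t * D.a s t)) :=
    (ProjTensor.norm_lift_apply_le _ _).trans
      (mul_le_mul (Y.bd.dag_sub r s hrs) (D.norm_zb_le s t hst) (norm_nonneg _) (by positivity))
  have hP : 0 ≤ ‖Y‖ * D.C := by positivity
  calc _ ≤ (‖Y‖ * (D.a r s * D.b r s)) * (D.C * D.a s t) +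
        (‖Y‖ * D.b r s) * (D.C * (D.a s t * D.a s t)) := (norm_add_le _ _).trans (add_le_add k1 k2)
    _ = (‖Y‖ * D.C) * (D.a r s * D.b r s * D.a s t) +
        (‖Y‖ * D.C) * (D.b r s * (D.a s t * D.a s t)) := by ring
    _ ≤ (‖Y‖ * D.C) * (D.ω r t ^ D.θ) + (‖Y‖ * D.C) * (D.ω r t ^ D.θ) := by gcongr
    _ = _ := by ring

theorem exists_integral (Y : D.Path (W →L[ℝ] V)) : ∃ J : ι → V, J D.o = 0 ∧ ∀ s t, s ≤ t →
    ‖J t - J s - D.germ Y.val Y.dag s t‖ ≤ sewConst D.θ * (2 * ‖Y‖ * D.C) * D.ω s t ^ D.θ :=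
  D.control.exists_sewing D.one_lt
    (mul_nonneg (mul_nonneg zero_le_two (norm_nonneg _)) D.C_nonneg)
    fun _ _ _ hrs hst => norm_germ_sub_sub_le Y hrs hst

/-- The rough integral. -/
noncomputable def intVal (Y : D.Path (W →L[ℝ] V)) : ι → V := (exists_integral Y).choose

theorem intVal_zero (Y : D.Path (W →L[ℝ] V)) : intVal Y D.o = 0 :=
  (exists_integral Y).choose_spec.1

theorem norm_intVal_sub_le (Y : D.Path (W →L[ℝ] V)) {s t : ι} (h : s ≤ t) :
    ‖intVal Y t - intVal Y s - D.germ Y.val Y.dag s t‖ ≤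
      sewConst D.θ * (2 * ‖Y‖ * D.C) * D.ω s t ^ D.θ :=
  (exists_integral Y).choose_spec.2 s t h

/-- The difference of the two paths has increments of the smaller of the two orders, still above 1;
the control is at most 1, so lowering an exponent costs nothing. -/
theorem eq_of_norm_sub_germ_le {X : Type*} [NormedAddCommGroup X]
    {Ξ : ι → ι → X} {J J' : ι → X} {θ C θ' C' : ℝ} (hθ : 1 < θ)
    (hθ' : 1 < θ') (hJ : ∀ s t, s ≤ t → ‖J t - J s - Ξ s t‖ ≤ C * D.ω s t ^ θ)
    (hJ' : ∀ s t, s ≤ t → ‖J' t - J' s - Ξ s t‖ ≤ C' * D.ω s t ^ θ') (h0 : J D.o = J' D.o) :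
    J = J' := by
  have key := D.control.eq_of_norm_sub_le (A := fun t => J t - J' t) (θ := min θ θ')
    (C := |C| + |C'|) (lt_min hθ hθ') fun s t hst => ?_
  · funext t
    have := key t
    rwa [h0, sub_self, sub_eq_zero] at this
  · have hw := D.control.nonneg s t hst
    have hm : ∀ {c β : ℝ}, min θ θ' ≤ β → c * D.ω s t ^ β ≤ |c| * D.ω s t ^ min θ θ' := by
      intro c β hβ
      refine mul_le_mul (le_abs_self c) ?_ (Real.rpow_nonneg hw _) (abs_nonneg c)
      exact Real.rpow_le_rpow_of_exponent_ge' hw (D.le_one s t hst)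
        (le_min (by linarith) (by linarith)) hβ
    calc ‖J t - J' t - (J s - J' s)‖ =
        ‖(J t - J s - Ξ s t) - (J' t - J' s - Ξ s t)‖ := by congr 1; abel
      _ ≤ |C| * D.ω s t ^ min θ θ' + |C'| * D.ω s t ^ min θ θ' :=
        (norm_sub_le _ _).trans (add_le_add ((hJ s t hst).trans (hm (min_le_left _ _)))
          ((hJ' s t hst).trans (hm (min_le_right _ _))))
      _ = _ := by ring

/-- The constant in the estimate of the rough integral. -/
noncomputable def cI (D : Driver ι U W) : ℝ := (2 * sewConst D.θ + 3) * D.C ^ 2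

theorem cI_nonneg : 0 ≤ D.cI :=
  mul_nonneg (by linarith [sewConst_pos (show 1 < D.θ from D.one_lt)]) (sq_nonneg _)

theorem norm_intVal_le (Y : D.Path (W →L[ℝ] V)) (t : ι) :
    ‖intVal Y t‖ ≤ D.cI * D.η * ‖Y‖ := by
  have hs : 0 < sewConst D.θ := sewConst_pos D.one_lt
  have ht := D.control.bot_le t
  have h := norm_intVal_sub_le Y ht
  rw [intVal_zero, sub_zero, θ, ← D.a_mul_a_mul_b ht] at h
  have hC := D.one_le_C
  have ha := D.a_nonneg ht
  have ha1 := D.a_le_one ht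
  have hb := D.b_nonneg ht
  have hb1 := D.b_le_one ht
  have hη := D.a_le_eta ht
  have k1 : ‖Y.val D.o (D.z t - D.z D.o)‖ ≤ ‖Y‖ * (D.C * D.a D.o t) :=
    (ContinuousLinearMap.le_opNorm _ _).trans
      (mul_le_mul (Y.bd.path _) (D.norm_z_le _ _ ht) (norm_nonneg _) (by positivity))
  have k2 : ‖ProjTensor.lift (Y.dag D.o) (D.zb D.o t)‖ ≤ ‖Y‖ * (D.C * (D.a D.o t * D.a D.o t)) :=
    (ProjTensor.norm_lift_apply_le _ _).trans
      (mul_le_mul (Y.bd.dag _) (D.norm_zb_le _ _ ht) (norm_nonneg _) (by positivity))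
  have haa : D.a D.o t * D.a D.o t ≤ D.a D.o t := mul_le_of_le_one_right ha ha1
  have haab : D.a D.o t * D.a D.o t * D.b D.o t ≤ D.a D.o t :=
    (mul_le_of_le_one_right (by positivity) hb1).trans haa
  have hCC : D.C ≤ D.C ^ 2 := by nlinarith
  calc ‖intVal Y t‖ = ‖(intVal Y t - D.germ Y.val Y.dag D.o t) +
        (Y.val D.o (D.z t - D.z D.o) + ProjTensor.lift (Y.dag D.o) (D.zb D.o t))‖ := by
        rw [germ]; congr 1; abel
    _ ≤ sewConst ((2 + D.τ) * D.al) * (2 * ‖Y‖ * D.C) * (D.a D.o t * D.a D.o t * D.b D.o t) +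
        (‖Y‖ * (D.C * D.a D.o t) + ‖Y‖ * (D.C * (D.a D.o t * D.a D.o t))) :=
        (norm_add_le _ _).trans (add_le_add h ((norm_add_le _ _).trans (add_le_add k1 k2)))
    _ ≤ sewConst D.θ * (2 * ‖Y‖ * D.C) * D.η + (‖Y‖ * (D.C * D.η) + ‖Y‖ * (D.C * D.η)) := by
        refine add_le_add (mul_le_mul_of_nonneg_left (haab.trans hη) (by positivity))
          (add_le_add ?_ ?_)
        · gcongr
        · exact mul_le_mul_of_nonneg_left (mul_le_mul_of_nonneg_left (haa.trans hη)
            (by linarith)) (norm_nonneg _)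
    _ = (2 * sewConst D.θ + 2) * D.C * (‖Y‖ * D.η) := by ring
    _ ≤ (2 * sewConst D.θ + 3) * D.C ^ 2 * (‖Y‖ * D.η) := by
        have := D.η_nonneg
        gcongr
        linarith
    _ = _ := by rw [cI]; ring

/-- The only component without a factor `η` is the supremum of `Y z†`; it is bounded separately by
`m * d`, and `d` will be made small by dilation instead of by shortening the interval. -/
theorem bd_integral (Y : D.Path (W →L[ℝ] V)) {m : ℝ} (hm : ∀ t, ‖Y.val t‖ ≤ m) :
    D.Bd (m * D.d + D.cI * D.η * ‖Y‖) (intVal Y) (fun t => (Y.val t).comp (D.zd t)) := by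
  have hs : 0 < sewConst D.θ := sewConst_pos D.one_lt
  have hC := D.one_le_C
  have hη0 := D.η_nonneg
  have hd0 : 0 ≤ D.d := (norm_nonneg _).trans (D.norm_zd_le D.o)
  have hm0 : 0 ≤ m := (norm_nonneg _).trans (hm D.o)
  have hmd : 0 ≤ m * D.d := mul_nonneg hm0 hd0
  have hcI := D.cI_nonneg
  have hI : 0 ≤ D.cI * D.η * ‖Y‖ := by positivity
  have hCC : D.C ≤ D.C ^ 2 := by nlinarith
  constructor
  · exact fun t => (norm_intVal_le Y t).trans (by linarith)
  · intro t
    exact (ContinuousLinearMap.opNorm_comp_le _ _).trans ((mul_le_mul (hm t) (D.norm_zd_le t)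
      (norm_nonneg _) hm0).trans (by linarith))
  · intro s t h
    have ha := D.a_nonneg h
    have hb := D.b_nonneg h
    have e : (Y.val t).comp (D.zd t) - (Y.val s).comp (D.zd s) =
        (Y.val t - Y.val s).comp (D.zd t) + (Y.val s).comp (D.zd t - D.zd s) := by
      ext u; simp
    have k1 : ‖(Y.val t - Y.val s).comp (D.zd t)‖ ≤ ((D.C + 1) * ‖Y‖ * D.a s t) * D.C :=
      (ContinuousLinearMap.opNorm_comp_le _ _).trans (mul_le_mul (Y.norm_val_sub_le h)
        ((D.norm_zd_le t).trans D.d_le_C) (norm_nonneg _) (by positivity))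
    have k2 : ‖(Y.val s).comp (D.zd t - D.zd s)‖ ≤ ‖Y‖ * (D.C * D.a s t) :=
      (ContinuousLinearMap.opNorm_comp_le _ _).trans (mul_le_mul (Y.bd.path s)
        (D.norm_zd_sub_le s t h) (norm_nonneg _) (norm_nonneg _))
    rw [e]
    calc _ ≤ ((D.C + 1) * ‖Y‖ * D.a s t) * D.C + ‖Y‖ * (D.C * D.a s t) :=
          (norm_add_le _ _).trans (add_le_add k1 k2)
      _ = (D.C ^ 2 + 2 * D.C) * (‖Y‖ * D.a s t) := by ring
      _ ≤ ((2 * sewConst D.θ + 3) * D.C ^ 2) * (‖Y‖ * (D.η * D.b s t)) := by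
          refine mul_le_mul ?_ (mul_le_mul_of_nonneg_left (D.a_le_eta_mul_b h) (norm_nonneg _))
            (by positivity) (by positivity)
          nlinarith [mul_nonneg hs.le (sq_nonneg D.C)]
      _ = D.cI * D.η * ‖Y‖ * D.b s t := by rw [cI]; ring
      _ ≤ _ := mul_le_mul_of_nonneg_right (by linarith) hb
  · intro s t h
    have ha := D.a_nonneg h
    have hb := D.b_nonneg h
    have h0 := norm_intVal_sub_le Y h
    rw [θ, ← D.a_mul_a_mul_b h] at h0
    have e : intVal Y t - intVal Y s - ((Y.val s).comp (D.zd s)) (D.x t - D.x s) =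
        (intVal Y t - intVal Y s - D.germ Y.val Y.dag s t) +
        (Y.val s (D.z t - D.z s - D.zd s (D.x t - D.x s)) +
          ProjTensor.lift (Y.dag s) (D.zb s t)) := by
      simp [germ]
      abel
    have k1 : ‖Y.val s (D.z t - D.z s - D.zd s (D.x t - D.x s))‖ ≤
        ‖Y‖ * (D.C * (D.a s t * D.a s t)) :=
      (ContinuousLinearMap.le_opNorm _ _).trans (mul_le_mul (Y.bd.path s)
        (D.norm_z_sharp_le s t h) (norm_nonneg _) (norm_nonneg _))
    have k2 : ‖ProjTensor.lift (Y.dag s) (D.zb s t)‖ ≤ ‖Y‖ * (D.C * (D.a s t * D.a s t)) :=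
      (ProjTensor.norm_lift_apply_le _ _).trans
        (mul_le_mul (Y.bd.dag _) (D.norm_zb_le _ _ h) (norm_nonneg _) (norm_nonneg _))
    have haa : D.a s t * D.a s t ≤ D.η * (D.a s t * D.b s t) := by
      calc _ ≤ D.a s t * (D.η * D.b s t) := mul_le_mul_of_nonneg_left (D.a_le_eta_mul_b h) ha
        _ = _ := by ring
    have haab : D.a s t * D.a s t * D.b s t ≤ D.η * (D.a s t * D.b s t) :=
      (mul_le_of_le_one_right (by positivity) (D.b_le_one h)).trans haa
    rw [e]
    calc _ ≤ sewConst ((2 + D.τ) * D.al) * (2 * ‖Y‖ * D.C) * (D.a s t * D.a s t * D.b s t) +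
          (‖Y‖ * (D.C * (D.a s t * D.a s t)) + ‖Y‖ * (D.C * (D.a s t * D.a s t))) :=
          (norm_add_le _ _).trans (add_le_add h0 ((norm_add_le _ _).trans (add_le_add k1 k2)))
      _ ≤ sewConst D.θ * (2 * ‖Y‖ * D.C) * (D.η * (D.a s t * D.b s t)) +
          (‖Y‖ * (D.C * (D.η * (D.a s t * D.b s t))) +
            ‖Y‖ * (D.C * (D.η * (D.a s t * D.b s t)))) := by
          refine add_le_add (mul_le_mul_of_nonneg_left haab (by positivity)) ?_
          gcongr
      _ = (2 * sewConst D.θ + 2) * D.C * (‖Y‖ * D.η * (D.a s t * D.b s t)) := by ring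
      _ ≤ (2 * sewConst D.θ + 3) * D.C ^ 2 * (‖Y‖ * D.η * (D.a s t * D.b s t)) := by
          gcongr
          linarith
      _ = D.cI * D.η * ‖Y‖ * (D.a s t * D.b s t) := by rw [cI]; ring
      _ ≤ _ := mul_le_mul_of_nonneg_right (by linarith) (by positivity)

/-- The integral is merely chosen, so its linearity comes from uniqueness: the sum of the two
integrals has the germ of the sum. -/
theorem intVal_add (Y Z : D.Path (W →L[ℝ] V)) : intVal (Y + Z) = intVal Y + intVal Z := by
  refine eq_of_norm_sub_germ_le (D := D) (Ξ := D.germ (Y + Z).val (Y + Z).dag)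
    (C' := sewConst D.θ * (2 * ‖Y‖ * D.C) + sewConst D.θ * (2 * ‖Z‖ * D.C)) D.one_lt D.one_lt
    (fun s t h => norm_intVal_sub_le _ h) (fun s t h => ?_) (by simp [intVal_zero])
  have e : (intVal Y + intVal Z) t - (intVal Y + intVal Z) s -
      D.germ (Y + Z).val (Y + Z).dag s t = (intVal Y t - intVal Y s - D.germ Y.val Y.dag s t) +
      (intVal Z t - intVal Z s - D.germ Z.val Z.dag s t) := by
    simp [germ, ProjTensor.lift_add]; abel
  rw [e, add_mul]
  exact (norm_add_le _ _).trans (add_le_add (norm_intVal_sub_le _ h) (norm_intVal_sub_le _ h))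

theorem intVal_smul (r : ℝ) (Y : D.Path (W →L[ℝ] V)) : intVal (r • Y) = r • intVal Y := by
  refine eq_of_norm_sub_germ_le (D := D) (Ξ := D.germ (r • Y).val (r • Y).dag)
    (C' := ‖r‖ * (sewConst D.θ * (2 * ‖Y‖ * D.C))) D.one_lt D.one_lt
    (fun s t h => norm_intVal_sub_le _ h) (fun s t h => ?_) (by simp [intVal_zero])
  have e : (r • intVal Y) t - (r • intVal Y) s - D.germ (r • Y).val (r • Y).dag s t =
      r • (intVal Y t - intVal Y s - D.germ Y.val Y.dag s t) := by
    simp [germ, ProjTensor.lift_smul, smul_sub]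
  rw [e, norm_smul, mul_assoc]
  exact mul_le_mul_of_nonneg_left (norm_intVal_sub_le _ h) (norm_nonneg _)

variable (D V)

/-- The rough integral as an operator on controlled paths. -/
noncomputable def integral : D.Path (W →L[ℝ] V) →L[ℝ] D.Path V :=
  LinearMap.mkContinuous
    ⟨⟨fun Y => Path.mk (intVal Y) (fun t => (Y.val t).comp (D.zd t))
        ⟨_, bd_integral Y fun t => Y.bd.path t⟩,
      fun Y Z => by ext <;> simp [intVal_add]⟩, fun r Y => by ext <;> simp [intVal_smul]⟩
    (D.d + D.cI * D.η) fun Y => by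
      refine Path.norm_le ((bd_integral Y fun t => Y.bd.path t).mono (le_of_eq ?_))
      ring

variable {D V}

@[simp] theorem val_integral (Y : D.Path (W →L[ℝ] V)) : (integral D V Y).val = intVal Y := rfl

@[simp] theorem dag_integral (Y : D.Path (W →L[ℝ] V)) :
    (integral D V Y).dag = fun t => (Y.val t).comp (D.zd t) := rfl

theorem norm_integral_le (Y : D.Path (W →L[ℝ] V)) {m : ℝ} (hm : ∀ t, ‖Y.val t‖ ≤ m) :
    ‖integral D V Y‖ ≤ m * D.d + D.cI * D.η * ‖Y‖ := Path.norm_le (bd_integral Y hm)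

end Driver

/-! ### The Picard fixed point and its dependence on the initial value -/

namespace Driver

section

variable {ι U W : Type*} [LinearOrder ι] [NormedAddCommGroup U] [NormedSpace ℝ U]
  [NormedAddCommGroup W] [NormedSpace ℝ W] {D : Driver ι U W}

section

variable {V : Type*} [NormedAddCommGroup V] [NormedSpace ℝ V]

theorem Tame.mono {R R' : ℝ} {y : ι → V} {y' : ι → U →L[ℝ] V} (h : D.Tame R y y') (hR : R ≤ R') :
    D.Tame R' y y' where
  dag t := (h.dag t).trans hR
  dag_sub s t hst := (h.dag_sub s t hst).trans (mul_le_mul_of_nonneg_right hR (D.b_nonneg hst))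
  sharp s t hst := (h.sharp s t hst).trans (mul_le_mul_of_nonneg_right hR
    (mul_nonneg (D.a_nonneg hst) (D.b_nonneg hst)))

theorem Tame.add {R R' : ℝ} {y v : ι → V} {y' v' : ι → U →L[ℝ] V} (h : D.Tame R y y')
    (h' : D.Tame R' v v') : D.Tame (R + R') (y + v) (y' + v') where
  dag t := (norm_add_le _ _).trans (add_le_add (h.dag t) (h'.dag t))
  dag_sub s t hst := by
    simp only [Pi.add_apply, add_sub_add_comm, add_mul]
    exact (norm_add_le _ _).trans (add_le_add (h.dag_sub s t hst) (h'.dag_sub s t hst))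
  sharp s t hst := by
    simp only [Pi.add_apply, add_sub_add_comm, add_mul, add_apply]
    exact (norm_add_le _ _).trans (add_le_add (h.sharp s t hst) (h'.sharp s t hst))

theorem Tame.smul {R : ℝ} {y : ι → V} {y' : ι → U →L[ℝ] V} (r : ℝ) (h : D.Tame R y y') :
    D.Tame (‖r‖ * R) (r • y) (r • y') where
  dag t := by
    rw [Pi.smul_apply, norm_smul]; exact mul_le_mul_of_nonneg_left (h.dag t) (norm_nonneg r)
  dag_sub s t hst := by
    simp only [Pi.smul_apply, ← smul_sub, norm_smul, mul_assoc]
    exact mul_le_mul_of_nonneg_left (h.dag_sub s t hst) (norm_nonneg r)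
  sharp s t hst := by
    simp only [Pi.smul_apply, smul_apply, ← smul_sub, norm_smul, mul_assoc]
    exact mul_le_mul_of_nonneg_left (h.sharp s t hst) (norm_nonneg r)

variable (D V)

/-- The controlled paths all of whose norm components but the one of the values are at most `R`. -/
def tameSet (R : ℝ) : Set (D.Path V) := {y | D.Tame R y.val y.dag}

variable {D V}

theorem convex_tameSet (R : ℝ) : Convex ℝ (D.tameSet V R) := by
  intro y hy v hv p q hp hq hpq
  have h := (hy.smul p).add (hv.smul q)
  rw [Real.norm_of_nonneg hp, Real.norm_of_nonneg hq, ← add_mul, hpq, one_mul] at h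
  exact h

theorem tameSet_add {R ρ : ℝ} {y v : D.Path V} (hy : y ∈ D.tameSet V R) (h : ‖v - y‖ ≤ ρ) :
    v ∈ D.tameSet V (R + ρ) := by
  have := Tame.add hy ((v - y).bd.mono h).tame
  rwa [← Path.val_add, ← Path.dag_add, add_sub_cancel] at this

theorem isClosed_tameSet (R : ℝ) : IsClosed (D.tameSet V R) := by
  refine isClosed_of_closure_subset fun y hy => ?_
  have key : ∀ ε > 0, D.Tame (R + ε) y.val y.dag := by
    intro ε hε
    obtain ⟨v, hv, hd⟩ := Metric.mem_closure_iff.1 hy ε hε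
    rw [dist_eq_norm] at hd
    exact tameSet_add hv hd.le
  have lim : ∀ m w : ℝ, (∀ ε > 0, m ≤ (R + ε) * w) → m ≤ R * w := by
    intro m w h
    have : Tendsto (fun ε : ℝ => (R + ε) * w) (𝓝[>] 0) (𝓝 ((R + 0) * w)) :=
      (((continuous_const.add continuous_id).mul continuous_const).tendsto 0).mono_left
        nhdsWithin_le_nhds
    rw [add_zero] at this
    exact ge_of_tendsto this (eventually_nhdsWithin_of_forall h)
  refine ⟨fun t => ?_, fun s t hst => ?_, fun s t hst => ?_⟩
  · simpa using lim _ 1 fun ε hε => by simpa using (key ε hε).dag t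
  · exact lim _ _ fun ε hε => (key ε hε).dag_sub s t hst
  · exact lim _ _ fun ε hε => (key ε hε).sharp s t hst

/-- The bound of `f(y)` for a tame controlled path `y`. -/
noncomputable def cB (D : Driver ι U W) (K : ℝ) : ℝ := 2 * K * ((D.C + 1) * 2) ^ 2

/-- The smallness of the driver needed for the fixed point argument with vector fields of size
`K`. -/
structure Small (D : Driver ι U W) (K : ℝ) : Prop where
  d_le : K * D.d ≤ 1 / 4
  η_le : D.cI * D.η * (4 * (D.C + 1) ^ 2 * D.cB K) ≤ 1 / 4

variable [CompleteSpace V] {γ K : ℝ} {f : V → W →L[ℝ] V}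

variable (D) in
/-- The map `y ↦ ∫ f(y) dz`. -/
noncomputable def picard (f : V → W →L[ℝ] V) (y : D.Path V) : D.Path V :=
  integral D V (nem f y)

/-- The derivative of `picard`. -/
noncomputable def picardDeriv (f : V → W →L[ℝ] V) (y : D.Path V) : D.Path V →L[ℝ] D.Path V :=
  (integral D V).comp (Path.mul D V (W →L[ℝ] V) (nem (fderiv ℝ f) y))

section

variable (hD : D.Small K) (hf : HolderOne γ K f) (hγ : D.τ ≤ γ) (hγ' : γ ≤ 1)

include hD hf hγ hγ'

/-- Both parts of the integral estimate are at most 1/4: the sup part by `d_le`, the rest by `η_le`.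
-/
theorem picard_mem {y : D.Path V} (hy : y ∈ D.tameSet V 2) : ‖D.picard f y‖ ≤ 1 / 2 := by
  have h := norm_integral_le (nem f y) (m := K)
    fun t => by rw [val_nem hf hγ hγ']; exact hf.norm_le _
  refine h.trans ?_
  have hn := norm_nem_le hf hγ hγ' (by norm_num) y hy
  have h1 := hD.η_le
  have hC := D.one_le_C
  have hB : 0 ≤ D.cB K := by rw [cB]; have := hf.K_nonneg; positivity
  have hI : 0 ≤ D.cI * D.η := mul_nonneg D.cI_nonneg D.η_nonneg
  have h2 : D.cI * D.η * ‖nem f y‖ ≤ D.cI * D.η * (4 * (D.C + 1) ^ 2 * D.cB K) := by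
    refine mul_le_mul_of_nonneg_left (hn.trans ?_) hI
    exact le_mul_of_one_le_left hB (by nlinarith)
  linarith [hD.d_le]

variable (hf' : HolderOne γ K (fderiv ℝ f))
include hf'

-- The values of the integral see only the `η` part of the estimate, hence 1/4 instead of the 1/2 of
-- the full norm. This sharper constant is what makes the derivative of the flow invertible.
omit hf in
theorem norm_picardDeriv_val_le {y : D.Path V} (hy : y ∈ D.tameSet V 2) (h : D.Path V) (t : ι) :
    ‖(picardDeriv f y h).val t‖ ≤ 1 / 4 * ‖h‖ := by
  refine (norm_intVal_le _ t).trans ?_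
  have hn := norm_nem_le hf' hγ hγ' (by norm_num) y hy
  have hm := Path.norm_mul_le (nem (fderiv ℝ f) y) h
  have hI : 0 ≤ D.cI * D.η := mul_nonneg D.cI_nonneg D.η_nonneg
  calc _ ≤ D.cI * D.η * (4 * (D.C + 1) ^ 2 * D.cB K * ‖h‖) := by
        refine mul_le_mul_of_nonneg_left (hm.trans ?_) hI
        exact mul_le_mul_of_nonneg_right (mul_le_mul_of_nonneg_left hn (by positivity))
          (norm_nonneg _)
    _ = D.cI * D.η * (4 * (D.C + 1) ^ 2 * D.cB K) * ‖h‖ := by ring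
    _ ≤ _ := mul_le_mul_of_nonneg_right hD.η_le (norm_nonneg _)

theorem norm_picardDeriv_le {y : D.Path V} (hy : y ∈ D.tameSet V 2) :
    ‖picardDeriv f y‖ ≤ 1 / 2 := by
  refine ContinuousLinearMap.opNorm_le_bound _ (by norm_num) fun h => ?_
  have h1 := norm_integral_le (Path.mul D V (W →L[ℝ] V) (nem (fderiv ℝ f) y) h) (m := K * ‖h‖)
    fun t => by
      rw [Path.val_mul, val_nem hf' hγ hγ']
      exact (ContinuousLinearMap.le_opNorm _ _).trans
        (mul_le_mul (hf'.norm_le _) (h.bd.path t) (norm_nonneg _) hf.K_nonneg)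
  refine h1.trans ?_
  have hn := norm_nem_le hf' hγ hγ' (by norm_num) y hy
  have hm := Path.norm_mul_le (nem (fderiv ℝ f) y) h
  have hI : 0 ≤ D.cI * D.η := mul_nonneg D.cI_nonneg D.η_nonneg
  have h2 : D.cI * D.η * ‖Path.mul D V (W →L[ℝ] V) (nem (fderiv ℝ f) y) h‖ ≤ 1 / 4 * ‖h‖ := by
    calc _ ≤ D.cI * D.η * (4 * (D.C + 1) ^ 2 * D.cB K * ‖h‖) := by
          refine mul_le_mul_of_nonneg_left (hm.trans ?_) hI
          exact mul_le_mul_of_nonneg_right (mul_le_mul_of_nonneg_left hn (by positivity))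
            (norm_nonneg _)
      _ = D.cI * D.η * (4 * (D.C + 1) ^ 2 * D.cB K) * ‖h‖ := by ring
      _ ≤ _ := mul_le_mul_of_nonneg_right hD.η_le (norm_nonneg _)
  have h3 : K * ‖h‖ * D.d ≤ 1 / 4 * ‖h‖ := by
    have := mul_le_mul_of_nonneg_right hD.d_le (norm_nonneg h)
    linarith
  linarith

variable (hd : ∀ y : D.Path V, HasFDerivAt (D.picard f) (picardDeriv f y) y)
include hd

theorem norm_picard_sub_le {y v : D.Path V} (hy : y ∈ D.tameSet V 2) (hv : v ∈ D.tameSet V 2) :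
    ‖D.picard f v - D.picard f y‖ ≤ 1 / 2 * ‖v - y‖ :=
  (convex_tameSet 2).norm_image_sub_le_of_norm_hasFDerivWithin_le (𝕜 := ℝ)
    (fun w _ => (hd w).hasFDerivWithinAt)
    (fun _ hw => norm_picardDeriv_le hD hf hγ hγ' hf' hw) hy hv

omit hf in
theorem norm_picard_val_sub_le {y v : D.Path V} (hy : y ∈ D.tameSet V 2)
    (hv : v ∈ D.tameSet V 2) (t : ι) :
    ‖(D.picard f v).val t - (D.picard f y).val t‖ ≤ 1 / 4 * ‖v - y‖ :=
  (convex_tameSet 2).norm_image_sub_le_of_norm_hasFDerivWithin_le (𝕜 := ℝ)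
    (f := fun w => (D.picard f w).val t)
    (fun w _ => ((Path.ev D V t).hasFDerivAt.comp w (hd w)).hasFDerivWithinAt)
    (fun _ hw => ContinuousLinearMap.opNorm_le_bound _ (by norm_num)
      fun h => norm_picardDeriv_val_le hD hγ hγ' hf' hw h t) hy hv

theorem picard_fixed_unique {a : V} {y v : D.Path V} (hy : y ∈ D.tameSet V 2)
    (hv : v ∈ D.tameSet V 2) (ey : y = Path.const D V a + D.picard f y)
    (ev : v = Path.const D V a + D.picard f v) : v = y := by
  have h := norm_picard_sub_le hD hf hγ hγ' hf' hd hy hv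
  have e : v - y = D.picard f v - D.picard f y := by
    nth_rw 1 [ev, ey]
    abel
  rw [← e] at h
  rw [← sub_eq_zero, ← norm_le_zero_iff]
  linarith [norm_nonneg (v - y)]

omit hf' hd in
theorem const_add_picard_mem (a : V) {y : D.Path V} (hy : y ∈ D.tameSet V 2) :
    Path.const D V a + D.picard f y ∈ D.tameSet V 1 := by
  have h1 := ((D.picard f y).bd.mono (picard_mem hD hf hγ hγ' hy)).tame
  have h0 : D.Tame 0 (Path.const D V a).val (Path.const D V a).dag := by constructor <;> simp
  exact (h0.add h1).mono (by norm_num)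

/-- Banach's theorem on `tameSet 2`. The image lies in `tameSet 1`, and the margin of one unit is
later used to recognise nearby fixed points. -/
theorem exists_picard_fixed (a : V) :
    ∃ y ∈ D.tameSet V 1, y = Path.const D V a + D.picard f y := by
  let T : D.Path V → D.Path V := fun y => Path.const D V a + D.picard f y
  have hmaps : MapsTo T (D.tameSet V 2) (D.tameSet V 2) := fun y hy =>
    Tame.mono (const_add_picard_mem hD hf hγ hγ' a hy) one_le_two
  have hcon : ContractingWith (1 / 2) (hmaps.restrict T _ _) := by
    refine ⟨by
      rw [← NNReal.coe_lt_coe]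
      norm_num, LipschitzWith.of_dist_le_mul fun y v => ?_⟩
    rw [Subtype.dist_eq, Subtype.dist_eq, dist_eq_norm, dist_eq_norm]
    have := norm_picard_sub_le hD hf hγ hγ' hf' hd v.2 y.2
    change ‖T y - T v‖ ≤ _
    simpa [T] using this
  have h0 : (0 : D.Path V) ∈ D.tameSet V 2 := by
    refine ⟨?_, ?_, ?_⟩ <;> intros <;> simp <;> have := D.a_nonneg ‹_› <;>
      have := D.b_nonneg ‹_› <;> positivity
  obtain ⟨y, hy, hfix, -⟩ := hcon.exists_fixedPoint' (isClosed_tameSet 2).isComplete hmaps h0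
    (edist_ne_top _ _)
  refine ⟨y, ?_, hfix.symm⟩
  rw [← hfix.eq]
  exact const_add_picard_mem hD hf hγ hγ' a hy

theorem norm_picard_fixed_sub_le {Y : V → D.Path V} (hY : ∀ a, Y a ∈ D.tameSet V 2)
    (hfix : ∀ a, Y a = Path.const D V a + D.picard f (Y a)) (a b : V) :
    ‖Y a - Y b‖ ≤ 2 * ‖a - b‖ := by
  have h := norm_picard_sub_le hD hf hγ hγ' hf' hd (hY b) (hY a)
  have e : Y a - Y b = Path.const D V (a - b) + (D.picard f (Y a) - D.picard f (Y b)) := by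
    rw [map_sub]
    nth_rw 1 [hfix a, hfix b]
    abel
  have h2 : ‖Y a - Y b‖ ≤ ‖a - b‖ + 1 / 2 * ‖Y a - Y b‖ := by
    nth_rw 1 [e]
    exact (norm_add_le _ _).trans (add_le_add (Path.norm_const_le _) h)
  linarith

/-- The identity minus the flow is Lipschitz with constant `1/4 * 2`, where 2 is the Lipschitz
constant of the fixed point in its initial value; a Neumann series then inverts the derivative. -/
theorem isUnit_of_hasFDerivAt_flow {Y : V → D.Path V} (hY : ∀ a, Y a ∈ D.tameSet V 2)
    (hfix : ∀ a, Y a = Path.const D V a + D.picard f (Y a)) (t : ι) {a : V} {A : V →L[ℝ] V}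
    (hA : HasFDerivAt (fun a => (Y a).val t) A a) : IsUnit A := by
  have h1 : HasFDerivAt (fun a => a - (Y a).val t) (1 - A) a := (hasFDerivAt_id a).sub hA
  have h2 : ‖1 - A‖ ≤ 1 / 2 := by
    refine h1.le_of_lip' (by norm_num) (Eventually.of_forall fun b => ?_)
    have e : ∀ c, c - (Y c).val t = -(D.picard f (Y c)).val t := fun c => by
      nth_rw 1 [hfix c]
      simp
    rw [e, e, ← norm_neg]
    have h3 := norm_picard_val_sub_le hD hγ hγ' hf' hd (hY a) (hY b) t
    have h4 := norm_picard_fixed_sub_le hD hf hγ hγ' hf' hd hY hfix b a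
    have e2 : -(-(D.picard f (Y b)).val t - -(D.picard f (Y a)).val t) =
      (D.picard f (Y b)).val t - (D.picard f (Y a)).val t := by abel
    rw [e2]
    linarith
  have := isUnit_one_sub_of_norm_lt_one (x := 1 - A) (by linarith)
  rwa [sub_sub_cancel] at this

end

end

end

universe u₁ u₂ u₃ u₄

/-- Near `a`, the fixed point is the local inverse of `y ↦ y - ∫ f(y) dz` applied to constant paths.
That map has invertible derivative, because the derivative of the Picard map has norm at most 1/2.
-/
theorem holderDiffAt_picard_fixed {ι : Type u₁} {U : Type u₂} {V : Type u₃} {W : Type u₄}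
    [LinearOrder ι] [NormedAddCommGroup U] [NormedSpace ℝ U]
    [NormedAddCommGroup W] [NormedSpace ℝ W] {D : Driver ι U W}
    [NormedAddCommGroup V] [NormedSpace ℝ V] [CompleteSpace V] {γ K α : ℝ} {f : V → W →L[ℝ] V}
    (hD : D.Small K) (hf : HolderOne γ K f) (hγ : D.τ ≤ γ) (hγ' : γ ≤ 1)
    (hf' : HolderOne γ K (fderiv ℝ f))
    (hd : ∀ y : D.Path V, HasFDerivAt (D.picard f) (picardDeriv f y) y) (hα : 0 < α) (hα' : α ≤ 1)
    {k : ℕ} (hk : 1 ≤ k)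
    (hn : ∀ y : D.Path V, HolderDiffAt k α (D.picard f) y)
    {Y : V → D.Path V} (hY : ∀ a, Y a ∈ D.tameSet V 1)
    (hfix : ∀ a, Y a = Path.const D V a + D.picard f (Y a)) (a : V) :
    HolderDiffAt k α Y a := by
  let Ψ : D.Path V → D.Path V := fun y => y - D.picard f y
  have hΨ : HolderDiffAt k α Ψ (Y a) := by
    have h1 : HolderDiffAt k α (fun y : D.Path V => y) (Y a) :=
      HolderDiffAt.of_contDiffAt hα hα' contDiffAt_id
    have h2 := h1.add ((hn (Y a)).clm_comp (-ContinuousLinearMap.id ℝ (D.Path V)))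
    refine h2.congr (Eventually.of_forall fun y => ?_)
    simp [Ψ, sub_eq_add_neg]
  have hY2 : ∀ a, Y a ∈ D.tameSet V 2 := fun a => (hY a).mono one_le_two
  have hM : ‖picardDeriv f (Y a)‖ < 1 :=
    (norm_picardDeriv_le hD hf hγ hγ' hf' (hY2 a)).trans_lt (by norm_num)
  let e' : D.Path V ≃L[ℝ] D.Path V :=
    ContinuousLinearEquiv.unitsEquiv ℝ _ (Units.oneSub (picardDeriv f (Y a)) hM)
  have he' : HasFDerivAt Ψ (e' : D.Path V →L[ℝ] D.Path V) (Y a) :=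
    (hasFDerivAt_id (Y a)).sub (hd (Y a))
  have hk0 : (k : WithTop ℕ∞) ≠ 0 := by
    have : k ≠ 0 := by omega
    exact_mod_cast this
  let e := hΨ.1.toOpenPartialHomeomorph Ψ he' hk0
  have hea : Y a ∈ e.source := hΨ.1.mem_toOpenPartialHomeomorph_source he' hk0
  have hcoe : ∀ y, e y = y - D.picard f y := fun _ => rfl
  have hca : ∀ b, Path.const D V b = Y b - D.picard f (Y b) := fun b => by
    nth_rw 1 [hfix b]
    abel
  have heY : e (Y a) = Path.const D V a := by rw [hcoe, hca]
  have hs : HolderDiffAt k α e.symm (Path.const D V a) := by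
    rw [← heY]
    exact HolderDiffAt.symm hα hα' hk e hea hΨ he'
  have hs2 := HolderDiffAt.comp_clm.{max u₁ u₂ u₃, u₃} hα hα' k (Path.const D V) hs
  refine hs2.congr ?_
  have hcont : ContinuousAt (fun b => e.symm (Path.const D V b)) a := hs2.1.continuousAt
  have hsa : e.symm (Path.const D V a) = Y a := by rw [← heY, e.left_inv hea]
  have hball : ∀ᶠ b in 𝓝 a, e.symm (Path.const D V b) ∈ Metric.ball (Y a) 1 := by
    have := hcont.eventually (Metric.ball_mem_nhds _ one_pos)
    simp only [hsa] at this
    exact this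
  have htar : ∀ᶠ b in 𝓝 a, Path.const D V b ∈ e.target :=
    (Path.const D V).continuous.continuousAt.eventually
      (e.open_target.mem_nhds (heY ▸ e.map_source hea))
  filter_upwards [hball, htar] with b hb hb'
  -- A point within distance 1 of `tameSet 1` lies in `tameSet 2`, where fixed points are unique;
  -- this identifies the local inverse with `Y b`.
  have hmem : e.symm (Path.const D V b) ∈ D.tameSet V 2 := by
    have := tameSet_add (hY a) (mem_ball_iff_norm.1 hb).le
    rwa [one_add_one_eq_two] at this
  refine picard_fixed_unique hD hf hγ hγ' hf' hd hmem (hY2 b) ?_ (hfix b)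
  have := e.right_inv hb'
  rw [hcoe] at this
  exact sub_eq_iff_eq_add.1 this

end Driver

/-! ### Controls on intervals -/

namespace IsControl

variable {T : ℝ} {ω : ℝ → ℝ → ℝ}

theorem mono (hω : IsControl T ω) {r s t v : ℝ} (h₀ : 0 ≤ r) (h₁ : r ≤ s) (h₂ : s ≤ t)
    (h₃ : t ≤ v) (h₄ : v ≤ T) : ω s t ≤ ω r v := by
  linarith [hω.superadd r s v h₀ h₁ (h₂.trans h₃) h₄,
    hω.superadd s t v (h₀.trans h₁) h₂ h₃ h₄, hω.nonneg r s h₀ h₁ (h₂.trans (h₃.trans h₄)),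
    hω.nonneg t v (h₀.trans (h₁.trans h₂)) h₃ h₄]

theorem exists_modulus (hω : IsControl T ω) {ε : ℝ} (hε : 0 < ε) :
    ∃ δ > 0, ∀ s t, 0 ≤ s → s ≤ t → t ≤ T → t - s ≤ δ → ω s t ≤ ε := by
  have h1 : ∀ u : Icc 0 T, ∃ r > 0, ∀ s ∈ Metric.ball (u : ℝ) r, ∀ t ∈ Metric.ball (u : ℝ) r,
      0 ≤ s → s ≤ t → t ≤ T → ω s t < ε := by
    intro u
    have h := (hω.tendsto_diag u u.2).eventually (gt_mem_nhds hε)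
    rw [eventually_nhdsWithin_iff] at h
    obtain ⟨r, hr, h⟩ := Metric.eventually_nhds_iff_ball.1 h
    refine ⟨r, hr, fun s hs t ht h0 hst hT => h (s, t) ?_ ⟨h0, hst, hT⟩⟩
    rw [← ball_prod_same]
    exact ⟨hs, ht⟩
  choose r hr h using h1
  -- Continuity at the diagonal is only pointwise; a Lebesgue number of the cover by the
  -- corresponding balls makes it uniform.
  obtain ⟨δ, hδ, hc⟩ := lebesgue_number_lemma_of_metric (isCompact_Icc (a := (0 : ℝ)) (b := T))
    (c := fun u : Icc 0 T => Metric.ball (u : ℝ) (r u)) (fun _ => Metric.isOpen_ball)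
    (fun u hu => mem_iUnion.2 ⟨⟨u, hu⟩, Metric.mem_ball_self (hr _)⟩)
  refine ⟨δ / 2, half_pos hδ, fun s t h0 hst hT hd => ?_⟩
  obtain ⟨u, hu⟩ := hc s ⟨h0, hst.trans hT⟩
  refine (h u s (hu (Metric.mem_ball_self hδ)) t (hu ?_) h0 hst hT).le
  rw [Metric.mem_ball, Real.dist_eq, abs_of_nonneg (by linarith)]
  linarith

theorem chainControl (hω : IsControl T ω) {a b : ℝ} (h₀ : 0 ≤ a) (h : a ≤ b) (hT : b ≤ T) :
    ChainControl (⟨a, left_mem_Icc.2 h⟩ : Icc a b) (fun s t => ω s t) where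
  bot_le s := s.2.1
  nonneg s t hst := hω.nonneg s t (h₀.trans s.2.1) hst (t.2.2.trans hT)
  superadd r s t hrs hst := hω.superadd r s t (h₀.trans r.2.1) hrs hst (t.2.2.trans hT)
  fine := by
    intro ε hε
    obtain ⟨δ, hδ, hm⟩ := hω.exists_modulus hε
    obtain ⟨N, hN⟩ := exists_nat_ge ((b - a) / δ)
    -- The chain of step `δ`, stopped at `b`; the stopping does not lengthen any step.
    refine ⟨fun i => projIcc a b h (a + i * δ), N, ?_, ?_, fun s => ?_, fun i => ?_⟩
    · intro i j hij
      refine monotone_projIcc h ?_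
      have : (i : ℝ) ≤ j := by exact_mod_cast hij
      nlinarith
    · simp
    · change s ≤ projIcc a b h (a + N * δ)
      rw [projIcc_of_right_le h]
      · exact s.2.2
      · rw [div_le_iff₀ hδ] at hN
        linarith
    · have hle : projIcc a b h (a + i * δ) ≤ projIcc a b h (a + (i + 1 : ℕ) * δ) :=
        monotone_projIcc h (by push_cast; nlinarith)
      refine hm _ _ (h₀.trans (projIcc a b h _).2.1) hle ((projIcc a b h _).2.2.trans hT) ?_
      rw [coe_projIcc, coe_projIcc]
      push_cast
      have e1 : min b (a + (i + 1) * δ) ≤ min b (a + i * δ) + δ := by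
        rw [← min_add_add_right]
        exact min_le_min (by linarith) (by linarith)
      have e2 : max a (min b (a + (i + 1) * δ)) ≤ max a (min b (a + i * δ)) + δ := by
        rw [← max_add_add_right]
        exact max_le_max (by linarith) e1
      linarith

theorem rpow_le (hω : IsControl T ω) {θ β : ℝ} (hθ : 0 ≤ θ) (h : θ ≤ β) {s t : ℝ} (h0 : 0 ≤ s)
    (hst : s ≤ t) (hT : t ≤ T) : ω s t ^ β ≤ ω 0 T ^ (β - θ) * ω s t ^ θ := by
  have hw := hω.nonneg s t h0 hst hT
  calc ω s t ^ β = ω s t ^ (β - θ) * ω s t ^ θ := by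
        rw [← Real.rpow_add_of_nonneg hw (by linarith) hθ, sub_add_cancel]
    _ ≤ _ := mul_le_mul_of_nonneg_right (Real.rpow_le_rpow hw (hω.mono le_rfl h0 hst hT le_rfl)
        (by linarith)) (Real.rpow_nonneg hw _)

theorem rpow_two_div (hω : IsControl T ω) {p s t : ℝ} (hp : 2 ≤ p) (h0 : 0 ≤ s)
    (hst : s ≤ t) (hT : t ≤ T) : ω s t ^ (1 / (p / 2)) = ω s t ^ (1 / p) * ω s t ^ (1 / p) := by
  have hp1 : 0 ≤ 1 / p := by positivity
  rw [← Real.rpow_add_of_nonneg (hω.nonneg s t h0 hst hT) hp1 hp1]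
  congr 1
  field_simp
  norm_num

theorem rpow_three_div (hω : IsControl T ω) {p s t : ℝ} (hp : 2 ≤ p) (h0 : 0 ≤ s)
    (hst : s ≤ t) (hT : t ≤ T) :
    ω s t ^ (3 / p) = ω s t ^ (1 / p) * ω s t ^ (1 / p) * ω s t ^ (1 / p) := by
  have hp1 : 0 ≤ 1 / p := by positivity
  have hw := hω.nonneg s t h0 hst hT
  rw [← Real.rpow_add_of_nonneg hw hp1 hp1, ← Real.rpow_add_of_nonneg hw (by linarith) hp1]
  congr 1
  ring

end IsControl

theorem BoundedByControl.exists_one_le {E : Type*} [NormedAddCommGroup E] {T : ℝ}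
    {ω : ℝ → ℝ → ℝ} (hω : IsControl T ω) {θ : ℝ} {A : ℝ → ℝ → E}
    (h : BoundedByControl T ω θ A) :
    ∃ C ≥ 1, ∀ s t, 0 ≤ s → s ≤ t → t ≤ T → ‖A s t‖ ≤ C * ω s t ^ θ := by
  obtain ⟨C, hC⟩ := h
  refine ⟨max 1 C, le_max_left _ _, fun s t h0 hst hT => (hC s t h0 hst hT).trans ?_⟩
  exact mul_le_mul_of_nonneg_right (le_max_right _ _)
    (Real.rpow_nonneg (hω.nonneg s t h0 hst hT) _)

namespace ProjTensor

variable {E F G : Type*} [NormedAddCommGroup E] [NormedSpace ℝ E]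
  [NormedAddCommGroup F] [NormedSpace ℝ F] [NormedAddCommGroup G] [NormedSpace ℝ G]

theorem norm_mapRight_le (A : F →L[ℝ] G) (q : ProjTensor E F) :
    ‖mapRight A q‖ ≤ ‖A‖ * ‖q‖ := by
  refine (norm_lift_apply_le _ q).trans (mul_le_mul_of_nonneg_right ?_ (norm_nonneg _))
  refine ContinuousLinearMap.opNorm_le_bound₂ _ (norm_nonneg _) fun a b => ?_
  calc ‖tmul E G a (A b)‖ ≤ ‖a‖ * ‖A b‖ := norm_tmul_le _ _
    _ ≤ ‖a‖ * (‖A‖ * ‖b‖) := mul_le_mul_of_nonneg_left (A.le_opNorm b) (norm_nonneg _)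
    _ = _ := by ring

theorem mapRight_sub (A B : F →L[ℝ] G) :
    (mapRight (A - B) : ProjTensor E F →L[ℝ] ProjTensor E G) = mapRight A - mapRight B :=
  clm_ext fun a b => by simp [mapRight_tmul]

end ProjTensor

theorem RoughPath.incr₂_chen {T : ℝ} {ω : ℝ → ℝ → ℝ} {p : ℝ} {U : Type*} [NormedAddCommGroup U]
    [NormedSpace ℝ U] (x : RoughPath T ω p U) (r s t : ℝ) :
    x.incr₂ r t = x.incr₂ r s + x.incr₂ s t + ProjTensor.tmul U U (x.incr₁ r s) (x.incr₁ s t) := by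
  simp only [incr₂, incr₁, map_sub, sub_apply]
  abel

/-! ### The cross iterated integral -/

section

variable {T : ℝ} {ω : ℝ → ℝ → ℝ} {p : ℝ} {U W : Type*}
  [NormedAddCommGroup U] [NormedSpace ℝ U] [NormedAddCommGroup W] [NormedSpace ℝ W]

/-- The driving rough path, the controlled path `z` and its iterated integral `zb` are all bounded
with the constant `C`. -/
structure RoughBounds {x : RoughPath T ω p U} (z : CRP x p (p / 2) W)
    (zb : ℝ → ℝ → ProjTensor U W) (C : ℝ) : Prop where
  one_le : 1 ≤ C
  norm_x_le : ∀ s t, 0 ≤ s → s ≤ t → t ≤ T → ‖x.first t - x.first s‖ ≤ C * ω s t ^ (1 / p)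
  norm_zd_le : ∀ t, 0 ≤ t → t ≤ T → ‖z.dag t‖ ≤ C
  norm_zd_sub_le : ∀ s t, 0 ≤ s → s ≤ t → t ≤ T → ‖z.dag t - z.dag s‖ ≤ C * ω s t ^ (1 / p)
  norm_z_le : ∀ s t, 0 ≤ s → s ≤ t → t ≤ T → ‖z.path t - z.path s‖ ≤ C * ω s t ^ (1 / p)
  norm_z_sharp_le : ∀ s t, 0 ≤ s → s ≤ t → t ≤ T →
    ‖z.path t - z.path s - z.dag s (x.first t - x.first s)‖ ≤
      C * (ω s t ^ (1 / p) * ω s t ^ (1 / p))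
  norm_zb_le : ∀ s t, 0 ≤ s → s ≤ t → t ≤ T →
    ‖zb s t‖ ≤ C * (ω s t ^ (1 / p) * ω s t ^ (1 / p))
  chen : ∀ r s t, 0 ≤ r → r ≤ s → s ≤ t → t ≤ T →
    zb r s + zb s t + ProjTensor.tmul U W (x.first s - x.first r) (z.path t - z.path s) = zb r t

variable (hω : IsControl T ω) (hT : 0 < T) (hp : 2 ≤ p) (hp' : p < 3)
include hω hT hp hp'

/-- Chen's relation is not additivity, so what is sewn is `∫ (x - x_0) ⊗ dz`, with defects of order
`3/p > 1`; subtracting `(x_s - x_0) ⊗ z_{s,t}` from its increments restores the relation. -/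
theorem exists_flat {x : RoughPath T ω p U} (z : CRP x p (p / 2) W) :
    ∃ zb, IsFlat z zb ∧ ∃ C, RoughBounds z zb C := by
  obtain ⟨C₁, hC₁, h₁⟩ := x.bound_first.exists_one_le hω
  obtain ⟨C₂, hC₂, h₂⟩ := x.bound_second.exists_one_le hω
  obtain ⟨C₃, hC₃, h₃⟩ := z.bound_dag.exists_one_le hω
  obtain ⟨C₄, hC₄, h₄⟩ := z.bound_sharp.exists_one_le hω
  have hp0 : 0 < p := by linarith
  set Ω := ω 0 T ^ (1 / p) with hΩ
  have hq0 : ∀ {s t}, 0 ≤ s → s ≤ t → t ≤ T → 0 ≤ ω s t ^ (1 / p) := fun h0 hst hT =>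
    Real.rpow_nonneg (hω.nonneg _ _ h0 hst hT) _
  have hqΩ : ∀ {s t}, 0 ≤ s → s ≤ t → t ≤ T → ω s t ^ (1 / p) ≤ Ω := fun h0 hst hT =>
    Real.rpow_le_rpow (hω.nonneg _ _ h0 hst hT) (hω.mono le_rfl h0 hst hT le_rfl) (by positivity)
  have hΩ0 : 0 ≤ Ω := hq0 le_rfl hT.le le_rfl
  obtain ⟨C, hC1, hx, hx2, hzds, hzsh, hzd, hz⟩ : ∃ C : ℝ, 1 ≤ C ∧
      (∀ s t, 0 ≤ s → s ≤ t → t ≤ T → ‖x.first t - x.first s‖ ≤ C * ω s t ^ (1 / p)) ∧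
      (∀ s t, 0 ≤ s → s ≤ t → t ≤ T →
        ‖x.incr₂ s t‖ ≤ C * (ω s t ^ (1 / p) * ω s t ^ (1 / p))) ∧
      (∀ s t, 0 ≤ s → s ≤ t → t ≤ T → ‖z.dag t - z.dag s‖ ≤ C * ω s t ^ (1 / p)) ∧
      (∀ s t, 0 ≤ s → s ≤ t → t ≤ T → ‖z.path t - z.path s - z.dag s (x.first t - x.first s)‖ ≤
        C * (ω s t ^ (1 / p) * ω s t ^ (1 / p))) ∧
      (∀ t, 0 ≤ t → t ≤ T → ‖z.dag t‖ ≤ C) ∧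
      (∀ s t, 0 ≤ s → s ≤ t → t ≤ T → ‖z.path t - z.path s‖ ≤ C * ω s t ^ (1 / p)) := by
    -- The parenthesis bounds `z†` on `[0, T]`. The product `A * A` below is needed for `z`, whose
    -- increment is `z† x` plus a remainder.
    let A := C₁ + C₂ + C₃ + C₄ + (‖z.dag 0‖ + C₃ * Ω)
    have hB : 0 ≤ ‖z.dag 0‖ + C₃ * Ω := by positivity
    have hA1 : 1 ≤ A := by linarith
    have hAA : A ≤ A * A + A * Ω := by
      have : A ≤ A * A := by nlinarith
      have : 0 ≤ A * Ω := by positivity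
      linarith
    have hzd : ∀ t, 0 ≤ t → t ≤ T → ‖z.dag t‖ ≤ A := fun t h0 hT' => by
      have := h₃ 0 t le_rfl h0 hT'
      calc ‖z.dag t‖ = ‖z.dag 0 + (z.dag t - z.dag 0)‖ := by congr 1; abel
        _ ≤ ‖z.dag 0‖ + C₃ * Ω := (norm_add_le _ _).trans (add_le_add le_rfl (this.trans
            (mul_le_mul_of_nonneg_left (hqΩ le_rfl h0 hT') (by linarith))))
        _ ≤ A := by linarith
    refine ⟨A * A + A * Ω, by linarith, fun s t h0 hst hT' => ?_, fun s t h0 hst hT' => ?_,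
      fun s t h0 hst hT' => ?_, fun s t h0 hst hT' => ?_, fun t h0 hT' => ?_,
      fun s t h0 hst hT' => ?_⟩
    · exact (h₁ s t h0 hst hT').trans (mul_le_mul_of_nonneg_right (by linarith) (hq0 h0 hst hT'))
    · rw [← hω.rpow_two_div hp h0 hst hT', one_div_div]
      exact (h₂ s t h0 hst hT').trans (mul_le_mul_of_nonneg_right (by linarith)
        (Real.rpow_nonneg (hω.nonneg s t h0 hst hT') _))
    · exact (h₃ s t h0 hst hT').trans (mul_le_mul_of_nonneg_right (by linarith) (hq0 h0 hst hT'))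
    · rw [← hω.rpow_two_div hp h0 hst hT']
      exact (h₄ s t h0 hst hT').trans (mul_le_mul_of_nonneg_right (by linarith)
        (Real.rpow_nonneg (hω.nonneg s t h0 hst hT') _))
    · exact (hzd t h0 hT').trans hAA
    · have k1 := h₄ s t h0 hst hT'
      rw [hω.rpow_two_div hp h0 hst hT'] at k1
      have q0 := hq0 h0 hst hT'
      have k2 : ‖z.dag s (x.first t - x.first s)‖ ≤ A * (A * ω s t ^ (1 / p)) :=
        ((z.dag s).le_opNorm _).trans (mul_le_mul (hzd s h0 (hst.trans hT'))
          ((h₁ s t h0 hst hT').trans (mul_le_mul_of_nonneg_right (by linarith) q0))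
          (norm_nonneg _) (by linarith))
      calc ‖z.path t - z.path s‖ = ‖(z.path t - z.path s - z.dag s (x.incr₁ s t)) +
            z.dag s (x.first t - x.first s)‖ := by
            congr 1; simp [RoughPath.incr₁]
        _ ≤ C₄ * (ω s t ^ (1 / p) * ω s t ^ (1 / p)) + A * (A * ω s t ^ (1 / p)) :=
            (norm_add_le _ _).trans (add_le_add k1 k2)
        _ ≤ A * (Ω * ω s t ^ (1 / p)) + A * (A * ω s t ^ (1 / p)) := by
            refine add_le_add (mul_le_mul (by linarith) (mul_le_mul_of_nonneg_right
              (hqΩ h0 hst hT') q0) (by positivity) (by linarith)) le_rfl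
        _ = _ := by ring
  have hctl := hω.chainControl le_rfl hT.le le_rfl
  let Ξ : ℝ → ℝ → ProjTensor U W := fun s t =>
    ProjTensor.tmul U W (x.first s - x.first 0) (z.path t - z.path s) +
      ProjTensor.mapRight (z.dag s) (x.incr₂ s t)
  have hΞ : ∀ r s t : Icc 0 T, r ≤ s → s ≤ t → ‖Ξ r t - Ξ r s - Ξ s t‖ ≤
      3 * C ^ 3 * ω r t ^ (3 / p) := by
    rintro ⟨r, hr⟩ ⟨s, hs⟩ ⟨t, ht⟩ (hrs : r ≤ s) (hst : s ≤ t)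
    dsimp only
    have hrt := hrs.trans hst
    have e : Ξ r t - Ξ r s - Ξ s t = -(ProjTensor.mapRight (z.dag s - z.dag r) (x.incr₂ s t) +
        ProjTensor.tmul U W (x.first s - x.first r)
          ((z.path t - z.path s - z.dag s (x.first t - x.first s)) +
            (z.dag s - z.dag r) (x.first t - x.first s))) := by
      simp only [Ξ, x.incr₂_chen r s t, map_add, ProjTensor.mapRight_tmul, ProjTensor.mapRight_sub,
        sub_apply, map_sub, RoughPath.incr₁]
      abel
    rw [e, norm_neg, hω.rpow_three_div hp hr.1 hrt ht.2]
    have q1 : ω r s ^ (1 / p) ≤ ω r t ^ (1 / p) := Real.rpow_le_rpow (hω.nonneg _ _ hr.1 hrs hs.2)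
      (hω.mono hr.1 le_rfl hrs hst ht.2) (by positivity)
    have q2 : ω s t ^ (1 / p) ≤ ω r t ^ (1 / p) := Real.rpow_le_rpow (hω.nonneg _ _ hs.1 hst ht.2)
      (hω.mono hr.1 hrs hst le_rfl ht.2) (by positivity)
    have q3 := hq0 hr.1 hrs hs.2
    have q4 := hq0 hs.1 hst ht.2
    have q5 := hq0 hr.1 hrt ht.2
    set q := ω r t ^ (1 / p)
    have hC0 : 0 ≤ C := by linarith
    have b1 : ‖z.dag s - z.dag r‖ ≤ C * q :=
      (hzds r s hr.1 hrs hs.2).trans (mul_le_mul_of_nonneg_left q1 hC0)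
    have b2 : ‖x.incr₂ s t‖ ≤ C * (q * q) :=
      (hx2 s t hs.1 hst ht.2).trans (mul_le_mul_of_nonneg_left
        (mul_le_mul q2 q2 q4 q5) hC0)
    have b3 : ‖x.first s - x.first r‖ ≤ C * q :=
      (hx r s hr.1 hrs hs.2).trans (mul_le_mul_of_nonneg_left q1 hC0)
    have b4 : ‖z.path t - z.path s - z.dag s (x.first t - x.first s)‖ ≤ C * (q * q) :=
      (hzsh s t hs.1 hst ht.2).trans (mul_le_mul_of_nonneg_left
        (mul_le_mul q2 q2 q4 q5) hC0)
    have b5 : ‖x.first t - x.first s‖ ≤ C * q :=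
      (hx s t hs.1 hst ht.2).trans (mul_le_mul_of_nonneg_left q2 hC0)
    have b6 : ‖(z.dag s - z.dag r) (x.first t - x.first s)‖ ≤ C * q * (C * q) :=
      (ContinuousLinearMap.le_opNorm _ _).trans (mul_le_mul b1 b5 (norm_nonneg _) (by positivity))
    have hC2 : C ^ 2 ≤ C ^ 3 := pow_le_pow_right₀ hC1 (by norm_num)
    calc _ ≤ C * q * (C * (q * q)) + C * q * (C * (q * q) + C * q * (C * q)) := by
          refine (norm_add_le _ _).trans (add_le_add ?_ ?_)
          · exact (ProjTensor.norm_mapRight_le _ _).trans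
              (mul_le_mul b1 b2 (norm_nonneg _) (by positivity))
          · exact (ProjTensor.norm_tmul_le _ _).trans (mul_le_mul b3
              ((norm_add_le _ _).trans (add_le_add b4 b6)) (norm_nonneg _) (by positivity))
      _ = (2 * C ^ 2 + C ^ 3) * (q * q * q) := by ring
      _ ≤ _ := mul_le_mul_of_nonneg_right (by linarith) (by positivity)
  have hθ : 1 < 3 / p := (one_lt_div hp0).2 hp'
  obtain ⟨J, -, hJ⟩ := hctl.exists_sewing hθ (by positivity) hΞ
  let j : ℝ → ProjTensor U W := fun t => J (projIcc 0 T hT.le t)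
  let zb : ℝ → ℝ → ProjTensor U W := fun s t =>
    j t - j s - ProjTensor.tmul U W (x.first s - x.first 0) (z.path t - z.path s)
  set S := sewConst (3 / p) * (3 * C ^ 3)
  have hS : 0 ≤ S := mul_nonneg (sewConst_pos hθ).le (by positivity)
  have hclose : ∀ s t, 0 ≤ s → s ≤ t → t ≤ T →
      ‖zb s t - ProjTensor.mapRight (z.dag s) (x.incr₂ s t)‖ ≤ S * ω s t ^ (3 / p) := by
    intro s t h0 hst hT'
    have := hJ ⟨s, h0, hst.trans hT'⟩ ⟨t, h0.trans hst, hT'⟩ hst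
    have e : zb s t - ProjTensor.mapRight (z.dag s) (x.incr₂ s t) =
        J ⟨t, h0.trans hst, hT'⟩ - J ⟨s, h0, hst.trans hT'⟩ - Ξ s t := by
      simp only [zb, j, Ξ, projIcc_of_mem hT.le (show s ∈ Icc 0 T from ⟨h0, hst.trans hT'⟩),
        projIcc_of_mem hT.le (show t ∈ Icc 0 T from ⟨h0.trans hst, hT'⟩)]
      abel
    rw [e]
    exact this
  have hchen : ∀ r s t, 0 ≤ r → r ≤ s → s ≤ t → t ≤ T → zb r s + zb s t +
      ProjTensor.tmul U W (x.first s - x.first r) (z.path t - z.path s) = zb r t := by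
    intro r s t _ _ _ _
    simp only [zb, map_sub, sub_apply]
    abel
  refine ⟨zb, ⟨hchen, 3 / p, hθ, S, hclose⟩, C ^ 2 + S * Ω, ?_⟩
  have hCC : C ≤ C ^ 2 := by nlinarith
  have hSΩ : 0 ≤ S * Ω := by positivity
  have hle : C ≤ C ^ 2 + S * Ω := by linarith
  refine ⟨by linarith, fun s t h0 hst hT' => ?_, fun t h0 hT' => (hzd t h0 hT').trans hle,
    fun s t h0 hst hT' => ?_, fun s t h0 hst hT' => ?_, fun s t h0 hst hT' => ?_,
    fun s t h0 hst hT' => ?_, hchen⟩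
  · exact (hx s t h0 hst hT').trans (mul_le_mul_of_nonneg_right hle (hq0 h0 hst hT'))
  · exact (hzds s t h0 hst hT').trans (mul_le_mul_of_nonneg_right hle (hq0 h0 hst hT'))
  · exact (hz s t h0 hst hT').trans (mul_le_mul_of_nonneg_right hle (hq0 h0 hst hT'))
  · exact (hzsh s t h0 hst hT').trans (mul_le_mul_of_nonneg_right hle
      (mul_nonneg (hq0 h0 hst hT') (hq0 h0 hst hT')))
  · have k1 := hclose s t h0 hst hT'
    rw [hω.rpow_three_div hp h0 hst hT'] at k1
    have q0 := hq0 h0 hst hT'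
    have q1 := hqΩ h0 hst hT'
    have k2 : ‖ProjTensor.mapRight (z.dag s) (x.incr₂ s t)‖ ≤
        C * (C * (ω s t ^ (1 / p) * ω s t ^ (1 / p))) :=
      (ProjTensor.norm_mapRight_le _ _).trans (mul_le_mul (hzd s h0 (hst.trans hT'))
        (hx2 s t h0 hst hT') (norm_nonneg _) (by linarith))
    calc ‖zb s t‖ = ‖(zb s t - ProjTensor.mapRight (z.dag s) (x.incr₂ s t)) +
          ProjTensor.mapRight (z.dag s) (x.incr₂ s t)‖ := by rw [sub_add_cancel]
      _ ≤ S * (ω s t ^ (1 / p) * ω s t ^ (1 / p) * ω s t ^ (1 / p)) +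
          C * (C * (ω s t ^ (1 / p) * ω s t ^ (1 / p))) :=
          (norm_add_le _ _).trans (add_le_add k1 k2)
      _ ≤ S * (ω s t ^ (1 / p) * ω s t ^ (1 / p) * Ω) +
          C * (C * (ω s t ^ (1 / p) * ω s t ^ (1 / p))) := by gcongr
      _ = _ := by ring

-- In the difference of two candidates the tensor term of Chen's relation cancels, so it is the
-- increment of a path, of order above 1, hence zero.
omit hp hp' in
theorem IsFlat.eq {x : RoughPath T ω p U} {z : CRP x p (p / 2) W}
    {zb zb' : ℝ → ℝ → ProjTensor U W} (h : IsFlat z zb) (h' : IsFlat z zb') {s t : ℝ} (h0 : 0 ≤ s)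
    (hst : s ≤ t) (hT' : t ≤ T) : zb s t = zb' s t := by
  obtain ⟨hc, θ, hθ, hb⟩ := h
  obtain ⟨hc', θ', hθ', hb'⟩ := h'
  obtain ⟨C, hC, hb⟩ := hb.exists_one_le hω
  obtain ⟨C', hC', hb'⟩ := hb'.exists_one_le hω
  have hctl := hω.chainControl le_rfl hT.le le_rfl
  have hadd : ∀ s t, 0 ≤ s → s ≤ t → t ≤ T →
      (zb 0 t - zb' 0 t) - (zb 0 s - zb' 0 s) = zb s t - zb' s t := by
    intro s t h0 hst hT'
    rw [← hc 0 s t le_rfl h0 hst hT', ← hc' 0 s t le_rfl h0 hst hT']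
    abel
  have hm1 : 0 ≤ min θ θ' := (lt_min (by linarith) (by linarith)).le
  have key := hctl.eq_of_norm_sub_le (A := fun t : Icc 0 T => zb 0 t - zb' 0 t) (θ := min θ θ')
    (C := C * ω 0 T ^ (θ - min θ θ') + C' * ω 0 T ^ (θ' - min θ θ')) (lt_min hθ hθ') ?_
  · rw [← sub_eq_zero, ← hadd s t h0 hst hT']
    have k1 := key ⟨s, h0, hst.trans hT'⟩
    have k2 := key ⟨t, h0.trans hst, hT'⟩
    dsimp only at k1 k2
    rw [k1, k2, sub_self]
  · rintro ⟨s, hs⟩ ⟨t, ht⟩ (hst : s ≤ t)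
    dsimp only
    rw [hadd s t hs.1 hst ht.2]
    calc ‖zb s t - zb' s t‖ = ‖(zb s t - ProjTensor.mapRight (z.dag s) (x.incr₂ s t)) -
          (zb' s t - ProjTensor.mapRight (z.dag s) (x.incr₂ s t))‖ := by congr 1; abel
      _ ≤ C * ω s t ^ θ + C' * ω s t ^ θ' :=
          (norm_sub_le _ _).trans (add_le_add (hb s t hs.1 hst ht.2) (hb' s t hs.1 hst ht.2))
      _ ≤ C * (ω 0 T ^ (θ - min θ θ') * ω s t ^ min θ θ') +
          C' * (ω 0 T ^ (θ' - min θ θ') * ω s t ^ min θ θ') :=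
          add_le_add (mul_le_mul_of_nonneg_left (hω.rpow_le hm1 (min_le_left _ _) hs.1 hst ht.2)
            (by linarith)) (mul_le_mul_of_nonneg_left
            (hω.rpow_le hm1 (min_le_right _ _) hs.1 hst ht.2) (by linarith))
      _ = _ := by ring

end

/-! ### Solutions on intervals -/

section

variable {T : ℝ} {ω : ℝ → ℝ → ℝ} {p : ℝ} {U V W : Type*}
  [NormedAddCommGroup U] [NormedSpace ℝ U] [NormedAddCommGroup V] [NormedSpace ℝ V]
  [CompleteSpace V] [NormedAddCommGroup W] [NormedSpace ℝ W]
  {x : RoughPath T ω p U}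

/-- The local expansion of the solutions of the equation driven by `z` along the vector field
`f`. -/
noncomputable def rdeGerm (z : CRP x p (p / 2) W) (zb : ℝ → ℝ → ProjTensor U W)
    (f : V → W →L[ℝ] V) (y : ℝ → V) (s t : ℝ) : V :=
  f (y s) (z.path t - z.path s) +
    ProjTensor.lift ((fderiv ℝ f (y s)).comp ((f (y s)).comp (z.dag s))) (zb s t)

/-- The path `y` solves on `[a, b]` the equation driven by `z` along the vector field `f`, in terms
of its local expansion. -/
def DavieOn (z : CRP x p (p / 2) W) (zb : ℝ → ℝ → ProjTensor U W) (f : V → W →L[ℝ] V) (a b : ℝ)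
    (y : ℝ → V) : Prop :=
  ∃ C θ : ℝ, 1 < θ ∧ ∀ s t, a ≤ s → s ≤ t → t ≤ b →
    ‖y t - y s - rdeGerm z zb f y s t‖ ≤ C * ω s t ^ θ

variable {z : CRP x p (p / 2) W} {zb : ℝ → ℝ → ProjTensor U W} {f : V → W →L[ℝ] V}
  {a b : ℝ} {y : ℝ → V}

theorem DavieOn.mono {a' b' : ℝ} (h : DavieOn z zb f a b y) (ha : a ≤ a') (hb : b' ≤ b) :
    DavieOn z zb f a' b' y := by
  obtain ⟨C, θ, hθ, h⟩ := h
  exact ⟨C, θ, hθ, fun s t hs hst ht => h s t (ha.trans hs) hst (ht.trans hb)⟩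

theorem DavieOn.congr {v : ℝ → V} (h : DavieOn z zb f a b y) (hv : EqOn v y (Icc a b)) :
    DavieOn z zb f a b v := by
  obtain ⟨C, θ, hθ, h⟩ := h
  refine ⟨C, θ, hθ, fun s t hs hst ht => ?_⟩
  rw [rdeGerm, hv ⟨hs, hst.trans ht⟩, hv ⟨hs.trans hst, ht⟩]
  exact h s t hs hst ht

/-- The increments of a solution on `[a, b]`, together with those of its derivative, are bounded
with the constant `C`. -/
structure DavieBounds (z : CRP x p (p / 2) W) (f : V → W →L[ℝ] V) (a b C : ℝ) (y : ℝ → V) :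
    Prop where
  one_le : 1 ≤ C
  path : ∀ s t, a ≤ s → s ≤ t → t ≤ b → ‖y t - y s‖ ≤ C * ω s t ^ (1 / p)
  sharp : ∀ s t, a ≤ s → s ≤ t → t ≤ b →
    ‖y t - y s - f (y s) (z.dag s (x.first t - x.first s))‖ ≤
      C * (ω s t ^ (1 / p) * ω s t ^ (1 / p))
  dag : ∀ s t, a ≤ s → s ≤ t → t ≤ b →
    ‖(f (y t)).comp (z.dag t) - (f (y s)).comp (z.dag s)‖ ≤ C * ω s t ^ (1 / p)

omit [CompleteSpace V] in
theorem DavieBounds.mono {C C' a' b' : ℝ} (hω : IsControl T ω) (h : DavieBounds z f a b C y)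
    (hC : C ≤ C') (ha0 : 0 ≤ a) (hbT : b ≤ T) (ha : a ≤ a') (hb : b' ≤ b) :
    DavieBounds z f a' b' C' y where
  one_le := h.one_le.trans hC
  path s t hs hst ht := (h.path s t (ha.trans hs) hst (ht.trans hb)).trans
    (mul_le_mul_of_nonneg_right hC (Real.rpow_nonneg
      (hω.nonneg s t (ha0.trans (ha.trans hs)) hst (ht.trans (hb.trans hbT))) _))
  sharp s t hs hst ht := (h.sharp s t (ha.trans hs) hst (ht.trans hb)).trans
    (mul_le_mul_of_nonneg_right hC (mul_self_nonneg _))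
  dag s t hs hst ht := (h.dag s t (ha.trans hs) hst (ht.trans hb)).trans
    (mul_le_mul_of_nonneg_right hC (Real.rpow_nonneg
      (hω.nonneg s t (ha0.trans (ha.trans hs)) hst (ht.trans (hb.trans hbT))) _))

variable {γ K C₀ : ℝ} (hω : IsControl T ω) (hT : 0 < T) (hp : 2 ≤ p) (R : RoughBounds z zb C₀)
  (hf : HolderOne γ K f) (hf' : HolderOne γ K (fderiv ℝ f))
include hω hp R hf

omit [CompleteSpace V] hω hp in
theorem norm_comp_dag_le (v : V) {s : ℝ} (h0 : 0 ≤ s) (h1 : s ≤ T) :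
    ‖(f v).comp (z.dag s)‖ ≤ K * C₀ :=
  (ContinuousLinearMap.opNorm_comp_le _ _).trans
    (mul_le_mul (hf.norm_le _) (R.norm_zd_le s h0 h1) (norm_nonneg _) hf.K_nonneg)

omit [CompleteSpace V] hω hp in
theorem norm_fderiv_comp_dag_le (v : V) {s : ℝ} (h0 : 0 ≤ s) (h1 : s ≤ T) :
    ‖(fderiv ℝ f v).comp ((f v).comp (z.dag s))‖ ≤ K * (K * C₀) :=
  (ContinuousLinearMap.opNorm_comp_le _ _).trans
    (mul_le_mul (hf.norm_fderiv_le _) (norm_comp_dag_le R hf v h0 h1) (norm_nonneg _)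
      hf.K_nonneg)

/-- Since `2/p ≤ 1 < θ`, the error of the expansion is absorbed in the order `2/p`, and the
remaining terms are bounded through `f`, `Df` and the driver. No a priori bound on `y` is needed. -/
theorem DavieOn.exists_bounds (h : DavieOn z zb f a b y) (ha0 : 0 ≤ a) (hbT : b ≤ T) :
    ∃ C, DavieBounds z f a b C y := by
  obtain ⟨S, θ, hθ, h⟩ := h
  have hC := R.one_le
  have hK := hf.K_nonneg
  have h2p : 0 ≤ 1 / (p / 2) := by positivity
  have h2p' : 1 / (p / 2) ≤ θ := by
    refine le_trans ?_ hθ.le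
    rw [div_le_one (by linarith)]
    linarith
  rcases lt_or_ge T 0 with hT0 | hT0
  · refine ⟨1, le_rfl, ?_, ?_, ?_⟩ <;> intro s t hs hst ht <;> exfalso <;> linarith
  set Ω := ω 0 T ^ (1 / p)
  have hΩ0 : 0 ≤ Ω := Real.rpow_nonneg (hω.nonneg _ _ le_rfl hT0 le_rfl) _
  set S' := |S| * ω 0 T ^ (θ - 1 / (p / 2))
  have hS' : 0 ≤ S' := mul_nonneg (abs_nonneg _)
    (Real.rpow_nonneg (hω.nonneg _ _ le_rfl hT0 le_rfl) _)
  have hq0 : ∀ {s t}, a ≤ s → s ≤ t → t ≤ b → 0 ≤ ω s t ^ (1 / p) := fun hs hst ht =>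
    Real.rpow_nonneg (hω.nonneg _ _ (ha0.trans hs) hst (ht.trans hbT)) _
  have hqΩ : ∀ {s t}, a ≤ s → s ≤ t → t ≤ b → ω s t ^ (1 / p) ≤ Ω := fun hs hst ht =>
    Real.rpow_le_rpow (hω.nonneg _ _ (ha0.trans hs) hst (ht.trans hbT))
      (hω.mono le_rfl (ha0.trans hs) hst (ht.trans hbT) le_rfl) (by positivity)
  set A := S' + K * C₀ + K * (K * C₀) * C₀
  have hA : 0 ≤ A := by positivity
  have hsharp : ∀ s t, a ≤ s → s ≤ t → t ≤ b →
      ‖y t - y s - f (y s) (z.dag s (x.first t - x.first s))‖ ≤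
        A * (ω s t ^ (1 / p) * ω s t ^ (1 / p)) := by
    intro s t hs hst ht
    have hs0 := ha0.trans hs
    have htT := ht.trans hbT
    have k0 : ‖y t - y s - rdeGerm z zb f y s t‖ ≤ S' * (ω s t ^ (1 / p) * ω s t ^ (1 / p)) := by
      rw [← hω.rpow_two_div hp hs0 hst htT, mul_assoc]
      exact (h s t hs hst ht).trans (mul_le_mul (le_abs_self S) (hω.rpow_le h2p h2p' hs0 hst htT)
        (Real.rpow_nonneg (hω.nonneg s t hs0 hst htT) _) (abs_nonneg _))
    have k1 : ‖f (y s) (z.path t - z.path s - z.dag s (x.first t - x.first s))‖ ≤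
        K * (C₀ * (ω s t ^ (1 / p) * ω s t ^ (1 / p))) :=
      (ContinuousLinearMap.le_opNorm _ _).trans (mul_le_mul (hf.norm_le _)
        (R.norm_z_sharp_le s t hs0 hst htT) (norm_nonneg _) hK)
    have k2 : ‖ProjTensor.lift ((fderiv ℝ f (y s)).comp ((f (y s)).comp (z.dag s))) (zb s t)‖ ≤
        K * (K * C₀) * (C₀ * (ω s t ^ (1 / p) * ω s t ^ (1 / p))) :=
      (ProjTensor.norm_lift_apply_le _ _).trans (mul_le_mul
        (norm_fderiv_comp_dag_le R hf _ hs0 (hst.trans htT))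
        (R.norm_zb_le s t hs0 hst htT) (norm_nonneg _) (by positivity))
    have e : y t - y s - f (y s) (z.dag s (x.first t - x.first s)) =
        (y t - y s - rdeGerm z zb f y s t) +
        (f (y s) (z.path t - z.path s - z.dag s (x.first t - x.first s)) +
        ProjTensor.lift ((fderiv ℝ f (y s)).comp ((f (y s)).comp (z.dag s))) (zb s t)) := by
      rw [rdeGerm, map_sub (f (y s)) (z.path t - z.path s)]
      abel
    rw [e]
    refine (norm_add_le _ _).trans ((add_le_add k0 ((norm_add_le _ _).trans
      (add_le_add k1 k2))).trans_eq ?_)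
    ring
  set B := A * Ω + K * C₀ * C₀
  have hB : 0 ≤ B := by positivity
  have hpath : ∀ s t, a ≤ s → s ≤ t → t ≤ b → ‖y t - y s‖ ≤ B * ω s t ^ (1 / p) := by
    intro s t hs hst ht
    have hs0 := ha0.trans hs
    have htT := ht.trans hbT
    have q0 := hq0 hs hst ht
    have k1 : ‖(f (y s)).comp (z.dag s) (x.first t - x.first s)‖ ≤
        K * C₀ * (C₀ * ω s t ^ (1 / p)) :=
      (ContinuousLinearMap.le_opNorm _ _).trans (mul_le_mul
        (norm_comp_dag_le R hf _ hs0 (hst.trans htT)) (R.norm_x_le s t hs0 hst htT)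
        (norm_nonneg _) (by positivity))
    calc ‖y t - y s‖ = ‖(y t - y s - f (y s) (z.dag s (x.first t - x.first s))) +
          (f (y s)).comp (z.dag s) (x.first t - x.first s)‖ := by
          rw [ContinuousLinearMap.comp_apply, sub_add_cancel]
      _ ≤ A * (Ω * ω s t ^ (1 / p)) + K * C₀ * (C₀ * ω s t ^ (1 / p)) :=
          (norm_add_le _ _).trans (add_le_add ((hsharp s t hs hst ht).trans
            (mul_le_mul_of_nonneg_left (mul_le_mul_of_nonneg_right (hqΩ hs hst ht) q0) hA)) k1)
      _ = _ := by ring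
  refine ⟨1 + A + B + (K * B * C₀ + K * C₀), ?_, fun s t hs hst ht => ?_,
    fun s t hs hst ht => ?_, fun s t hs hst ht => ?_⟩
  · have : 0 ≤ K * B * C₀ + K * C₀ := by positivity
    linarith
  · refine (hpath s t hs hst ht).trans (mul_le_mul_of_nonneg_right ?_ (hq0 hs hst ht))
    have : 0 ≤ K * B * C₀ + K * C₀ := by positivity
    linarith
  · refine (hsharp s t hs hst ht).trans (mul_le_mul_of_nonneg_right ?_ (mul_self_nonneg _))
    have : 0 ≤ K * B * C₀ + K * C₀ := by positivity
    linarith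
  · have hs0 := ha0.trans hs
    have htT := ht.trans hbT
    have q0 := hq0 hs hst ht
    have e : (f (y t)).comp (z.dag t) - (f (y s)).comp (z.dag s) =
        (f (y t) - f (y s)).comp (z.dag t) + (f (y s)).comp (z.dag t - z.dag s) := by
      ext u; simp
    have k1 : ‖(f (y t) - f (y s)).comp (z.dag t)‖ ≤ K * (B * ω s t ^ (1 / p)) * C₀ :=
      (ContinuousLinearMap.opNorm_comp_le _ _).trans (mul_le_mul ((hf.norm_sub_le _ _).trans
        (mul_le_mul_of_nonneg_left (hpath s t hs hst ht) hK)) (R.norm_zd_le t (hs0.trans hst) htT)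
        (norm_nonneg _) (by positivity))
    have k2 : ‖(f (y s)).comp (z.dag t - z.dag s)‖ ≤ K * (C₀ * ω s t ^ (1 / p)) :=
      (ContinuousLinearMap.opNorm_comp_le _ _).trans (mul_le_mul (hf.norm_le _)
        (R.norm_zd_sub_le s t hs0 hst htT) (norm_nonneg _) hK)
    rw [e]
    calc _ ≤ K * (B * ω s t ^ (1 / p)) * C₀ + K * (C₀ * ω s t ^ (1 / p)) :=
          (norm_add_le _ _).trans (add_le_add k1 k2)
      _ = (K * B * C₀ + K * C₀) * ω s t ^ (1 / p) := by ring
      _ ≤ _ := mul_le_mul_of_nonneg_right (by linarith) q0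

include hf'

/-- The germ is almost additive of order `3/p`: Chen's relation cancels the leading terms, and the
rest are Taylor remainders and increments. `Df` being Lipschitz makes them quadratic, and only
bounds on the left interval enter. -/
theorem norm_rdeGerm_add_sub_le {u C : ℝ} (ha0 : 0 ≤ a) (hbT : b ≤ T)
    (hy : DavieBounds z f a u C y) {s t : ℝ} (hs : a ≤ s) (hsu : s ≤ u) (hut : u ≤ t)
    (ht : t ≤ b) :
    ‖rdeGerm z zb f y s u + rdeGerm z zb f y u t - rdeGerm z zb f y s t‖ ≤
      ((K * C ^ 2 + K * C) * C₀ + (K * C * (K * C₀) + K * C) * C₀) * ω s t ^ (3 / p) := by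
  have hC := hy.one_le
  have hC₀ := R.one_le
  have hK := hf.K_nonneg
  have hs0 := ha0.trans hs
  have hu0 := hs0.trans hsu
  have htT := ht.trans hbT
  have huT := hut.trans htT
  have e : rdeGerm z zb f y s u + rdeGerm z zb f y u t - rdeGerm z zb f y s t =
      ((f (y u) - f (y s) - fderiv ℝ f (y s) (y u - y s)) +
        fderiv ℝ f (y s) (y u - y s - f (y s) (z.dag s (x.first u - x.first s))))
          (z.path t - z.path u) +
      ProjTensor.lift ((fderiv ℝ f (y u) - fderiv ℝ f (y s)).comp ((f (y u)).comp (z.dag u)) +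
        (fderiv ℝ f (y s)).comp ((f (y u)).comp (z.dag u) - (f (y s)).comp (z.dag s)))
          (zb u t) := by
    simp only [rdeGerm, ← R.chen s u t hs0 hsu hut htT, map_add, ProjTensor.lift_tmul,
      ContinuousLinearMap.sub_comp, ContinuousLinearMap.comp_sub, ProjTensor.lift_sub,
      ProjTensor.lift_add, add_apply, sub_apply, map_sub, ContinuousLinearMap.comp_apply]
    abel
  have q1 : ω s u ^ (1 / p) ≤ ω s t ^ (1 / p) := Real.rpow_le_rpow (hω.nonneg _ _ hs0 hsu huT)
    (hω.mono hs0 le_rfl hsu hut htT) (by positivity)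
  have q2 : ω u t ^ (1 / p) ≤ ω s t ^ (1 / p) := Real.rpow_le_rpow (hω.nonneg _ _ hu0 hut htT)
    (hω.mono hs0 hsu hut le_rfl htT) (by positivity)
  have q3 : 0 ≤ ω s u ^ (1 / p) := Real.rpow_nonneg (hω.nonneg _ _ hs0 hsu huT) _
  have q4 : 0 ≤ ω u t ^ (1 / p) := Real.rpow_nonneg (hω.nonneg _ _ hu0 hut htT) _
  rw [e, hω.rpow_three_div hp hs0 (hsu.trans hut) htT]
  set q := ω s t ^ (1 / p)
  have q0 : 0 ≤ q := q3.trans q1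
  have k1 : ‖y u - y s‖ ≤ C * q := (hy.path s u hs hsu le_rfl).trans
    (mul_le_mul_of_nonneg_left q1 (by linarith))
  have k2 : ‖y u - y s - f (y s) (z.dag s (x.first u - x.first s))‖ ≤ C * (q * q) :=
    (hy.sharp s u hs hsu le_rfl).trans
      (mul_le_mul_of_nonneg_left (mul_le_mul q1 q1 q3 q0) (by linarith))
  have k3 : ‖(f (y u)).comp (z.dag u) - (f (y s)).comp (z.dag s)‖ ≤ C * q :=
    (hy.dag s u hs hsu le_rfl).trans (mul_le_mul_of_nonneg_left q1 (by linarith))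
  have k4 : ‖z.path t - z.path u‖ ≤ C₀ * q := (R.norm_z_le u t hu0 hut htT).trans
    (mul_le_mul_of_nonneg_left q2 (by linarith))
  have k5 : ‖zb u t‖ ≤ C₀ * (q * q) := (R.norm_zb_le u t hu0 hut htT).trans
    (mul_le_mul_of_nonneg_left (mul_le_mul q2 q2 q4 q0) (by linarith))
  have k6 : ‖f (y u) - f (y s) - fderiv ℝ f (y s) (y u - y s)‖ ≤ K * C ^ 2 * (q * q) := by
    have h1 : HolderOne 1 K f := ⟨hf.diff, hf.norm_le, hf.norm_fderiv_le, fun u v => by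
      rw [Real.rpow_one]; exact hf'.norm_sub_le u v⟩
    have h2 := h1.norm_taylor_sub_le zero_le_one (y s) (v := y u - y s) (v' := 0) le_rfl (by simp)
    simp only [add_sub_cancel, add_zero, sub_self, map_zero, sub_zero, Real.rpow_one] at h2
    refine h2.trans ?_
    calc _ ≤ K * (C * q) * (C * q) := by gcongr
      _ = _ := by ring
  have k7 : ‖fderiv ℝ f (y s) (y u - y s - f (y s) (z.dag s (x.first u - x.first s)))‖ ≤
      K * (C * (q * q)) := (ContinuousLinearMap.le_opNorm _ _).trans
    (mul_le_mul (hf.norm_fderiv_le _) k2 (norm_nonneg _) hK)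
  have k8 : ‖(fderiv ℝ f (y u) - fderiv ℝ f (y s)).comp ((f (y u)).comp (z.dag u))‖ ≤
      K * (C * q) * (K * C₀) := (ContinuousLinearMap.opNorm_comp_le _ _).trans
    (mul_le_mul ((hf'.norm_sub_le _ _).trans (mul_le_mul_of_nonneg_left k1 hK))
      (norm_comp_dag_le R hf _ hu0 huT) (norm_nonneg _) (by positivity))
  have k9 : ‖(fderiv ℝ f (y s)).comp ((f (y u)).comp (z.dag u) - (f (y s)).comp (z.dag s))‖ ≤
      K * (C * q) := (ContinuousLinearMap.opNorm_comp_le _ _).trans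
    (mul_le_mul (hf.norm_fderiv_le _) k3 (norm_nonneg _) hK)
  have k10 := (ContinuousLinearMap.opNorm_add_le _ _).trans (add_le_add k8 k9)
  calc _ ≤ (K * C ^ 2 * (q * q) + K * (C * (q * q))) * (C₀ * q) +
        (K * (C * q) * (K * C₀) + K * (C * q)) * (C₀ * (q * q)) := by
        refine (norm_add_le _ _).trans (add_le_add ?_ ?_)
        · exact (ContinuousLinearMap.le_opNorm _ _).trans (mul_le_mul
            ((norm_add_le _ _).trans (add_le_add k6 k7)) k4 (norm_nonneg _) (by positivity))
        · exact (ProjTensor.norm_lift_apply_le _ _).trans (mul_le_mul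
            k10 k5 (norm_nonneg _) (by positivity))
    _ = _ := by ring

/-- Only intervals that straddle `u` need an argument: their error is the sum of the errors on the
two sides and the defect of the germ. -/
theorem DavieOn.concat (hp' : p < 3) {u : ℝ} (ha0 : 0 ≤ a) (hbT : b ≤ T) (hau : a ≤ u)
    (hub : u ≤ b) (h : DavieOn z zb f a u y) (h' : DavieOn z zb f u b y) :
    DavieOn z zb f a b y := by
  obtain ⟨C, hy⟩ := h.exists_bounds hω hp R hf ha0 (hub.trans hbT)
  obtain ⟨C₁, θ₁, hθ₁, h₁⟩ := h
  obtain ⟨C₂, θ₂, hθ₂, h₂⟩ := h'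
  set C₃ := (K * C ^ 2 + K * C) * C₀ + (K * C * (K * C₀) + K * C) * C₀
  have hC₃ : 0 ≤ C₃ := by
    have := hy.one_le
    have := R.one_le
    have := hf.K_nonneg
    positivity
  have h3p : 1 < 3 / p := (one_lt_div (by linarith)).2 hp'
  set θ := min (min θ₁ θ₂) (3 / p)
  have hθ : 1 < θ := lt_min (lt_min hθ₁ hθ₂) h3p
  set P : ℝ → ℝ := fun β => ω 0 T ^ (β - θ)
  have hT0 : 0 ≤ T := ha0.trans (hau.trans (hub.trans hbT))
  have hP : ∀ β, 0 ≤ P β := fun β => Real.rpow_nonneg (hω.nonneg _ _ le_rfl hT0 le_rfl) _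
  have key : ∀ {C β s t : ℝ}, θ ≤ β → 0 ≤ s → s ≤ t → t ≤ T →
      C * ω s t ^ β ≤ |C| * P β * ω s t ^ θ := by
    intro C β s t hβ h0 hst hT'
    rw [mul_assoc]
    exact mul_le_mul (le_abs_self C) (hω.rpow_le (by linarith) hβ h0 hst hT')
      (Real.rpow_nonneg (hω.nonneg s t h0 hst hT') _) (abs_nonneg _)
  have l₁ : θ ≤ θ₁ := (min_le_left _ _).trans (min_le_left _ _)
  have l₂ : θ ≤ θ₂ := (min_le_left _ _).trans (min_le_right _ _)
  refine ⟨|C₁| * P θ₁ + |C₂| * P θ₂ + |C₃| * P (3 / p), θ, hθ, fun s t hs hst ht => ?_⟩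
  have hs0 := ha0.trans hs
  have htT := ht.trans hbT
  have n1 : 0 ≤ |C₁| * P θ₁ := mul_nonneg (abs_nonneg _) (hP _)
  have n2 : 0 ≤ |C₂| * P θ₂ := mul_nonneg (abs_nonneg _) (hP _)
  have n3 : 0 ≤ |C₃| * P (3 / p) := mul_nonneg (abs_nonneg _) (hP _)
  have nw : 0 ≤ ω s t ^ θ := Real.rpow_nonneg (hω.nonneg s t hs0 hst htT) _
  rcases le_total t u with htu | hut
  · refine ((h₁ s t hs hst htu).trans (key l₁ hs0 hst htT)).trans
      (mul_le_mul_of_nonneg_right (by linarith) nw)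
  rcases le_total u s with hus | hsu
  · refine ((h₂ s t hus hst ht).trans (key l₂ hs0 hst htT)).trans
      (mul_le_mul_of_nonneg_right (by linarith) nw)
  have huT := hut.trans htT
  have hu0 := hs0.trans hsu
  have e : y t - y s - rdeGerm z zb f y s t = (y u - y s - rdeGerm z zb f y s u) +
      (y t - y u - rdeGerm z zb f y u t) +
      (rdeGerm z zb f y s u + rdeGerm z zb f y u t - rdeGerm z zb f y s t) := by abel
  have m1 : ω s u ^ θ ≤ ω s t ^ θ := Real.rpow_le_rpow (hω.nonneg _ _ hs0 hsu huT)
    (hω.mono hs0 le_rfl hsu hut htT) (by linarith)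
  have m2 : ω u t ^ θ ≤ ω s t ^ θ := Real.rpow_le_rpow (hω.nonneg _ _ hu0 hut htT)
    (hω.mono hs0 hsu hut le_rfl htT) (by linarith)
  rw [e, add_mul, add_mul]
  refine (norm_add_le _ _).trans (add_le_add ((norm_add_le _ _).trans (add_le_add ?_ ?_)) ?_)
  · exact ((h₁ s u hs hsu le_rfl).trans (key l₁ hs0 hsu huT)).trans
      (mul_le_mul_of_nonneg_left m1 n1)
  · exact ((h₂ u t le_rfl hut ht).trans (key l₂ hu0 hut htT)).trans
      (mul_le_mul_of_nonneg_left m2 n2)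
  · exact (norm_rdeGerm_add_sub_le hω hp R hf hf' ha0 hbT hy hs hsu hut ht).trans
      (key (min_le_right _ _) hs0 hst htT)

end

/-! ### The local flow -/

section

variable {T : ℝ} {ω : ℝ → ℝ → ℝ} {p : ℝ} {U V W : Type*}
  [NormedAddCommGroup U] [NormedSpace ℝ U] [NormedAddCommGroup V] [NormedSpace ℝ V]
  [CompleteSpace V] [NormedAddCommGroup W] [NormedSpace ℝ W]
  {x : RoughPath T ω p U} {z : CRP x p (p / 2) W} {zb : ℝ → ℝ → ProjTensor U W}
  {a b : ℝ}

/-- The driver `D` is the restriction of `x`, `z` and `zb` to `[a, b]`, where the rough path `x` is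
dilated by `Λ`. -/
structure IsDilation (z : CRP x p (p / 2) W) (zb : ℝ → ℝ → ProjTensor U W)
    (D : Driver (Icc a b) U W) (Λ : ℝ) : Prop where
  pos : 0 < Λ
  one_le : 1 ≤ Λ
  o_eq : (D.o : ℝ) = a
  ω_eq : ∀ s t, D.ω s t = ω s t
  al_eq : D.al = 1 / p
  x_eq : ∀ t, D.x t = Λ • x.first t
  z_eq : ∀ t, D.z t = z.path t
  zd_eq : ∀ t, D.zd t = Λ⁻¹ • z.dag t
  zb_eq : ∀ s t, D.zb s t = Λ • zb s t

/-- The restriction of a driver to `[a, b]`, with a dilated rough path. -/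
noncomputable def dilatedDriver {C₀ τ Λ η : ℝ} (hω : IsControl T ω) (hp : 2 ≤ p)
    (R : RoughBounds z zb C₀) (hτ : 0 < τ) (hτ' : τ < 1) (hτp : p < 2 + τ) (hΛ : 1 ≤ Λ)
    (hη : 0 ≤ η) (h0 : 0 ≤ a) (h : a ≤ b) (hT : b ≤ T) (h1 : ω a b ≤ 1)
    (hη' : (ω a b ^ (1 / p)) ^ (1 - τ) ≤ η) : Driver (Icc a b) U W where
  o := ⟨a, left_mem_Icc.2 h⟩
  ω s t := ω s t
  control := hω.chainControl h0 h hT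
  al := 1 / p
  τ := τ
  al_pos := by positivity
  τ_pos := hτ
  τ_lt_one := hτ'
  one_lt := by
    rw [mul_one_div, one_lt_div (by linarith)]
    exact hτp
  C := Λ * C₀
  η := η
  d := Λ⁻¹ * C₀
  one_le_C := one_le_mul_of_one_le_of_one_le hΛ R.one_le
  η_nonneg := hη
  d_le_C := mul_le_mul_of_nonneg_right ((inv_le_one_of_one_le₀ hΛ).trans hΛ)
    (zero_le_one.trans R.one_le)
  le_one s t hst := (hω.mono h0 s.2.1 hst t.2.2 hT).trans h1
  pow_le s t hst := le_trans (Real.rpow_le_rpow (Real.rpow_nonneg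
    (hω.nonneg _ _ (h0.trans s.2.1) hst (t.2.2.trans hT)) _) (Real.rpow_le_rpow
    (hω.nonneg _ _ (h0.trans s.2.1) hst (t.2.2.trans hT)) (hω.mono h0 s.2.1 hst t.2.2 hT)
    (by positivity)) (by linarith)) hη'
  x t := Λ • x.first t
  z t := z.path t
  zd t := Λ⁻¹ • z.dag t
  zb s t := Λ • zb s t
  norm_x_le s t hst := by
    rw [← smul_sub, norm_smul, Real.norm_of_nonneg (by linarith), mul_assoc]
    exact mul_le_mul_of_nonneg_left (R.norm_x_le s t (h0.trans s.2.1) hst (t.2.2.trans hT))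
      (by linarith)
  norm_zd_le t := by
    have : 0 ≤ Λ⁻¹ := inv_nonneg.2 (by linarith)
    rw [norm_smul, Real.norm_of_nonneg this]
    exact mul_le_mul_of_nonneg_left (R.norm_zd_le t (h0.trans t.2.1) (t.2.2.trans hT)) this
  norm_zd_sub_le s t hst := by
    have : 0 ≤ Λ⁻¹ := inv_nonneg.2 (by linarith)
    rw [← smul_sub, norm_smul, Real.norm_of_nonneg this, mul_assoc]
    exact mul_le_mul ((inv_le_one_of_one_le₀ hΛ).trans hΛ)
      (R.norm_zd_sub_le s t (h0.trans s.2.1) hst (t.2.2.trans hT)) (norm_nonneg _) (by linarith)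
  norm_z_le s t hst := by
    have := R.norm_z_le s t (h0.trans s.2.1) hst (t.2.2.trans hT)
    rw [mul_assoc]
    exact this.trans (le_mul_of_one_le_left ((norm_nonneg _).trans this) hΛ)
  norm_z_sharp_le s t hst := by
    have := R.norm_z_sharp_le s t (h0.trans s.2.1) hst (t.2.2.trans hT)
    rw [← smul_sub, smul_apply, map_smul, inv_smul_smul₀ (by linarith), mul_assoc]
    exact this.trans (le_mul_of_one_le_left ((norm_nonneg _).trans this) hΛ)
  norm_zb_le s t hst := by
    rw [norm_smul, Real.norm_of_nonneg (by linarith), mul_assoc]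
    exact mul_le_mul_of_nonneg_left (R.norm_zb_le s t (h0.trans s.2.1) hst (t.2.2.trans hT))
      (by linarith)
  chen r s t hrs hst := by
    rw [← R.chen r s t (h0.trans r.2.1) hrs hst (t.2.2.trans hT), ← smul_sub, map_smul,
      smul_apply, smul_add, smul_add]

/-- The order of the choices matters: `Λ` depends on `K` and `C₀`, and fixes the constant `Λ * C₀`;
then `η` is chosen, and last the length `δ`, which does not depend on the position of the interval.
The parameter `M` lets given solutions be brought into the contraction domain. -/
theorem exists_dilatedDriver {C₀ τ : ℝ} (hω : IsControl T ω) (hp : 2 ≤ p)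
    (R : RoughBounds z zb C₀) (hτ : 0 < τ) (hτ' : τ < 1) (hτp : p < 2 + τ) (K M : ℝ) :
    ∃ δ > 0, ∀ a b, 0 ≤ a → a ≤ b → b ≤ T → b - a ≤ δ →
      ∃ (D : Driver (Icc a b) U W) (Λ : ℝ), IsDilation z zb D Λ ∧ D.Small K ∧ D.τ = τ ∧
        M * D.η ≤ 1 := by
  set Λ := 4 * |K| * C₀ + 1
  have hC₀ := R.one_le
  have hKC : 0 ≤ 4 * |K| * C₀ := by positivity
  have hΛ : 1 ≤ Λ := by linarith
  set cI := (2 * sewConst ((2 + τ) * (1 / p)) + 3) * (Λ * C₀) ^ 2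
  set B := cI * (4 * (Λ * C₀ + 1) ^ 2 * (2 * K * ((Λ * C₀ + 1) * 2) ^ 2))
  -- Serves both `B * η ≤ 1/4`, the second smallness condition, and `M * η ≤ 1`.
  set η := (4 * |B| + |M| + 1)⁻¹
  have hη : 0 < η := by positivity
  have hη1 : (4 * |B| + |M| + 1) * η = 1 := mul_inv_cancel₀ (by positivity)
  have hp0 : 0 < p := by linarith
  have hτ1 : 0 < 1 - τ := by linarith
  -- The threshold inverts the powers `1/p` and `1 - τ`, so that `(ω ^ (1/p)) ^ (1-τ) ≤ η`.
  obtain ⟨δ, hδ, hm⟩ := hω.exists_modulus (ε := min 1 ((η ^ (1 / (1 - τ))) ^ p)) (by positivity)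
  refine ⟨δ, hδ, fun a b h0 h hT hd => ?_⟩
  have hw := hm a b h0 h hT hd
  have hw0 := hω.nonneg a b h0 h hT
  have h2 : (ω a b ^ (1 / p)) ^ (1 - τ) ≤ η := by
    have k1 : ω a b ^ (1 / p) ≤ η ^ (1 / (1 - τ)) := by
      refine (Real.rpow_le_rpow hw0 (hw.trans (min_le_right _ _)) (by positivity)).trans_eq ?_
      rw [← Real.rpow_mul (by positivity), mul_one_div_cancel hp0.ne', Real.rpow_one]
    refine (Real.rpow_le_rpow (Real.rpow_nonneg hw0 _) k1 hτ1.le).trans_eq ?_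
    rw [← Real.rpow_mul hη.le, one_div_mul_cancel hτ1.ne', Real.rpow_one]
  refine ⟨dilatedDriver hω hp R hτ hτ' hτp hΛ hη.le h0 h hT (hw.trans (min_le_left _ _)) h2, Λ,
    ⟨by linarith, hΛ, rfl, fun _ _ => rfl, rfl, fun _ => rfl, fun _ => rfl, fun _ => rfl,
      fun _ _ => rfl⟩, ⟨?_, ?_⟩, rfl, ?_⟩
  · change K * (Λ⁻¹ * C₀) ≤ 1 / 4
    rw [show K * (Λ⁻¹ * C₀) = K * C₀ / Λ by field_simp, div_le_iff₀ (by linarith)]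
    have : K * C₀ ≤ |K| * C₀ := mul_le_mul_of_nonneg_right (le_abs_self K) (by linarith)
    linarith
  · change cI * η * (4 * (Λ * C₀ + 1) ^ 2 * (2 * K * ((Λ * C₀ + 1) * 2) ^ 2)) ≤ 1 / 4
    have e : cI * η * (4 * (Λ * C₀ + 1) ^ 2 * (2 * K * ((Λ * C₀ + 1) * 2) ^ 2)) = B * η := by
      simp only [B]; ring
    rw [e]
    have h3 : B * η ≤ |B| * η := mul_le_mul_of_nonneg_right (le_abs_self B) hη.le
    have h4 : 0 ≤ |M| * η := by positivity
    linarith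
  · change M * η ≤ 1
    have h3 : M * η ≤ |M| * η := mul_le_mul_of_nonneg_right (le_abs_self M) hη.le
    have h4 : 0 ≤ |B| * η := by positivity
    linarith

namespace IsDilation

variable {D : Driver (Icc a b) U W} {Λ : ℝ} (hD : IsDilation z zb D Λ)
include hD

theorem a_eq (s t : Icc a b) : D.a s t = ω s t ^ (1 / p) := by
  rw [Driver.a, hD.ω_eq, hD.al_eq]

/-- The factors `Λ⁻¹` from `z†` and `Λ` from `z♭` cancel: the local expansion does not see the
dilation. -/
theorem lift_zb {f : V → W →L[ℝ] V} (v : V) (s t : Icc a b) :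
    ProjTensor.lift ((fderiv ℝ f v).comp ((f v).comp (D.zd s))) (D.zb s t) =
      ProjTensor.lift ((fderiv ℝ f v).comp ((f v).comp (z.dag s))) (zb s t) := by
  rw [hD.zd_eq, hD.zb_eq, ContinuousLinearMap.comp_smul, ContinuousLinearMap.comp_smul,
    ProjTensor.lift_smul, smul_apply, map_smul, inv_smul_smul₀ hD.pos.ne']

variable {γ K : ℝ} {f : V → W →L[ℝ] V} (hf : HolderOne γ K f) (hγ : D.τ ≤ γ) (hγ' : γ ≤ 1)
include hf hγ hγ'

/-- The fixed point equation forces `y† = f(y) z†`, which turns the germ of the rough integral into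
the local expansion of the equation. -/
theorem davieOn_of_fixed {v : V} {y : D.Path V}
    (hy : y = Driver.Path.const D V v + D.picard f y) (h : a ≤ b) :
    y.val D.o = v ∧ DavieOn z zb f a b fun t => y.val (projIcc a b h t) := by
  have hval : ∀ t, y.val t = v + Driver.intVal (Driver.nem f y) t := fun t => by
    conv_lhs => rw [hy]
    rfl
  have hdag : ∀ t, y.dag t = (f (y.val t)).comp (D.zd t) := fun t => by
    conv_lhs => rw [hy]
    rw [Driver.Path.dag_add, Pi.add_apply, Driver.Path.dag_const, zero_add, Driver.picard,
      Driver.dag_integral, Driver.val_nem hf hγ hγ']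
  refine ⟨by rw [hval, Driver.intVal_zero, add_zero], sewConst D.θ * (2 * ‖Driver.nem f y‖ * D.C), D.θ,
    D.one_lt, fun s t hs hst ht => ?_⟩
  have hs' : s ∈ Icc a b := ⟨hs, hst.trans ht⟩
  have ht' : t ∈ Icc a b := ⟨hs.trans hst, ht⟩
  have key := Driver.norm_intVal_sub_le (Driver.nem f y) (s := ⟨s, hs'⟩) (t := ⟨t, ht'⟩) hst
  rw [hD.ω_eq, Driver.germ, Driver.val_nem hf hγ hγ', Driver.dag_nem hf hγ hγ'] at key
  simp only [hdag, hD.lift_zb, hD.z_eq] at key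
  rw [rdeGerm]
  simp only [projIcc_of_mem h hs', projIcc_of_mem h ht']
  rw [show y.val ⟨t, ht'⟩ - y.val ⟨s, hs'⟩ = Driver.intVal (Driver.nem f y) ⟨t, ht'⟩ -
    Driver.intVal (Driver.nem f y) ⟨s, hs'⟩ by rw [hval, hval, add_sub_add_left_eq_sub]]
  exact key

/-- The natural weights give `M * a ≤ M * η * b ≤ b`: on a short interval any solution with bounds
`M` is tame with constant 1. Uniqueness of the sewn integral then makes it a fixed point. -/
theorem exists_fixed_of_davieOn {y : ℝ → V} {M : ℝ} (hKd : D.Small K)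
    (hM : M * D.η ≤ 1) (hy : DavieBounds z f a b M y) (h : DavieOn z zb f a b y) :
    ∃ v ∈ D.tameSet V 1, v = Driver.Path.const D V (y a) + D.picard f v ∧ ∀ t : Icc a b, v.val t = y t := by
  have hM1 := hy.one_le
  have ha : ∀ s t : Icc a b, s ≤ t → M * ω s t ^ (1 / p) ≤ D.b s t := fun s t hst => by
    rw [← hD.a_eq]
    calc M * D.a s t ≤ M * (D.η * D.b s t) :=
          mul_le_mul_of_nonneg_left (D.a_le_eta_mul_b hst) (by linarith)
      _ = M * D.η * D.b s t := by ring
      _ ≤ _ := mul_le_of_le_one_left (D.b_nonneg hst) hM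
  let v' : Icc a b → U →L[ℝ] V := fun t => (f (y t)).comp (D.zd t)
  have htame : D.Tame 1 (fun t : Icc a b => y t) v' := by
    refine ⟨fun t => ?_, fun s t hst => ?_, fun s t hst => ?_⟩
    · refine (ContinuousLinearMap.opNorm_comp_le _ _).trans ((mul_le_mul (hf.norm_le _)
        (D.norm_zd_le t) (norm_nonneg _) hf.K_nonneg).trans ?_)
      linarith [hKd.d_le]
    · have hΛ : 0 ≤ Λ⁻¹ := inv_nonneg.2 hD.pos.le
      have e : v' t - v' s = Λ⁻¹ • ((f (y t)).comp (z.dag t) - (f (y s)).comp (z.dag s)) := by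
        simp only [v', hD.zd_eq, ContinuousLinearMap.comp_smul, smul_sub]
      rw [e, norm_smul, Real.norm_of_nonneg hΛ, one_mul]
      have k := (hy.dag s t s.2.1 hst t.2.2).trans (ha s t hst)
      exact (mul_le_of_le_one_left (norm_nonneg _) (inv_le_one_of_one_le₀ hD.one_le)).trans k
    · have e : v' s (D.x t - D.x s) = f (y s) (z.dag s (x.first t - x.first s)) := by
        simp only [v', hD.zd_eq, hD.x_eq, ← smul_sub, ContinuousLinearMap.comp_apply, map_smul,
          smul_apply, smul_inv_smul₀ hD.pos.ne']
      rw [e, one_mul]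
      refine (hy.sharp s t s.2.1 hst t.2.2).trans ?_
      rw [← hD.a_eq]
      have := mul_le_mul_of_nonneg_left (ha s t hst) (D.a_nonneg hst)
      rw [← hD.a_eq] at this
      linarith
  have hbd : ∃ c, D.Bd c (fun t : Icc a b => y t) v' := by
    refine ⟨1 + (‖y a‖ + M), ?_⟩
    have h0 : 0 ≤ ‖y a‖ + M := by positivity
    refine ⟨fun t => ?_, fun t => (htame.dag t).trans (by linarith), fun s t hst =>
      (htame.dag_sub s t hst).trans (mul_le_mul_of_nonneg_right (by linarith) (D.b_nonneg hst)),
      fun s t hst => (htame.sharp s t hst).trans (mul_le_mul_of_nonneg_right (by linarith)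
        (mul_nonneg (D.a_nonneg hst) (D.b_nonneg hst)))⟩
    have k1 := hy.path a t le_rfl t.2.1 t.2.2
    have k2 := ha D.o t (D.control.bot_le t)
    rw [hD.o_eq] at k2
    have k3 := D.b_le_one (D.control.bot_le t)
    calc ‖y t‖ = ‖y a + (y t - y a)‖ := by congr 1; abel
      _ ≤ ‖y a‖ + ‖y t - y a‖ := norm_add_le _ _
      _ ≤ _ := by linarith
  let v : D.Path V := Driver.Path.mk _ v' hbd
  refine ⟨v, htame, ?_, fun t => rfl⟩
  obtain ⟨C, θ, hθ, hC⟩ := h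
  have key : (fun t : Icc a b => y t - y a) = Driver.intVal (Driver.nem f v) := by
    refine Driver.eq_of_norm_sub_germ_le (D := D)
      (Ξ := D.germ (Driver.nem f v).val (Driver.nem f v).dag) (C := C) (θ := θ) hθ D.one_lt
      (fun s t hst => ?_) (fun s t hst => Driver.norm_intVal_sub_le _ hst) ?_
    · rw [hD.ω_eq, Driver.germ, Driver.val_nem hf hγ hγ', Driver.dag_nem hf hγ hγ']
      have := hC s t s.2.1 hst t.2.2
      simp only [v, v', Driver.Path.val_mk, Driver.Path.dag_mk, hD.lift_zb, hD.z_eq,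
        sub_sub_sub_cancel_right]
      exact this
    · rw [Driver.intVal_zero, hD.o_eq, sub_self]
  ext t : 2
  · change y t = y a + Driver.intVal (Driver.nem f v) t
    rw [← key]
    simp
  · rw [Driver.Path.dag_add, Pi.add_apply, Driver.Path.dag_const, zero_add, Driver.picard,
      Driver.dag_integral, Driver.val_nem hf hγ hγ']
    rfl

end IsDilation

end

/-! ### The global flow by composition of local flows -/

theorem HolderOne.mono {E F : Type*} [NormedAddCommGroup E] [NormedSpace ℝ E]
    [NormedAddCommGroup F] [NormedSpace ℝ F] {γ K K' : ℝ} {g : E → F} (hg : HolderOne γ K g)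
    (h : K ≤ K') : HolderOne γ K' g where
  diff := hg.diff
  norm_le u := (hg.norm_le u).trans h
  norm_fderiv_le u := (hg.norm_fderiv_le u).trans h
  holder u v := (hg.holder u v).trans
    (mul_le_mul_of_nonneg_right h (Real.rpow_nonneg (norm_nonneg _) _))

/-- A vector field `f` of class `C^{k+1+γ}`, with a bound `K` for its first derivatives, and the
admissible parameters of the flow along `f`. -/
structure FlowData {V W : Type*} [NormedAddCommGroup V] [NormedSpace ℝ V]
    [NormedAddCommGroup W] [NormedSpace ℝ W] (k : ℕ) (γ κ K : ℝ) (f : V → W →L[ℝ] V) : Prop where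
  one_le : 1 ≤ k
  γ_pos : 0 < γ
  γ_le : γ ≤ 1
  κ_pos : 0 < κ
  κ_lt : κ < 1
  holder : IsHolderClassOn (k + 1) γ f univ
  zero : HolderOne γ K f
  one : HolderOne γ K (fderiv ℝ f)

namespace FlowData

section

variable {V W : Type*} [NormedAddCommGroup V] [NormedSpace ℝ V]
  [NormedAddCommGroup W] [NormedSpace ℝ W] {k : ℕ} {γ κ K : ℝ} {f : V → W →L[ℝ] V}

theorem exists_of_isHolderClassOn (hk : 1 ≤ k) (hγ : 0 < γ) (hγ' : γ ≤ 1) (hκ : 0 < κ)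
    (hκ' : κ < 1) (hf : IsHolderClassOn (k + 1) γ f univ) : ∃ K, FlowData k γ κ K f := by
  obtain ⟨k, rfl⟩ := Nat.exists_eq_succ_of_ne_zero (by omega : k ≠ 0)
  obtain ⟨K, -, hK⟩ := hf.exists_holderOne hγ hγ'
  obtain ⟨K', -, hK'⟩ := hf.fderiv.exists_holderOne hγ hγ'
  exact ⟨max K K', hk, hγ, hγ', hκ, hκ', hf, hK.mono (le_max_left _ _),
    hK'.mono (le_max_right _ _)⟩

variable (F : FlowData k γ κ K f)
include F

theorem α_pos : 0 < (1 - κ) * γ := mul_pos (sub_pos.2 F.κ_lt) F.γ_pos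

theorem α_le : (1 - κ) * γ ≤ 1 :=
  mul_le_one₀ (by linarith [F.κ_pos]) F.γ_pos.le F.γ_le

theorem τ_pos : 0 < κ * γ := mul_pos F.κ_pos F.γ_pos

theorem τ_lt : κ * γ < 1 :=
  (mul_le_of_le_one_right F.κ_pos.le F.γ_le).trans_lt F.κ_lt

theorem τ_le : κ * γ ≤ γ := mul_le_of_le_one_left F.γ_pos.le F.κ_lt.le

variable {ι U : Type*} [LinearOrder ι] [NormedAddCommGroup U] [NormedSpace ℝ U]
  {D : Driver ι U W} [CompleteSpace V] (hτ : D.τ = κ * γ)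
include hτ

theorem hasFDerivAt_picard (y : D.Path V) :
    HasFDerivAt (D.picard f) (Driver.picardDeriv f y) y := by
  obtain ⟨k, rfl⟩ := Nat.exists_eq_succ_of_ne_zero (by have := F.one_le; omega : k ≠ 0)
  have hc : Continuous (Driver.nem (fderiv ℝ f) : D.Path V → D.Path (V →L[ℝ] W →L[ℝ] V)) :=
    continuous_iff_continuousAt.2 fun y => (Driver.holderDiffAt_nem F.γ_pos F.γ_le F.κ_pos
      F.κ_lt hτ k F.holder.fderiv y).1.continuousAt
  have hf2 : ContDiff ℝ 2 f := (isHolderClassOn_univ_iff.1 F.holder).1.of_le (by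
    exact_mod_cast (by omega : 2 ≤ k + 1 + 1))
  exact (Driver.integral D V).hasFDerivAt.comp y
    (Driver.hasFDerivAt_nem F.zero F.one hf2 (hτ.trans_le F.τ_le) F.γ_le hc y)

theorem holderDiffAt_picard (y : D.Path V) : HolderDiffAt k ((1 - κ) * γ) (D.picard f) y :=
  (Driver.holderDiffAt_nem F.γ_pos F.γ_le F.κ_pos F.κ_lt hτ k F.holder y).clm_comp
    (Driver.integral D V)

end

variable {T : ℝ} {ω : ℝ → ℝ → ℝ} {p : ℝ} {U V W : Type*}
  [NormedAddCommGroup U] [NormedSpace ℝ U] [NormedAddCommGroup V] [NormedSpace ℝ V]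
  [CompleteSpace V] [NormedAddCommGroup W] [NormedSpace ℝ W]
  {x : RoughPath T ω p U} {z : CRP x p (p / 2) W} {zb : ℝ → ℝ → ProjTensor U W}
  {a b C₀ : ℝ} {k : ℕ} {γ κ K : ℝ} {f : V → W →L[ℝ] V}

/-- `φ` is a family of solutions on `[a, b]` which depends regularly on the value at `a`. -/
structure IsFlow (z : CRP x p (p / 2) W) (zb : ℝ → ℝ → ProjTensor U W) (f : V → W →L[ℝ] V)
    (k : ℕ) (α a b : ℝ) (φ : V → ℝ → V) : Prop where
  init : ∀ v, φ v a = v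
  davie : ∀ v, DavieOn z zb f a b (φ v)
  holder : ∀ t ∈ Icc a b, ∀ v, HolderDiffAt k α (fun v => φ v t) v
  isUnit : ∀ t ∈ Icc a b, ∀ v, IsUnit (fderiv ℝ (fun v => φ v t) v)

variable (F : FlowData k γ κ K f) (hω : IsControl T ω) (hp : 2 ≤ p) (R : RoughBounds z zb C₀)
  (hκγ : p < 2 + κ * γ)
include F hω hp R hκγ

/-- No prior solution has to be tamed, so the driver is taken with `M = 0`. -/
theorem exists_local_flow : ∃ δ > 0, ∀ a b, 0 ≤ a → a ≤ b → b ≤ T → b - a ≤ δ →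
    ∃ φ, IsFlow z zb f k ((1 - κ) * γ) a b φ := by
  obtain ⟨δ, hδ, h⟩ := exists_dilatedDriver hω hp R F.τ_pos F.τ_lt hκγ K 0
  refine ⟨δ, hδ, fun a b h0 hab hbT hd => ?_⟩
  obtain ⟨D, Λ, hD, hS, hτ, -⟩ := h a b h0 hab hbT hd
  have hγ : D.τ ≤ γ := hτ.trans_le F.τ_le
  have hder := F.hasFDerivAt_picard hτ
  choose Y hY hfix using Driver.exists_picard_fixed hS F.zero hγ F.γ_le F.one hder
  have hdv := fun v => hD.davieOn_of_fixed F.zero hγ F.γ_le (hfix v) hab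
  have hho : ∀ t : Icc a b, ∀ v, HolderDiffAt k ((1 - κ) * γ) (fun v => (Y v).val t) v :=
    fun t v => (Driver.holderDiffAt_picard_fixed hS F.zero hγ F.γ_le F.one hder F.α_pos F.α_le
      F.one_le (F.holderDiffAt_picard hτ) hY hfix v).clm_comp (Driver.Path.ev D V t)
  refine ⟨fun v t => (Y v).val (projIcc a b hab t), fun v => ?_, fun v => (hdv v).2,
    fun t _ v => hho _ v, fun t _ v => ?_⟩
  · have e := (hdv v).1
    rw [show D.o = ⟨a, left_mem_Icc.2 hab⟩ from Subtype.ext hD.o_eq] at e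
    rwa [projIcc_left]
  · refine Driver.isUnit_of_hasFDerivAt_flow hS F.zero hγ F.γ_le F.one hder
      (fun v => (hY v).mono one_le_two) hfix (projIcc a b hab t)
      ((hho (projIcc a b hab t) v).1.differentiableAt ?_).hasFDerivAt
    have : k ≠ 0 := by have := F.one_le; omega
    exact_mod_cast this

/-- The step `δ` depends on the bounds of the two given solutions. They are then compared on
successive intervals of that length, where both are tame fixed points with the same initial value.
-/
theorem eqOn_of_davieOn {y v : ℝ → V} (h0 : 0 ≤ a) (hbT : b ≤ T) (hy : DavieOn z zb f a b y)
    (hv : DavieOn z zb f a b v) (hyv : y a = v a) : EqOn y v (Icc a b) := by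
  obtain ⟨C, hC⟩ := hy.exists_bounds hω hp R F.zero h0 hbT
  obtain ⟨C', hC'⟩ := hv.exists_bounds hω hp R F.zero h0 hbT
  obtain ⟨δ, hδ, h⟩ := exists_dilatedDriver hω hp R F.τ_pos F.τ_lt hκγ K (max C C')
  have key : ∀ n : ℕ, ∀ t ∈ Icc a b, t ≤ a + n * δ → y t = v t := by
    intro n
    induction n with
    | zero =>
      intro t ht htn
      rw [show t = a by apply le_antisymm _ ht.1; simpa using htn]
      exact hyv
    | succ n ih =>
      intro t ht htn
      push_cast at htn
      have hn : 0 ≤ n * δ := by positivity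
      -- The minimum treats points already reached, where `u = t`, like the new ones.
      set u := min t (a + n * δ)
      have hau : a ≤ u := le_min ht.1 (by linarith)
      have hut : u ≤ t := min_le_left _ _
      have hd : t - u ≤ δ := by
        rcases min_choice t (a + n * δ) with h | h <;> simp only [u, h] <;> linarith
      obtain ⟨D, Λ, hD, hS, hτ, hM⟩ := h u t (h0.trans hau) hut (ht.2.trans hbT) hd
      have hγ : D.τ ≤ γ := hτ.trans_le F.τ_le
      obtain ⟨Y, hY, hYf, hYv⟩ := hD.exists_fixed_of_davieOn F.zero hγ F.γ_le hS hM
        (hC.mono hω (le_max_left _ _) h0 hbT hau ht.2) (hy.mono hau ht.2)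
      obtain ⟨Z, hZ, hZf, hZv⟩ := hD.exists_fixed_of_davieOn F.zero hγ F.γ_le hS hM
        (hC'.mono hω (le_max_right _ _) h0 hbT hau ht.2) (hv.mono hau ht.2)
      rw [← ih u ⟨hau, hut.trans ht.2⟩ (min_le_right _ _)] at hZf
      have := Driver.picard_fixed_unique hS F.zero hγ F.γ_le F.one (F.hasFDerivAt_picard hτ)
        (hY.mono one_le_two) (hZ.mono one_le_two) hYf hZf
      rw [← hYv ⟨t, right_mem_Icc.2 hut⟩, ← hZv ⟨t, right_mem_Icc.2 hut⟩, this]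
  intro t ht
  obtain ⟨n, hn⟩ := exists_nat_ge ((t - a) / δ)
  rw [div_le_iff₀ hδ] at hn
  exact key n t ht (by linarith)

omit hκγ in
theorem IsFlow.concat (hp' : p < 3) {u : ℝ} (h0 : 0 ≤ a) (hau : a ≤ u) (hub : u ≤ b)
    (hbT : b ≤ T) {φ ψ : V → ℝ → V} (hφ : IsFlow z zb f k ((1 - κ) * γ) a u φ)
    (hψ : IsFlow z zb f k ((1 - κ) * γ) u b ψ) :
    IsFlow z zb f k ((1 - κ) * γ) a b fun v t => if t ≤ u then φ v t else ψ (φ v u) t := by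
  have e1 : ∀ {t}, t ≤ u → (fun v => if t ≤ u then φ v t else ψ (φ v u) t) = fun v => φ v t :=
    fun h => funext fun v => if_pos h
  have e2 : ∀ {t}, ¬ t ≤ u →
      (fun v => if t ≤ u then φ v t else ψ (φ v u) t) = fun v => ψ (φ v u) t :=
    fun h => funext fun v => if_neg h
  have hu : u ∈ Icc a u := ⟨hau, le_rfl⟩
  have hk : (k : WithTop ℕ∞) ≠ 0 := by
    have : k ≠ 0 := by have := F.one_le; omega
    exact_mod_cast this
  have hk1 : ((1 : ℕ) : WithTop ℕ∞) ≤ k := by exact_mod_cast F.one_le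
  refine ⟨fun v => by simp only [if_pos hau, hφ.init], fun v => ?_, fun t ht v => ?_,
    fun t ht v => ?_⟩
  · refine DavieOn.concat hω hp R F.zero F.one hp' h0 hbT hau hub
      ((hφ.davie v).congr fun t ht => if_pos ht.2) ((hψ.davie (φ v u)).congr fun t ht => ?_)
    -- At the junction itself the definition uses the first flow, which agrees with the second there
    -- by its initial condition.
    rcases ht.1.eq_or_lt with rfl | h
    · simp only [if_pos le_rfl, hψ.init]
    · exact if_neg h.not_ge
  · by_cases h : t ≤ u
    · rw [e1 h]
      exact hφ.holder t ⟨ht.1, h⟩ v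
    · rw [e2 h]
      exact HolderDiffAt.comp F.α_pos F.α_le k (g := fun v => ψ v t) (f := fun v => φ v u)
        (hψ.holder t ⟨(not_le.1 h).le, ht.2⟩ _) (hφ.holder u hu v)
        (Or.inl ((hφ.holder u hu v).1.of_le hk1))
  · by_cases h : t ≤ u
    · rw [e1 h]
      exact hφ.isUnit t ⟨ht.1, h⟩ v
    · rw [e2 h]
      have ht' : t ∈ Icc u b := ⟨(not_le.1 h).le, ht.2⟩
      have := fderiv_comp v (g := fun v => ψ v t) (f := fun v => φ v u)
        ((hψ.holder t ht' _).1.differentiableAt hk) ((hφ.holder u hu v).1.differentiableAt hk)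
      rw [Function.comp_def] at this
      rw [this]
      exact (hψ.isUnit t ht' _).mul (hφ.isUnit u hu v)

theorem exists_flow (hp' : p < 3) (hT : 0 ≤ T) : ∃ φ, IsFlow z zb f k ((1 - κ) * γ) 0 T φ := by
  obtain ⟨δ, hδ, h⟩ := F.exists_local_flow hω hp R hκγ
  have key : ∀ n : ℕ, ∀ b, 0 ≤ b → b ≤ T → b ≤ n * δ →
      ∃ φ, IsFlow z zb f k ((1 - κ) * γ) 0 b φ := by
    intro n
    induction n with
    | zero =>
      intro b hb hbT hbn
      exact h 0 b le_rfl hb hbT (by simp at hbn; linarith)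
    | succ n ih =>
      intro b hb hbT hbn
      push_cast at hbn
      have hn : 0 ≤ n * δ := by positivity
      have hub : min b (n * δ) ≤ b := min_le_left _ _
      have h0u : 0 ≤ min b (n * δ) := le_min hb hn
      have hd : b - min b (n * δ) ≤ δ := by
        rcases min_choice b (n * δ) with h | h <;> rw [h] <;> linarith
      obtain ⟨φ, hφ⟩ := ih _ h0u (hub.trans hbT) (min_le_right _ _)
      obtain ⟨ψ, hψ⟩ := h _ b h0u hub hbT hd
      exact ⟨_, IsFlow.concat F hω hp R hp' le_rfl h0u hub hbT hφ hψ⟩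
  obtain ⟨n, hn⟩ := exists_nat_ge (T / δ)
  rw [div_le_iff₀ hδ] at hn
  exact key n T hT le_rfl hn

end FlowData

/-! ### Solutions in the sense of rough integrals -/

section

variable {T : ℝ} {ω : ℝ → ℝ → ℝ} {p : ℝ} {U V W : Type*}
  [NormedAddCommGroup U] [NormedSpace ℝ U] [NormedAddCommGroup V] [NormedSpace ℝ V]
  [CompleteSpace V] [NormedAddCommGroup W] [NormedSpace ℝ W]
  {x : RoughPath T ω p U} {z : CRP x p (p / 2) W} {zb : ℝ → ℝ → ProjTensor U W}
  {f : V → W →L[ℝ] V}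

/-- A solution comes with its own iterated integral; uniqueness (`IsFlat.eq`) replaces it by the
fixed `zb`, so that all solutions share one local expansion. -/
theorem IsRDESolution.davieOn (hω : IsControl T ω) (hT : 0 < T) (hzb : IsFlat z zb) {a : V}
    {y : CRP x p (p / 2) V} (h : IsRDESolution z f a 0 y) :
    DavieOn z zb f 0 T y.path ∧ y.path 0 = a ∧
      ∀ t ∈ Icc 0 T, y.dag t = (f (y.path t)).comp (z.dag t) := by
  obtain ⟨⟨J, ⟨hJ0, zb', hzb', θ, hθ, C, hC⟩, hJ⟩, hd⟩ := h
  simp only [zero_apply, add_zero] at hJ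
  have hd' : ∀ t ∈ Icc 0 T, y.dag t = (f (y.path t)).comp (z.dag t) := fun t ht => by
    rw [hd t ht, ContinuousLinearMap.zero_comp, add_zero]
  refine ⟨⟨C, θ, hθ, fun s t hs hst ht => ?_⟩, ?_, hd'⟩
  · have hs' : s ∈ Icc 0 T := ⟨hs, hst.trans ht⟩
    have := hC s t hs hst ht
    dsimp only at this
    rw [hd' s hs', ← hzb.eq hω hT hzb' hs hst ht, sub_sub _ (f (y.path s) _)] at this
    rw [hJ t ⟨hs.trans hst, ht⟩, hJ s hs', add_sub_add_left_eq_sub, rdeGerm]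
    exact this
  · rw [hJ 0 (left_mem_Icc.2 hT.le), hJ0, add_zero]

theorem DavieOn.exists_isRDESolution (hω : IsControl T ω) (hp : 2 ≤ p) {C γ K : ℝ}
    (hzb : IsFlat z zb) (R : RoughBounds z zb C) (hf : HolderOne γ K f) {y : ℝ → V}
    (h : DavieOn z zb f 0 T y) :
    ∃ Y : CRP x p (p / 2) V, Y.path = y ∧ IsRDESolution z f (y 0) 0 Y := by
  obtain ⟨M, hM⟩ := h.exists_bounds hω hp R hf le_rfl le_rfl
  obtain ⟨C', θ, hθ, h⟩ := h
  refine ⟨⟨y, fun t => (f (y t)).comp (z.dag t), ⟨M, hM.dag⟩, M, fun s t hs hst ht => ?_⟩, rfl,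
    ⟨fun t => y t - y 0, ⟨sub_self _, zb, hzb, θ, hθ, C', fun s t hs hst ht => ?_⟩,
      fun t _ => ?_⟩, fun t _ => ?_⟩
  · rw [hω.rpow_two_div hp hs hst ht]
    exact hM.sharp s t hs hst ht
  · have := h s t hs hst ht
    rw [rdeGerm, ← sub_sub] at this
    simpa only [sub_sub_sub_cancel_right] using this
  · simp
  · simp

end
theorem mainTheorem6 {U V W : Type*}
    [NormedAddCommGroup U] [NormedSpace ℝ U] [CompleteSpace U]
    [NormedAddCommGroup V] [NormedSpace ℝ V] [CompleteSpace V]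
    [NormedAddCommGroup W] [NormedSpace ℝ W] [CompleteSpace W]
    (T : ℝ) (hT : 0 < T) (ω : ℝ → ℝ → ℝ) (hω : IsControl T ω)
    (p : ℝ) (hp : 2 ≤ p) (hp' : p < 3)
    (k : ℕ) (hk : 1 ≤ k) (γ : ℝ) (hγ : 0 < γ) (hγ' : γ ≤ 1)
    (κ : ℝ) (hκ : 0 < κ) (hκ' : κ < 1) (hκγ : p < 2 + κ * γ)
    (x : RoughPath T ω p U) (z : CRP x p (p / 2) W)
    (f : V → W →L[ℝ] V) (hf : IsHolderClassOn (k + 1) γ f Set.univ) :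
    ∃ I : V → CRP x p (p / 2) V,
      (∀ a, IsRDESolution z f a 0 (I a)) ∧
      (∀ a y, IsRDESolution z f a 0 y →
        Set.EqOn y.path (I a).path (Set.Icc 0 T) ∧ Set.EqOn y.dag (I a).dag (Set.Icc 0 T)) ∧
      ∀ t ∈ Set.Ioc 0 T, IsLocalHolderDiffeo k ((1 - κ) * γ) fun a => (I a).path t := by
  obtain ⟨K, F⟩ := FlowData.exists_of_isHolderClassOn hk hγ hγ' hκ hκ' hf
  obtain ⟨zb, hzb, C₀, R⟩ := exists_flat hω hT hp hp' z
  obtain ⟨φ, hφ⟩ := F.exists_flow hω hp R hκγ hp' hT.le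
  have hsol := fun a => (hφ.davie a).exists_isRDESolution hω hp hzb R F.zero
  simp only [hφ.init] at hsol
  choose I hI hI' using hsol
  refine ⟨I, hI', fun a y hy => ?_, fun t ht => ?_⟩
  · obtain ⟨h1, h2, h3⟩ := hy.davieOn hω hT hzb
    obtain ⟨g1, g2, g3⟩ := (hI' a).davieOn hω hT hzb
    have hpath := F.eqOn_of_davieOn hω hp R hκγ le_rfl le_rfl h1 g1 (h2.trans g2.symm)
    -- The derivative needs no separate argument: it is `f(y) z†`, a function of the path.
    exact ⟨hpath, fun t ht => by rw [h3 t ht, g3 t ht, hpath ht]⟩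
  · have ht' : t ∈ Set.Icc 0 T := ⟨ht.1.le, ht.2⟩
    simp only [hI]
    exact isLocalHolderDiffeo_of_holderDiffAt F.one_le F.α_pos F.α_le (hφ.holder t ht')
      (hφ.isUnit t ht')
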